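/- Let $m\ge 2$, $N=2^m$, $n=N/2$, let $M\ge 1$ be the number of receive antennas, and write $(a)^+=\max\{a,0\}$ and $f(n,M)=n^2-((n-M)^+)^2$. Consider codes with $T=N$ channel uses and $K=2(n^2+1)=\frac{N^2}{2}+2$ weight matrices in $\mathbb{C}^{N\times N}$, linearly independent over $\mathbb{R}$ and divided into two groups $\mathcal{G}_1,\mathcal{G}_2$ of $n^2+1$ matrices each, such that: every weight matrix is $\mathrm{diag}(\mathbf{V}_1,\mathbf{V}_2)$ with unitary $\mathbf{V}_1,\mathbf{V}_2\in\mathbb{C}^{n\times n}$; $\mathbf{V}_1$ is the same for all matrices of $\mathcal{G}_1$; $\mathbf{V}_2$ is the same for all matrices of $\mathcal{G}_2$; and the two groups of real symbols can be ML decoded independently, i.e. for every channel matrix $\mathbf{H}$ and received matrix $\mathbf{Y}$, $\|\mathbf{Y}-\sum_i x_i\mathbf{A}_i\mathbf{H}\|_F^2$ is a function of the symbols of the first group plus a function of those of the second group. (This is the structure of the 2-group ML decodable codes of Srinath and Rajan.) Let $\mathbf{H}\in\mathbb{C}^{N\times M}$ and the noise $\mathbf{W}\in\mathbb{C}^{N\times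 M}$ have i.i.d. circularly symmetric complex Gaussian entries of mean $0$ and variance $1$, let $\mathbf{G}\in\mathbb{R}^{2MN\times K}$ be the equivalent channel matrix, whose $i$-th column lists the real and imaginary parts of the entries of $\mathbf{A}_i\mathbf{H}$, and let $\mathbf{G}_1,\mathbf{G}_2$ be its submatrices for the two groups. Such codes exist, and every such code satisfies the following. 1. Its rate is $R=\frac{K}{2T}=\frac N4+\frac1N$. 2. With probability $1$, $\mathrm{rank}(\mathbf{G}_1)=\mathrm{rank}(\mathbf{G}_2)=f(N/2,M)+1$ and $\mathrm{rank}(\mathbf{G})=2\left(\frac{N^2}{4}-\left(\left(\frac N2-M\right)^+\right)^2+1\right)$. 3. If $\lceil R\rceil\le M<\frac N2$, the code is singular for $M$ receive antennas, i.e. $M\ge R$ and $\mathrm{rank}(\mathbf{G})<K$ with probability $1$. 4. Let $\boldsymbol\Theta_1,\boldsymbol\Theta_2$ be invertible real matrices of size $n^2+1$ and $\rho_0>0$. For a nonempty finite alphabet $\mathcal{A}_q\subset\mathbb{Z}$ with $q$ elements, let the symbols of group $k$ be $\boldsymbol\Theta_k\mathbf{s}_k$ with $\mathbf{s}_k\in\mathcal{A}_q^{n^2+1}$,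 and decode each group $k=1,2$ from $\mathbf{y}$, the vector of real and imaginary parts of the received matrix $\mathbf{Y}$, by the following sphere decoder. Take a decomposition $\mathbf{G}_k\boldsymbol\Theta_k\mathbf{P}=\mathbf{Q}[\mathbf{R}_a\ \mathbf{R}_b]$ with $\mathbf{P}$ a permutation matrix, $\mathbf{Q}$ having orthonormal columns and $\mathbf{R}_a$ upper triangular, invertible, of size $\mathrm{rank}(\mathbf{G}_k)$. For each value $\mathbf{s}_b$ of the symbols belonging to $\mathbf{R}_b$, search the tree of the remaining symbols, decided from the last one to the first, keeping the partial vectors whose partial distance $\left(\sum_{i\ge j}(\mathbf{Q}^T\mathbf{y}-[\mathbf{R}_a\ \mathbf{R}_b]\mathbf{P}^T\mathbf{s}_k)_i^2\right)^{1/2}$ is at most the radius, where $j$ is the index of the last decided symbol. Do this with radii $\rho_0,2\rho_0,4\rho_0,\dots$ until some complete vector is found, and output a closest vector found in that last search. Then for every $\mathbf{H}$ and every $\mathbf{Y}$ (and every choice of the decompositions) the two outputs exist and together form an ML estimate over all pairs $(\mathbf{s}_1,\mathbf{s}_2)$. The average complexity is $\mathcal{O}\left(q^{((N/2-M)^+)^2}\right)$: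 there is a constant $C$, depending only on the code, $M$, $\boldsymbol\Theta_1,\boldsymbol\Theta_2$ and $\rho_0$, such that for every $\mathcal{A}_q$, every transmitted pair $(\mathbf{s}_1,\mathbf{s}_2)$ and every choice of the decompositions, the expectation over $\mathbf{H}$ and $\mathbf{W}$ of the total number of visited tree nodes (values of $\mathbf{s}_b$ and partial vectors kept, over all searches and both groups), when $\mathbf{Y}=\mathbf{X}\mathbf{H}+\mathbf{W}$ with $\mathbf{X}$ the transmitted codeword, is at most $C\,q^{((N/2-M)^+)^2}$. -/

import Mathlib

open MeasureTheory ProbabilityTheory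
open scoped NNReal ENNReal

noncomputable section

namespace STBC

/-! ### Rayleigh fading: matrices with i.i.d. circularly symmetric Gaussian entries -/

/-- The circularly symmetric complex Gaussian law with mean zero and unit variance: real and
imaginary parts are independent real Gaussians of variance one half. -/
def complexGaussian : Measure ℂ :=
  ((gaussianReal 0 (1 / 2)).prod (gaussianReal 0 (1 / 2))).map Complex.measurableEquivRealProd.symm

/-- The law of a matrix with i.i.d. entries distributed as `complexGaussian`. -/
def gaussianMatrix (τ μ : Type) [Fintype τ] [Fintype μ] : Measure (τ → μ → ℂ) :=
  Measure.pi fun _ => Measure.pi fun _ => complexGaussian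

/-! ### Linear space-time block codes -/

section Codes

variable {κ τ ν μ : Type} [Fintype κ] [Fintype τ] [Fintype ν] [Fintype μ]

/-- Column stacking of the real part followed by column stacking of the imaginary part. -/
def vecTilde (X : Matrix τ μ ℂ) : (μ × τ) ⊕ (μ × τ) → ℝ :=
  Sum.elim (X.map Complex.re).vec (X.map Complex.im).vec

/-- The codeword `∑ xᵢ Aᵢ` of the real information symbols `x` for the weight matrices `A`. -/
def codeword (A : κ → Matrix τ ν ℂ) (x : κ → ℝ) : Matrix τ ν ℂ :=
  ∑ i, (x i : ℂ) • A i

/-- The equivalent channel matrix, whose `i`-th column is `vecTilde (Aᵢ H)`. -/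
def equivChannel (A : κ → Matrix τ ν ℂ) (H : Matrix ν μ ℂ) :
    Matrix ((μ × τ) ⊕ (μ × τ)) κ ℝ :=
  Matrix.of fun r i => vecTilde (A i * H) r

/-- The square of the Frobenius norm. -/
def frobSq (X : Matrix τ μ ℂ) : ℝ := ∑ i, ∑ j, ‖X i j‖ ^ 2

/-- The rate `K / (2T)` in complex symbols per channel use. -/
def rate (_A : κ → Matrix τ ν ℂ) : ℚ := (Fintype.card κ : ℚ) / (2 * Fintype.card τ)

/-- A code is singular for `M` receive antennas if `M ≥ R` and the equivalent channel matrix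
has rank less than the number `K` of real symbols with probability one. -/
def IsSingular (A : κ → Matrix τ ν ℂ) (M : ℕ) : Prop :=
  rate A ≤ M ∧ ∀ᵐ H ∂gaussianMatrix ν (Fin M),
    (equivChannel A (Matrix.of H)).rank < Fintype.card κ

/-- The symbols form two groups which can be ML decoded independently of each other: for every
channel realization and every received matrix, the ML metric is a sum of two functions, each
depending on the symbols of one group only. -/
def IsTwoGroupMLDecodable {κ₁ κ₂ : Type} [Fintype κ₁] [Fintype κ₂]
    (A : κ₁ ⊕ κ₂ → Matrix τ ν ℂ) : Prop :=
  ∀ (M : ℕ) (H : Matrix ν (Fin M) ℂ) (Y : Matrix τ (Fin M) ℂ),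
    ∃ (φ₁ : (κ₁ → ℝ) → ℝ) (φ₂ : (κ₂ → ℝ) → ℝ), ∀ (x₁ : κ₁ → ℝ) (x₂ : κ₂ → ℝ),
      frobSq (Y - codeword A (Sum.elim x₁ x₂) * H) = φ₁ x₁ + φ₂ x₂

end Codes

/-- The two-group codes for `N = T = 2n` antennas: `2(n² + 1)` real-linearly independent,
block-diagonal weight matrices with unitary `n × n` blocks, in two groups of `n² + 1` which can
be ML decoded independently; the first block is constant on the first group and the second
block is constant on the second group. -/
structure IsTwoGroupBlockCode (n : ℕ)
    (A : Fin (n ^ 2 + 1) ⊕ Fin (n ^ 2 + 1) → Matrix (Fin n ⊕ Fin n) (Fin n ⊕ Fin n) ℂ) : Prop where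
  linearIndependent : LinearIndependent ℝ A
  firstGroup : ∃ F₁ ∈ Matrix.unitaryGroup (Fin n) ℂ, ∀ j, ∃ V₂ ∈ Matrix.unitaryGroup (Fin n) ℂ,
    A (Sum.inl j) = Matrix.fromBlocks F₁ 0 0 V₂
  secondGroup : ∃ F₂ ∈ Matrix.unitaryGroup (Fin n) ℂ, ∀ j, ∃ V₁ ∈ Matrix.unitaryGroup (Fin n) ℂ,
    A (Sum.inr j) = Matrix.fromBlocks V₁ 0 0 F₂
  twoGroup : IsTwoGroupMLDecodable A

/-- The information symbols `x = Θ s` of the two groups, for integer vectors `s₁` and `s₂`. -/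
def latticeSymbols {L : ℕ} (Θ₁ Θ₂ : Matrix (Fin L) (Fin L) ℝ) (s₁ s₂ : Fin L → ℤ) :
    Fin L ⊕ Fin L → ℝ :=
  Sum.elim (Θ₁.mulVec fun i => (s₁ i : ℝ)) (Θ₂.mulVec fun i => (s₂ i : ℝ))

/-- The function `f(n, m) = n² - ((n - m)⁺)²`, with values in the integers. -/
def f (n m : ℕ) : ℤ := (n : ℤ) ^ 2 - (max ((n : ℤ) - m) 0) ^ 2

/-! ### The sphere decoder for possibly rank-deficient channels -/

/-- A QR decomposition of the column-permuted matrix `B`, of the form `Q [R_a R_b]` with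
orthonormal columns of `Q` and with `R_a` square, upper triangular, invertible and of size
`rank B`. -/
structure PivotedQR {ι : Type} [Fintype ι] {L : ℕ} (B : Matrix ι (Fin L) ℝ) where
  perm : Equiv.Perm (Fin L)
  Q : Matrix ι (Fin B.rank) ℝ
  R : Matrix (Fin B.rank) (Fin L) ℝ
  orthonormal : Q.transpose * Q = 1
  factorization : B.submatrix id perm = Q * R
  upper : ∀ (i : Fin B.rank) (j : Fin L), (j : ℕ) < i → R i j = 0
  diag_ne_zero : ∀ (i : Fin B.rank) (j : Fin L), (j : ℕ) = i → R i j ≠ 0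

theorem rank_eq_finrank_span_toLp {ι : Type} [Fintype ι] {L : ℕ} (B : Matrix ι (Fin L) ℝ) :
    B.rank = Module.finrank ℝ (Submodule.span ℝ
      (Set.range fun j => (WithLp.toLp 2 (B.col j) : EuclideanSpace ℝ ι))) := by
  rw [Matrix.rank_eq_finrank_span_cols]
  have h := LinearEquiv.finrank_map_eq (WithLp.linearEquiv 2 ℝ (ι → ℝ)).symm
    (Submodule.span ℝ (Set.range B.col))
  rw [← h, Submodule.map_span, ← Set.range_comp]
  rfl

/-- Every real matrix has such a decomposition. -/
theorem PivotedQR.nonempty {ι : Type} [Fintype ι] {L : ℕ} (B : Matrix ι (Fin L) ℝ) :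
    Nonempty (PivotedQR B) := by
  classical
  let b : Fin L → EuclideanSpace ℝ ι := fun j => WithLp.toLp 2 (B.col j)
  obtain ⟨v, hv, hspan, hli⟩ := Submodule.exists_fun_fin_finrank_span_eq ℝ (Set.range b)
  have hr : B.rank = Module.finrank ℝ (Submodule.span ℝ (Set.range b)) := rank_eq_finrank_span_toLp B
  let v' : Fin B.rank → EuclideanSpace ℝ ι := v ∘ Fin.cast hr
  have hli' : LinearIndependent ℝ v' := hli.comp _ (Fin.cast_injective hr)
  have hspan' : Submodule.span ℝ (Set.range v') = Submodule.span ℝ (Set.range b) := by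
    rw [← hspan]; congr 1
    exact (Fin.castOrderIso hr).surjective.range_comp v
  choose g hg using fun i => hv (Fin.cast hr i)
  have hginj : Function.Injective g := fun i j hij =>
    hli'.injective (by change v (Fin.cast hr i) = v (Fin.cast hr j); rw [← hg, ← hg, hij])
  have hle : B.rank ≤ L := by simpa using B.rank_le_card_width
  obtain ⟨σ, hσ⟩ := Equiv.Perm.exists_extending_pair (Fin.castLE hle) g
    (Fin.castLE_injective hle) hginj
  have hσ' : ∀ i, σ (Fin.castLE hle i) = g i := fun i => hσ i
  let q : Fin B.rank → EuclideanSpace ℝ ι := InnerProductSpace.gramSchmidtNormed ℝ v'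
  have hq : Orthonormal ℝ q := InnerProductSpace.gramSchmidtNormed_orthonormal hli'
  have hqspan : Submodule.span ℝ (Set.range q) = Submodule.span ℝ (Set.range b) := by
    rw [InnerProductSpace.span_gramSchmidtNormed_range, InnerProductSpace.span_gramSchmidt, hspan']
  have hb : ∀ (i : Fin B.rank) (j : Fin L) (hj : (j : ℕ) ≤ i), b (σ j) = v' ⟨j, lt_of_le_of_lt hj i.2⟩ := by
    intro i j hij
    have h := hg ⟨j, lt_of_le_of_lt hij i.2⟩
    rw [← hσ'] at h
    exact h
  refine ⟨⟨σ, Matrix.of fun x i => q i x, Matrix.of fun i j => inner ℝ (q i) (b (σ j)),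
    ?_, ?_, ?_, ?_⟩⟩
  · ext i j
    have := (orthonormal_iff_ite.mp hq) i j
    rw [Matrix.one_apply, ← this]
    simp [Matrix.mul_apply, PiLp.inner_apply, mul_comm]
  · ext x j
    have hmem : b (σ j) ∈ Submodule.span ℝ (Set.range q) :=
      hqspan ▸ Submodule.subset_span ⟨_, rfl⟩
    obtain ⟨c, hc⟩ := (Submodule.mem_span_range_iff_exists_fun ℝ).mp hmem
    have hc' : ∀ i, inner ℝ (q i) (b (σ j)) = c i := fun i => by
      rw [← hc]; exact hq.inner_right_fintype c i
    have := congrArg (fun w : EuclideanSpace ℝ ι => w x) hc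
    simp only [Matrix.mul_apply, Matrix.of_apply, hc', Matrix.submatrix_apply, id]
    simpa [b, mul_comm] using this.symm
  · intro i j hij
    have h := InnerProductSpace.gramSchmidt_inv_triangular ℝ v' (i := ⟨j, by omega⟩) (j := i) hij
    simp only [Matrix.of_apply, hb i j hij.le, q, InnerProductSpace.gramSchmidtNormed,
      inner_smul_left, h, mul_zero]
  · intro i j hij h0
    have hj : (⟨j, by omega⟩ : Fin B.rank) = i := Fin.ext hij
    rw [Matrix.of_apply, hb i j hij.le, hj] at h0
    have hne := InnerProductSpace.gramSchmidt_ne_zero i hli'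
    have hz : inner ℝ (InnerProductSpace.gramSchmidt ℝ v' i) (v' i) = 0 := by
      simpa [q, InnerProductSpace.gramSchmidtNormed, inner_smul_left, hne] using h0
    rw [InnerProductSpace.gramSchmidt_def'' ℝ v' i, inner_add_right, inner_sum,
      Finset.sum_eq_zero, add_zero] at hz
    · exact hne (inner_self_eq_zero.mp hz)
    · intro k hk
      rw [inner_smul_right, InnerProductSpace.gramSchmidt_orthogonal ℝ v'
        (Finset.mem_Iio.mp hk).ne', mul_zero]

namespace PivotedQR

variable {ι : Type} [Fintype ι] {L : ℕ} {B : Matrix ι (Fin L) ℝ}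

/-- Partial symbol vectors at level `k`: the permuted symbols with index `≥ k` are decided. -/
abbrev Partial (L k : ℕ) : Type := {j : Fin L // k ≤ (j : ℕ)} → ℤ

/-- The squared partial distance of a partial vector at level `k`, from the rows `≥ k` of
`Qᵀ y - R u`; these rows of `R` vanish on the undecided symbols. -/
def partialDist (D : PivotedQR B) (y : ι → ℝ) (k : ℕ) (u : Partial L k) : ℝ :=
  ∑ i : Fin B.rank, if k ≤ (i : ℕ) then
    (D.Q.transpose.mulVec y i - ∑ j : {j : Fin L // k ≤ (j : ℕ)}, D.R i j * (u j : ℝ)) ^ 2 else 0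

/-- The nodes of the search tree visited at level `k` for the search radius `ρ`: partial vectors
with entries in the alphabet whose partial distance is at most `ρ`. Level `rank B` consists of
all values of the symbols `s_b` which multiply `R_b`; for each of them the levels below are
the ordinary sphere decoding tree of `R_a`. Partial distances increase from a node to its
children, so that every ancestor of a visited node is visited. -/
def nodes (D : PivotedQR B) (y : ι → ℝ) (S : Finset ℤ) (ρ : ℝ) (k : ℕ) : Finset (Partial L k) :=
  (Fintype.piFinset fun _ => S).filter fun u => D.partialDist y k u ≤ ρ ^ 2

/-- Number of nodes visited in one search with radius `ρ`. -/
def searchSteps (D : PivotedQR B) (y : ι → ℝ) (S : Finset ℤ) (ρ : ℝ) : ℕ :=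
  ∑ k ∈ Finset.range (B.rank + 1), (D.nodes y S ρ k).card

/-- The search is repeated with radii `ρ₀, 2ρ₀, 4ρ₀, …` until the sphere contains a point; this
is the index of the last search. -/
def lastSearch (D : PivotedQR B) (y : ι → ℝ) (S : Finset ℤ) (ρ₀ : ℝ) : ℕ :=
  sInf {t : ℕ | (D.nodes y S (ρ₀ * 2 ^ t) 0).Nonempty}

/-- The total number of nodes visited by the sphere decoder, over all searches. -/
def steps (D : PivotedQR B) (y : ι → ℝ) (S : Finset ℤ) (ρ₀ : ℝ) : ℕ :=
  ∑ t ∈ Finset.range (D.lastSearch y S ρ₀ + 1), D.searchSteps y S (ρ₀ * 2 ^ t)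

/-- The possible outputs of the sphere decoder: the points found in the last search at the
smallest distance (several in the case of a tie), with the column permutation undone. -/
def outputs (D : PivotedQR B) (y : ι → ℝ) (S : Finset ℤ) (ρ₀ : ℝ) : Set (Fin L → ℤ) :=
  {s | (fun j => s (D.perm j.1)) ∈ D.nodes y S (ρ₀ * 2 ^ D.lastSearch y S ρ₀) 0 ∧
    ∀ u ∈ D.nodes y S (ρ₀ * 2 ^ D.lastSearch y S ρ₀) 0,
      D.partialDist y 0 (fun j => s (D.perm j.1)) ≤ D.partialDist y 0 u}

end PivotedQR

end STBC

end

noncomputable section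

namespace STBC

/-! ### Counting lattice points -/

section Counting

variable {ι α : Type*} [Fintype ι] [DecidableEq ι] [Fintype α]

/-! Structure and rank. At `Y = 0`, two-group decodability says that the signals of the two groups
are orthogonal for every channel, so all products `Aᵢᴴ Aⱼ` across the groups are skew-Hermitian.
Read block by block, each group consists of matrices diag(F, G Wⱼ), up to exchanging the blocks,
with F, G fixed unitaries and Wⱼ skew-Hermitian (`IsTwoGroupBlockCode.isHalfGroup`). The n² + 1
independent pairs (1, Wⱼ) form a basis of ℝ × 𝔲(n), so in suitable coordinates the equivalent
channel of a group is (a, U) ↦ (a F H₁, G U H₂), with H₁, H₂ the two halves of H. Almost surely its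
kernel is the space of U in 𝔲(n) with U H₂ = 0, of dimension ((n - M)⁺)². Ranks of the two groups
add by orthogonality. Codes exist because the pairs (1, W) with W unitary and skew-Hermitian span ℝ
× 𝔲(n).

ML decoding. Orthogonality splits the metric into one term per group, and a QR decomposition changes
each term only by a constant.

Complexity. The bound must be uniform over all pivotings, including those for which R_a is badly
conditioned. Hence the number of nodes is compared with an arbitrary r × r minor of R, where r is
the rank: nodes times minor is at most a polynomial in the channel size and the radius times q^(L -
r) (`PivotedQR.card_nodes_mul_le`). Multilinearity passes from minors of R to det(X B Z) with
bounded X, Z (`PivotedQR.exists_abs_det_le`). Choosing X, Z from a Gram–Schmidt basis of the columns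
of H₂ makes this determinant triangular, with value |entry of H₁| times the product of d_j^(2(n - j)
- 1) over j < min(M, n), where d_j is the distance of column j from the span of the earlier ones
(`IsHalfGroup.exists_det_eq`). Given the earlier columns, d_j dominates the norm of a Gaussian
vector of real dimension 2(n - j), so this inverse power, one below the dimension, has a bounded
mean (`lintegral_prod_columnDist_inv_ne_top`). The last radius is at most linear in the noise norm,
and all polynomial factors in H and the noise are absorbed by the weights exp(|z|²/2), which the
density exp(-|z|²)/π can afford. -/

/-- The determinant is linear in row `i`, so it is a sum of `card α` terms, each at most `b` times
the largest of the new determinants. -/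
theorem exists_abs_det_le_updateRow [Nonempty α] (M : Matrix ι ι ℝ) (i : ι) (c : α → ℝ)
    (v : α → ι → ℝ) (hM : M i = ∑ a, c a • v a) {b : ℝ} (hc : ∀ a, |c a| ≤ b) :
    ∃ a, |M.det| ≤ Fintype.card α * b * |(M.updateRow i (v a)).det| := by
  obtain ⟨a, ha⟩ := Finite.exists_max fun a => |(M.updateRow i (v a)).det|
  refine ⟨a, ?_⟩
  have h : M.det = ∑ a, c a * (M.updateRow i (v a)).det := by
    have key : ∀ N : ι → ι → ℝ, N i = ∑ a, c a • v a → Matrix.detRowAlternating N =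
        ∑ a, c a * Matrix.detRowAlternating (Function.update N i (v a)) := by
      intro N hN
      have h1 := (Matrix.detRowAlternating (n := ι) (R := ℝ)).toMultilinearMap.map_update_sum
        Finset.univ i (fun a => c a • v a) N
      rw [← hN, Function.update_eq_self] at h1
      simpa only [AlternatingMap.coe_multilinearMap, AlternatingMap.map_update_smul,
        smul_eq_mul] using h1
    exact key M hM
  rw [h]
  calc |∑ a, c a * (M.updateRow i (v a)).det| ≤ ∑ a, |c a * (M.updateRow i (v a)).det| :=
        Finset.abs_sum_le_sum_abs _ _
    _ ≤ ∑ _a : α, b * |(M.updateRow i (v a)).det| := by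
        refine Finset.sum_le_sum fun a' _ => ?_
        rw [abs_mul]
        exact mul_le_mul (hc a') (ha a') (abs_nonneg _) ((abs_nonneg _).trans (hc a'))
    _ = _ := by simp [mul_assoc]

/-- Expanding some rows of a determinant by multilinearity, one of the terms is large. -/
theorem exists_abs_det_le_piecewise [Nonempty α] (M : Matrix ι ι ℝ) (c : ι → α → ℝ)
    (v : ι → α → ι → ℝ) {b : ℝ} (A : Finset ι) (hM : ∀ i ∈ A, M i = ∑ a, c i a • v i a)
    (hc : ∀ i ∈ A, ∀ a, |c i a| ≤ b) :
    ∃ g : ι → α, |M.det| ≤ (Fintype.card α * b) ^ A.card *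
      |(Matrix.of fun i => if i ∈ A then v i (g i) else M i).det| := by
  induction A using Finset.induction_on with
  | empty => exact ⟨fun _ => Classical.arbitrary α, by simp; rfl⟩
  | insert i A hi ih =>
    obtain ⟨g, hg⟩ := ih (fun j hj => hM j (Finset.mem_insert_of_mem hj))
      (fun j hj => hc j (Finset.mem_insert_of_mem hj))
    set N : Matrix ι ι ℝ := Matrix.of fun i => if i ∈ A then v i (g i) else M i with hN
    obtain ⟨a, ha⟩ := exists_abs_det_le_updateRow N i (c i) (v i)
      (by rw [← hM i (Finset.mem_insert_self i A)]; ext j; simp [hN, hi])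
      (hc i (Finset.mem_insert_self i A))
    have hb : 0 ≤ b := (abs_nonneg _).trans (hc i (Finset.mem_insert_self i A) a)
    refine ⟨Function.update g i a, ?_⟩
    have hE : (Matrix.of fun j => if j ∈ insert i A then v j (Function.update g i a j) else M j)
        = N.updateRow i (v i a) := by
      ext j l
      by_cases hj : j = i
      · subst hj; simp
      · simp [hj, hN, Matrix.updateRow_apply]
    rw [hE, Finset.card_insert_of_notMem hi, pow_succ, mul_assoc]
    exact hg.trans (mul_le_mul_of_nonneg_left ha (by positivity))

/-- A packing bound for the integer points which a square matrix maps into a box. -/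
theorem card_mul_abs_det_le (M : Matrix ι ι ℝ) {b ρ : ℝ} (hb : ∀ i j, |M i j| ≤ b)
    (hb0 : 0 ≤ b) (hρ : 0 ≤ ρ) (z : ι → ℝ) (U : Finset (ι → ℤ))
    (hU : ∀ u ∈ U, ∀ i, |z i - M.mulVec (fun j => (u j : ℝ)) i| ≤ ρ) :
    (U.card : ℝ) * |M.det| ≤ (2 * (ρ + Fintype.card ι * b)) ^ Fintype.card ι := by
  by_cases hdet : M.det = 0
  · rw [hdet, abs_zero, mul_zero]; positivity
  -- Unit cubes based at the points of `U` are disjoint, with total volume `U.card`. Moving inside a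
  -- cube changes a coordinate of the image by at most `card ι * b`, so all cubes lie in the
  -- preimage of a box of side `2 * c`, whose volume is that of the box divided by `|det M|`.
  let cube : (ι → ℤ) → Set (ι → ℝ) := fun u => Set.pi Set.univ fun j => Set.Ico (u j : ℝ) (u j + 1)
  set c : ℝ := ρ + Fintype.card ι * b
  have hc : 0 ≤ c := by positivity
  let box : Set (ι → ℝ) := Set.pi Set.univ fun i => Set.Icc (z i - c) (z i + c)
  have hsub : (⋃ u ∈ U, cube u) ⊆ (Matrix.toLin' M) ⁻¹' box := by
    intro x hx
    simp only [Set.mem_iUnion] at hx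
    obtain ⟨u, hu, hx⟩ := hx
    simp only [Set.mem_preimage, box, Set.mem_univ_pi, Matrix.toLin'_apply]
    intro i
    have h1 := hU u hu i
    have h2 : |M.mulVec x i - M.mulVec (fun j => (u j : ℝ)) i| ≤ Fintype.card ι * b := by
      simp only [Matrix.mulVec, dotProduct, ← Finset.sum_sub_distrib, ← mul_sub]
      refine (Finset.abs_sum_le_sum_abs _ _).trans ?_
      calc ∑ j, |M i j * (x j - u j)| ≤ ∑ _j : ι, b := by
            refine Finset.sum_le_sum fun j _ => ?_
            have := hx j (Set.mem_univ j)
            simp only [Set.mem_Ico] at this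
            rw [abs_mul]
            calc |M i j| * |x j - u j| ≤ b * 1 := by
                  refine mul_le_mul (hb i j) ?_ (abs_nonneg _) hb0
                  rw [abs_le]; constructor <;> linarith
              _ = b := mul_one b
        _ = _ := by simp
    rw [abs_le] at h1 h2
    simp only [Set.mem_Icc, c]
    constructor <;> linarith [h1.1, h1.2, h2.1, h2.2]
  have hdisj : Set.PairwiseDisjoint (U : Set (ι → ℤ)) cube := by
    intro u _ v _ huv
    rw [Function.onFun, Set.disjoint_left]
    intro x hx hx'
    refine huv (funext fun j => ?_)
    have h1 := hx j (Set.mem_univ j)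
    have h2 := hx' j (Set.mem_univ j)
    rw [← Int.floor_eq_iff.mpr h1, ← Int.floor_eq_iff.mpr h2]
  have hvol : volume (⋃ u ∈ U, cube u) = U.card := by
    rw [measure_biUnion_finset hdisj
      (fun u _ => MeasurableSet.univ_pi fun j => measurableSet_Ico)]
    simp [cube, Real.volume_pi_Ico]
  have hbox : volume box = ENNReal.ofReal ((2 * c) ^ Fintype.card ι) := by
    simp only [box]
    rw [volume_pi_pi]
    simp [Real.volume_Icc, add_sub_sub_cancel, ← two_mul, ENNReal.ofReal_pow (mul_nonneg two_pos.le hc)]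
  have h := measure_mono (μ := volume) hsub
  rw [hvol, Measure.addHaar_preimage_linearMap _ (by rwa [LinearMap.det_toLin']),
    LinearMap.det_toLin', hbox, ← ENNReal.ofReal_mul (abs_nonneg _),
    ← ENNReal.ofReal_natCast, ENNReal.ofReal_le_ofReal_iff (by positivity), abs_inv] at h
  rwa [inv_mul_eq_div, le_div_iff₀ (abs_pos.mpr hdet)] at h

end Counting

/-- At level `k` only the rows `≥ k` constrain a node. In a nonzero minor, the rows `< k` can be
traded for unit vectors at a bounded cost; what remains is an invertible system in at least `r - k`
of the `L - k` decided symbols. These are counted by packing and the other, at most `L - r`, symbols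
are free. The column selection `f` is arbitrary, so the bound does not depend on the conditioning of
the leading triangular block. -/
theorem card_partial_mul_abs_det_le {r L k : ℕ} (hk : k ≤ r) (hr : r ≤ L)
    (R : Matrix (Fin r) (Fin L) ℝ) (hR : ∀ (i : Fin r) (j : Fin L), (j : ℕ) < i → R i j = 0)
    {b ρ : ℝ} (hb : ∀ i j, |R i j| ≤ b) (hb1 : 1 ≤ b) (hρ : 0 ≤ ρ) (f : Fin r → Fin L)
    (z : Fin r → ℝ) (S : Finset ℤ) (hS : S.Nonempty)
    (U : Finset (PivotedQR.Partial L k)) (hUS : ∀ u ∈ U, ∀ j, u j ∈ S)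
    (hU : ∀ u ∈ U, ∀ i : Fin r, k ≤ (i : ℕ) →
      |z i - ∑ j : {j : Fin L // k ≤ (j : ℕ)}, R i j * (u j : ℝ)| ≤ ρ) :
    (U.card : ℝ) * |(R.submatrix id f).det| ≤
      (r * b) ^ r * (2 * (ρ + r * b)) ^ r * (S.card : ℝ) ^ (L - r) := by
  classical
  have hb0 : 0 ≤ b := zero_le_one.trans hb1
  by_cases hdet : (R.submatrix id f).det = 0
  · rw [hdet, abs_zero, mul_zero]; positivity
  have hq1 : (1 : ℝ) ≤ S.card := by exact_mod_cast hS.card_pos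
  set A : Finset (Fin r) := Finset.univ.filter fun i => (i : ℕ) < k with hA
  have hAcard : A.card = k := by
    rw [hA, Fin.card_filter_val_lt, min_eq_right hk]
  obtain hr0 | hr0 := Nat.eq_zero_or_pos r
  · subst hr0
    obtain rfl : k = 0 := by omega
    have : U.card ≤ S.card ^ L := by
      calc U.card ≤ (Fintype.piFinset fun _ : {j : Fin L // 0 ≤ (j : ℕ)} => S).card :=
            Finset.card_le_card fun u hu => Fintype.mem_piFinset.mpr (hUS u hu)
        _ = S.card ^ L := by simp
    simp only [Matrix.det_isEmpty, abs_one, mul_one, pow_zero, Nat.sub_zero, one_mul]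
    exact_mod_cast this
  have : Nonempty (Fin r) := ⟨⟨0, hr0⟩⟩
  -- Each row `i < k` is a combination of unit vectors with coefficients at most `b`; the expansion
  -- picks the unit vector at `g i` and costs a factor `r * b` per row.
  obtain ⟨g, hg⟩ := exists_abs_det_le_piecewise (R.submatrix id f) (fun i a => R i (f a))
    (fun _ a => Pi.single a 1) (b := b) A
    (fun i _ => by
      ext j; simp [Finset.sum_apply, Pi.single_apply])
    (fun i _ a => hb _ _)
  set M : Matrix (Fin r) (Fin r) ℝ :=
    Matrix.of fun i => if i ∈ A then Pi.single (g i) 1 else R.submatrix id f i with hMdef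
  have hMA : ∀ i j : Fin r, (i : ℕ) < k → M i j = if j = g i then 1 else 0 := by
    intro i j hi; simp [hMdef, hA, hi, Pi.single_apply]
  have hMR : ∀ i j : Fin r, k ≤ (i : ℕ) → M i j = R i (f j) := by
    intro i j hi; simp [hMdef, hA, not_lt.mpr hi]
  have hMdet : M.det ≠ 0 := by
    intro h0
    rw [h0, abs_zero, mul_zero] at hg
    exact hdet (abs_nonpos_iff.mp hg)
  have hMb : ∀ i j, |M i j| ≤ b := by
    intro i j
    rcases lt_or_ge (i : ℕ) k with hi | hi
    · rw [hMA i j hi]; split_ifs <;> simp [hb1, hb0]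
    · rw [hMR i j hi]; exact hb _ _
  -- The columns of `M` on which all unit rows vanish: they carry the system formed by the rows `≥
  -- k`.
  set J : Finset (Fin r) := (A.image g)ᶜ with hJ
  have hgJ : ∀ i : Fin r, (i : ℕ) < k → g i ∉ J := by
    intro i hi
    simp only [hJ, Finset.mem_compl, not_not]
    exact Finset.mem_image_of_mem _ (by simp [hA, hi])
  have hne : ∀ j ∈ J, ∀ i : Fin r, (i : ℕ) < k → j ≠ g i := by
    rintro j hj i hi rfl
    exact hgJ i hi hj
  have hJk : ∀ j ∈ J, k ≤ (f j : ℕ) := by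
    intro j hj
    by_contra hlt
    -- If `f j < k`, the column also vanishes in the rows `≥ k`, by triangularity of `R`. Hence
    -- columns in `J` come from decided symbols.
    refine hMdet (Matrix.det_eq_zero_of_column_eq_zero j fun i => ?_)
    rcases lt_or_ge (i : ℕ) k with hi | hi
    · rw [hMA i j hi, if_neg (hne j hj i hi)]
    · rw [hMR i j hi]; exact hR _ _ (by omega)
  have hJcard : r - k ≤ J.card := by
    rw [hJ, Finset.card_compl, Fintype.card_fin]
    have := (Finset.card_image_le (s := A) (f := g))
    omega
  let fJ : {j // j ∈ J} → {j : Fin L // k ≤ (j : ℕ)} := fun j => ⟨f j, hJk j j.2⟩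
  have hfJ : Function.Injective fJ := by
    intro j j' h
    by_contra hjj
    have hff : f j = f j' := congrArg Subtype.val h
    refine hMdet (Matrix.det_zero_of_column_eq (fun h => hjj (Subtype.ext h)) fun i => ?_)
    rcases lt_or_ge (i : ℕ) k with hi | hi
    · rw [hMA i _ hi, hMA i _ hi, if_neg (hne _ j.2 i hi), if_neg (hne _ j'.2 i hi)]
    · rw [hMR i _ hi, hMR i _ hi, hff]
  set T : Finset {j : Fin L // k ≤ (j : ℕ)} := Finset.univ.image fJ with hT
  have hTcard : T.card = J.card := by
    rw [hT, Finset.card_image_of_injective _ hfJ]; simp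
  have hP : Fintype.card {j : Fin L // k ≤ (j : ℕ)} = L - k := by
    rw [Fintype.card_subtype]
    have h1 := Finset.card_filter_add_card_filter_not (s := (Finset.univ : Finset (Fin L)))
      (fun j => (j : ℕ) < k)
    rw [Fin.card_filter_val_lt, Finset.card_univ, Fintype.card_fin] at h1
    simp only [not_lt] at h1
    omega
  -- The nodes are fibred over the symbols outside `T`. Within a fibre a node is determined by its
  -- symbols in `T`; `ext` places these in the columns `J` and puts zero elsewhere, so the unit rows
  -- of `M` evaluate to zero.
  let π : PivotedQR.Partial L k → ({j // j ∉ T} → ℤ) := fun u j => u j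
  let ext : PivotedQR.Partial L k → (Fin r → ℤ) := fun u j => if h : j ∈ J then u (fJ ⟨j, h⟩) else 0
  have hfiber : ∀ t ∈ U.image π,
      ((U.filter fun u => π u = t).card : ℝ) * |M.det| ≤ (2 * (ρ + r * b)) ^ r := by
    intro t _
    have hinj : Set.InjOn ext (U.filter fun u => π u = t) := by
      intro u hu v hv huv
      simp only [Finset.coe_filter, Set.mem_ofPred_eq] at hu hv
      funext p
      by_cases hp : p ∈ T
      · obtain ⟨j, -, rfl⟩ := Finset.mem_image.mp hp
        have := congrFun huv j
        simpa [ext, j.2] using this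
      · exact congrFun (hu.2.trans hv.2.symm) ⟨p, hp⟩
    rw [← Finset.card_image_of_injOn hinj]
    have := card_mul_abs_det_le M hMb hb0 hρ
      (fun i => if (i : ℕ) < k then 0 else z i - ∑ j : {j // j ∉ T}, R i j.1 * (t j : ℝ))
      ((U.filter fun u => π u = t).image ext) ?_
    · simpa using this
    intro v hv i
    obtain ⟨u, hu, rfl⟩ := Finset.mem_image.mp hv
    rw [Finset.mem_filter] at hu
    rcases lt_or_ge (i : ℕ) k with hi | hi
    · have : M.mulVec (fun j => (ext u j : ℝ)) i = 0 := by
        simp only [Matrix.mulVec, dotProduct, hMA i _ hi]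
        simp [ext, hgJ i hi]
      simp [this, hi, hρ]
    · have h1 : M.mulVec (fun j => (ext u j : ℝ)) i = ∑ p ∈ T, R i p * (u p : ℝ) := by
        simp only [Matrix.mulVec, dotProduct, hMR i _ hi]
        rw [hT, Finset.sum_image (fun _ _ _ _ h => hfJ h)]
        rw [← Finset.sum_subset (Finset.subset_univ J)
          (fun j _ hj => by simp [ext, hj]), ← Finset.sum_coe_sort J]
        refine Finset.sum_congr rfl fun j _ => ?_
        simp [ext, j.2, fJ]
      have h2 : ∑ j : {j // j ∉ T}, R i j.1 * (t j : ℝ) = ∑ p ∈ Tᶜ, R i p * (u p : ℝ) := by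
        rw [← hu.2, Finset.sum_subtype (p := fun j => j ∉ T) Tᶜ (by simp)]
      rw [if_neg (not_lt.mpr hi), h1, h2, sub_sub, add_comm, Finset.sum_add_sum_compl]
      exact hU u hu.1 i hi
  have himg : (U.image π).card ≤ S.card ^ (L - r) := by
    calc (U.image π).card ≤ (Fintype.piFinset fun _ : {j // j ∉ T} => S).card := by
          refine Finset.card_le_card fun t ht => ?_
          obtain ⟨u, hu, rfl⟩ := Finset.mem_image.mp ht
          exact Fintype.mem_piFinset.mpr fun j => hUS u hu j
      _ = S.card ^ (L - k - J.card) := by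
          rw [Fintype.card_piFinset, Finset.prod_const, Finset.card_univ,
            Fintype.card_subtype_compl, hP, Fintype.card_coe, hTcard]
      _ ≤ S.card ^ (L - r) := Nat.pow_le_pow_right hS.card_pos (by omega)
  have hcount : (U.card : ℝ) * |M.det| ≤ (2 * (ρ + r * b)) ^ r * (S.card : ℝ) ^ (L - r) := by
    rw [Finset.card_eq_sum_card_image π U, Nat.cast_sum, Finset.sum_mul]
    calc _ ≤ ∑ t ∈ U.image π, (2 * (ρ + r * b)) ^ r := Finset.sum_le_sum hfiber
      _ = (2 * (ρ + r * b)) ^ r * (U.image π).card := by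
          rw [Finset.sum_const, nsmul_eq_mul, mul_comm]
      _ ≤ _ := by
          gcongr
          exact_mod_cast himg
  have hrb : (1 : ℝ) ≤ r * b := by
    have : (1 : ℝ) ≤ r := by exact_mod_cast hr0
    nlinarith
  calc (U.card : ℝ) * |(R.submatrix id f).det|
      ≤ U.card * ((Fintype.card (Fin r) * b) ^ A.card * |M.det|) := by gcongr
    _ = (r * b) ^ k * (U.card * |M.det|) := by rw [hAcard, Fintype.card_fin]; ring
    _ ≤ (r * b) ^ r * ((2 * (ρ + r * b)) ^ r * (S.card : ℝ) ^ (L - r)) := by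
        gcongr
    _ = _ := by ring

/-! ### The sphere decoder: node counts against minors, exactness, total cost -/

namespace PivotedQR

variable {ι : Type} [Fintype ι] {L : ℕ} {B : Matrix ι (Fin L) ℝ} (D : PivotedQR B)

end PivotedQR

namespace PivotedQR

variable {ι : Type} [Fintype ι] {L : ℕ} {B : Matrix ι (Fin L) ℝ} (D : PivotedQR B)

theorem abs_Q_le_one (x : ι) (i : Fin B.rank) : |D.Q x i| ≤ 1 := by
  have h := congrFun (congrFun D.orthonormal i) i
  simp only [Matrix.mul_apply, Matrix.transpose_apply, Matrix.one_apply_eq] at h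
  have : D.Q x i * D.Q x i ≤ 1 := by
    rw [← h]
    exact Finset.single_le_sum (f := fun x => D.Q x i * D.Q x i)
      (fun x _ => mul_self_nonneg _) (Finset.mem_univ x)
  rw [← sq_le_one_iff_abs_le_one, sq]
  exact this

theorem R_eq : D.R = D.Q.transpose * B.submatrix id D.perm := by
  rw [D.factorization, ← Matrix.mul_assoc, D.orthonormal, Matrix.one_mul]

theorem abs_R_le {β : ℝ} (hB : ∀ x j, |B x j| ≤ β) (i : Fin B.rank) (j : Fin L) :
    |D.R i j| ≤ Fintype.card ι * β := by
  rw [D.R_eq, Matrix.mul_apply]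
  refine (Finset.abs_sum_le_sum_abs _ _).trans ?_
  calc _ ≤ ∑ _x : ι, β := by
        refine Finset.sum_le_sum fun x _ => ?_
        rw [abs_mul, Matrix.transpose_apply, Matrix.submatrix_apply]
        calc _ ≤ 1 * β := mul_le_mul (D.abs_Q_le_one x i) (hB _ _) (abs_nonneg _) zero_le_one
          _ = β := one_mul β
    _ = _ := by simp

omit [Fintype ι] in
theorem rank_le : B.rank ≤ L := by simpa using B.rank_le_card_width

theorem mul_eq {α : Type*} (Z : Matrix (Fin L) α ℝ) :
    B * Z = D.Q * (D.R * Z.submatrix D.perm id) := by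
  rw [← Matrix.mul_assoc, ← D.factorization]
  ext x a
  simp only [Matrix.mul_apply, Matrix.submatrix_apply, id]
  exact (Equiv.sum_comp D.perm fun j => B x j * Z j a).symm

/-- Since `B = Q R` up to the permutation, the determinant factors as `det (X Q)` times the
determinant of `R` times the permuted `Z`. The first factor is bounded because entries of `Q` are at
most 1; the second is expanded into minors of `R` by multilinearity. A lower bound on one
well-chosen determinant of the channel thus reaches every pivoting. -/
theorem exists_abs_det_le (hL : 0 < L) {cX cZ : ℝ} (hcX : 0 ≤ cX)
    (X : Matrix (Fin B.rank) ι ℝ) (Z : Matrix (Fin L) (Fin B.rank) ℝ)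
    (hX : ∀ i x, |X i x| ≤ cX) (hZ : ∀ j i, |Z j i| ≤ cZ) :
    ∃ g : Fin B.rank → Fin L, |(X * B * Z).det| ≤
      (B.rank.factorial * (Fintype.card ι * cX) ^ B.rank) * (L * cZ) ^ B.rank *
        |(D.R.submatrix id g).det| := by
  have : Nonempty (Fin L) := ⟨⟨0, hL⟩⟩
  obtain ⟨g, hg⟩ := exists_abs_det_le_piecewise (D.R * Z.submatrix D.perm id).transpose
    (fun i l => Z (D.perm l) i) (fun _ l => D.R.transpose l) (b := cZ) Finset.univ
    (fun i _ => by
      ext j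
      simp [Matrix.mul_apply, Finset.sum_apply, mul_comm])
    (fun i _ l => hZ _ _)
  refine ⟨g, ?_⟩
  have hg' : |(D.R * Z.submatrix D.perm id).det| ≤
      (L * cZ) ^ B.rank * |(D.R.submatrix id g).det| := by
    rw [Matrix.det_transpose] at hg
    rw [← Matrix.det_transpose (D.R.submatrix id g)]
    simp only [Finset.card_univ, Fintype.card_fin, Finset.mem_univ, if_true] at hg
    exact hg
  have hXQ : |(X * D.Q).det| ≤ B.rank.factorial * (Fintype.card ι * cX) ^ B.rank := by
    have := Matrix.det_le (A := X * D.Q) (abv := IsAbsoluteValue.toAbsoluteValue (abs : ℝ → ℝ))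
      (x := Fintype.card ι * cX) ?_
    · simpa using this
    intro i j
    change |_| ≤ _
    rw [Matrix.mul_apply]
    refine (Finset.abs_sum_le_sum_abs _ _).trans ?_
    calc _ ≤ ∑ _x : ι, cX := by
          refine Finset.sum_le_sum fun x _ => ?_
          rw [abs_mul]
          calc _ ≤ cX * 1 := mul_le_mul (hX _ _) (D.abs_Q_le_one x j) (abs_nonneg _) hcX
            _ = cX := mul_one cX
      _ = _ := by simp
  rw [Matrix.mul_assoc, D.mul_eq, ← Matrix.mul_assoc, Matrix.det_mul, abs_mul, mul_assoc]
  exact mul_le_mul hXQ hg' (abs_nonneg _) (by positivity)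

theorem card_nodes_mul_le {y : ι → ℝ} {S : Finset ℤ} (hS : S.Nonempty) {ρ b : ℝ} (hρ : 0 ≤ ρ)
    (hb : ∀ i j, |D.R i j| ≤ b) (hb1 : 1 ≤ b) {k : ℕ} (hk : k ≤ B.rank)
    (g : Fin B.rank → Fin L) :
    ((D.nodes y S ρ k).card : ℝ) * |(D.R.submatrix id g).det| ≤
      (B.rank * b) ^ B.rank * (2 * (ρ + B.rank * b)) ^ B.rank *
        (S.card : ℝ) ^ (L - B.rank) := by
  refine card_partial_mul_abs_det_le hk rank_le D.R D.upper hb hb1 hρ g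
    (D.Q.transpose.mulVec y) S hS _ ?_ ?_
  · intro u hu j
    exact Fintype.mem_piFinset.mp (Finset.mem_filter.mp hu).1 j
  · intro u hu i hi
    have h := (Finset.mem_filter.mp hu).2
    refine abs_le.mpr (abs_le_of_sq_le_sq' (le_trans ?_ h) hρ)
    unfold partialDist
    refine le_trans (le_of_eq ?_) (Finset.single_le_sum (f := fun i : Fin B.rank =>
      if k ≤ (i : ℕ) then (D.Q.transpose.mulVec y i -
        ∑ j : {j : Fin L // k ≤ (j : ℕ)}, D.R i j * (u j : ℝ)) ^ 2 else 0)
      (fun i _ => by positivity) (Finset.mem_univ i))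
    simp [hi]

/-- The column selection `g` depends on neither the level nor the radius, so one minor serves all
`B.rank + 1` levels. -/
theorem searchSteps_mul_le (hL : 0 < L) {cX cZ : ℝ} (hcX : 0 ≤ cX) (hcZ : 0 ≤ cZ)
    (X : Matrix (Fin B.rank) ι ℝ) (Z : Matrix (Fin L) (Fin B.rank) ℝ)
    (hX : ∀ i x, |X i x| ≤ cX) (hZ : ∀ j i, |Z j i| ≤ cZ)
    {y : ι → ℝ} {S : Finset ℤ} (hS : S.Nonempty) {ρ b : ℝ} (hρ : 0 ≤ ρ)
    (hb : ∀ i j, |D.R i j| ≤ b) (hb1 : 1 ≤ b) :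
    (D.searchSteps y S ρ : ℝ) * |(X * B * Z).det| ≤
      (B.rank + 1) * ((B.rank.factorial * (Fintype.card ι * cX) ^ B.rank) * (L * cZ) ^ B.rank *
      ((B.rank * b) ^ B.rank * (2 * (ρ + B.rank * b)) ^ B.rank *
        (S.card : ℝ) ^ (L - B.rank))) := by
  obtain ⟨g, hg⟩ := D.exists_abs_det_le hL hcX X Z hX hZ
  unfold searchSteps
  rw [Nat.cast_sum, Finset.sum_mul]
  calc _ ≤ ∑ _k ∈ Finset.range (B.rank + 1),
        ((B.rank.factorial * (Fintype.card ι * cX) ^ B.rank) * (L * cZ) ^ B.rank *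
        ((B.rank * b) ^ B.rank * (2 * (ρ + B.rank * b)) ^ B.rank *
        (S.card : ℝ) ^ (L - B.rank))) := by
        refine Finset.sum_le_sum fun k hk => ?_
        have hk' : k ≤ B.rank := by simpa [Nat.lt_succ_iff] using hk
        calc _ ≤ ((D.nodes y S ρ k).card : ℝ) * _ := mul_le_mul_of_nonneg_left hg (by positivity)
          _ = (B.rank.factorial * (Fintype.card ι * cX) ^ B.rank) * (L * cZ) ^ B.rank *
              (((D.nodes y S ρ k).card : ℝ) * |(D.R.submatrix id g).det|) := by ring
          _ ≤ _ := mul_le_mul_of_nonneg_left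
              (D.card_nodes_mul_le hS hρ hb hb1 hk' g) (by positivity)
    _ = _ := by simp

/-! ### The decoder minimizes the distance -/

/-- The squared distance from `y` to `B s` splits into the complete partial distance and a part
independent of `s`. -/
theorem exists_dist_eq (y : ι → ℝ) : ∃ c : ℝ, 0 ≤ c ∧ ∀ s : Fin L → ℤ,
    ∑ x, (y x - B.mulVec (fun j => (s j : ℝ)) x) ^ 2
      = D.partialDist y 0 (fun j => s (D.perm j.1)) + c := by
  refine ⟨∑ x, (y x - D.Q.mulVec (D.Q.transpose.mulVec y) x) ^ 2,
    Finset.sum_nonneg fun _ _ => sq_nonneg _, fun s => ?_⟩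
  set z : Fin B.rank → ℝ := D.Q.transpose.mulVec y
  set t : Fin B.rank → ℝ := D.R.mulVec fun j => (s (D.perm j) : ℝ)
  have hB : B.mulVec (fun j => (s j : ℝ)) = D.Q.mulVec t := by
    have h1 : B.mulVec (fun j => (s j : ℝ)) =
        (B.submatrix id D.perm).mulVec (fun j => (s (D.perm j) : ℝ)) := by
      ext x
      exact (Equiv.sum_comp D.perm fun j => B x j * (s j : ℝ)).symm
    rw [h1, D.factorization, Matrix.mulVec_mulVec]
  have hpd : D.partialDist y 0 (fun j => s (D.perm j.1)) = ∑ i, (z i - t i) ^ 2 := by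
    unfold partialDist
    refine Finset.sum_congr rfl fun i _ => ?_
    rw [if_pos (Nat.zero_le _)]
    congr 2
    let e : {j : Fin L // 0 ≤ (j : ℕ)} ≃ Fin L := Equiv.subtypeUnivEquiv fun j => Nat.zero_le _
    exact Equiv.sum_comp e fun j => D.R i j * (s (D.perm j) : ℝ)
  -- The residual of the projection onto the range of `Q` is orthogonal to that range; the splitting
  -- is Pythagoras.
  have horth : D.Q.transpose.mulVec (y - D.Q.mulVec z) = 0 := by
    rw [Matrix.mulVec_sub, Matrix.mulVec_mulVec, D.orthonormal, Matrix.one_mulVec, sub_self]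
  have hsplit : y - D.Q.mulVec t = D.Q.mulVec (z - t) + (y - D.Q.mulVec z) := by
    rw [Matrix.mulVec_sub]; abel
  have hsq : ∀ w : ι → ℝ, ∑ x, (w x) ^ 2 = w ⬝ᵥ w := fun w => by simp [dotProduct, sq]
  have hQ : D.Q.mulVec (z - t) ⬝ᵥ D.Q.mulVec (z - t) = (z - t) ⬝ᵥ (z - t) := by
    rw [Matrix.dotProduct_mulVec, Matrix.vecMul_mulVec, D.orthonormal, Matrix.vecMul_one]
  have hcross : D.Q.mulVec (z - t) ⬝ᵥ (y - D.Q.mulVec z) = 0 := by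
    rw [← Matrix.vecMul_transpose, ← Matrix.dotProduct_mulVec, horth, dotProduct_zero]
  calc _ = (y - D.Q.mulVec t) ⬝ᵥ (y - D.Q.mulVec t) := by rw [← hsq, hB]; rfl
    _ = (z - t) ⬝ᵥ (z - t) + (y - D.Q.mulVec z) ⬝ᵥ (y - D.Q.mulVec z) := by
        rw [hsplit, add_dotProduct, dotProduct_add, dotProduct_add, hQ, hcross,
          dotProduct_comm (y - D.Q.mulVec z) (D.Q.mulVec (z - t)), hcross]
        ring
    _ = _ := by rw [← hsq (y - _), hpd]; simp [dotProduct, sq]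

theorem mem_nodes_zero {y : ι → ℝ} {S : Finset ℤ} {ρ : ℝ} {s : Fin L → ℤ} :
    (fun j : {j : Fin L // 0 ≤ (j : ℕ)} => s (D.perm j.1)) ∈ D.nodes y S ρ 0 ↔
      (∀ i, s i ∈ S) ∧ D.partialDist y 0 (fun j => s (D.perm j.1)) ≤ ρ ^ 2 := by
  rw [nodes, Finset.mem_filter, Fintype.mem_piFinset]
  refine and_congr_left fun _ => ⟨fun h i => ?_, fun h j => h _⟩
  simpa using h ⟨D.perm.symm i, Nat.zero_le _⟩

theorem lastSearch_le {y : ι → ℝ} {S : Finset ℤ} {ρ₀ : ℝ} {s : Fin L → ℤ} (hs : ∀ i, s i ∈ S)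
    {t : ℕ} (ht : D.partialDist y 0 (fun j => s (D.perm j.1)) ≤ (ρ₀ * 2 ^ t) ^ 2) :
    D.lastSearch y S ρ₀ ≤ t :=
  Nat.sInf_le ⟨_, D.mem_nodes_zero.mpr ⟨hs, ht⟩⟩

theorem nodes_lastSearch_nonempty (y : ι → ℝ) {S : Finset ℤ} (hS : S.Nonempty) {ρ₀ : ℝ}
    (hρ₀ : 0 < ρ₀) : (D.nodes y S (ρ₀ * 2 ^ D.lastSearch y S ρ₀) 0).Nonempty := by
  have : {t : ℕ | (D.nodes y S (ρ₀ * 2 ^ t) 0).Nonempty}.Nonempty := by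
    obtain ⟨a, ha⟩ := hS
    set d := D.partialDist y 0 (fun _ => a)
    obtain ⟨t, ht⟩ := pow_unbounded_of_one_lt (Real.sqrt d / ρ₀) one_lt_two
    refine ⟨t, _, D.mem_nodes_zero (s := fun _ => a) |>.mpr ⟨fun _ => ha, ?_⟩⟩
    rw [div_lt_iff₀ hρ₀, mul_comm] at ht
    exact Real.sqrt_le_left (by positivity) |>.mp ht.le
  exact Nat.sInf_mem this

theorem outputs_nonempty (y : ι → ℝ) {S : Finset ℤ} (hS : S.Nonempty) {ρ₀ : ℝ}
    (hρ₀ : 0 < ρ₀) : (D.outputs y S ρ₀).Nonempty := by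
  obtain ⟨u, hu, hmin⟩ := Finset.exists_min_image _ (D.partialDist y 0)
    (D.nodes_lastSearch_nonempty y hS hρ₀)
  have hE : (fun j : {j : Fin L // 0 ≤ (j : ℕ)} =>
      (fun i => u ⟨D.perm.symm i, Nat.zero_le _⟩ : Fin L → ℤ) (D.perm j.1)) = u := by
    funext j; simp
  refine ⟨fun i => u ⟨D.perm.symm i, Nat.zero_le _⟩, ?_, ?_⟩
  · rw [hE]; exact hu
  · rw [hE]; exact hmin

/-- Points outside the last sphere are farther than every point inside it, so minimality within the
sphere is global; partial and true squared distances differ by a constant. -/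
theorem outputs_spec {y : ι → ℝ} {S : Finset ℤ} {ρ₀ : ℝ}
    {s : Fin L → ℤ} (hs : s ∈ D.outputs y S ρ₀) : (∀ i, s i ∈ S) ∧
      ∀ s' : Fin L → ℤ, (∀ i, s' i ∈ S) →
        ∑ x, (y x - B.mulVec (fun j => (s j : ℝ)) x) ^ 2 ≤
        ∑ x, (y x - B.mulVec (fun j => (s' j : ℝ)) x) ^ 2 := by
  obtain ⟨h1, h2⟩ := hs
  rw [D.mem_nodes_zero] at h1
  refine ⟨h1.1, fun s' hs' => ?_⟩
  obtain ⟨c, -, hc⟩ := D.exists_dist_eq y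
  rw [hc, hc]
  gcongr
  by_cases hmem : D.partialDist y 0 (fun j => s' (D.perm j.1)) ≤
      (ρ₀ * 2 ^ D.lastSearch y S ρ₀) ^ 2
  · exact h2 _ (D.mem_nodes_zero.mpr ⟨hs', hmem⟩)
  · exact h1.2.trans (not_le.mp hmem).le

/-- `Q` and `B` have the same range, so a vector `v` orthogonal to the columns of `B` is invisible
to the decoder. It will be the signal of the other group, and `w` the noise. -/
theorem partialDist_zero_le {s : Fin L → ℤ} {v w : ι → ℝ} (hv : B.transpose.mulVec v = 0) :
    D.partialDist (B.mulVec (fun j => (s j : ℝ)) + v + w) 0 (fun j => s (D.perm j.1)) ≤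
      ∑ x, w x ^ 2 := by
  have hle : LinearMap.range B.mulVecLin ≤ LinearMap.range D.Q.mulVecLin := by
    rintro _ ⟨x, rfl⟩
    refine ⟨D.R.mulVec (x ∘ D.perm), ?_⟩
    rw [Matrix.mulVecLin_apply, Matrix.mulVec_mulVec, ← D.factorization]
    ext i
    exact Equiv.sum_comp D.perm fun j => B i j * x j
  have hrange : LinearMap.range B.mulVecLin = LinearMap.range D.Q.mulVecLin := by
    -- `Q` has only `B.rank` columns, so its range cannot be larger.
    refine Submodule.eq_of_le_of_finrank_le hle ?_
    have := D.Q.rank_le_card_width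
    rwa [Fintype.card_fin] at this
  have hQv : D.Q.transpose.mulVec v = 0 := by
    ext i
    have : D.Q.mulVec (Pi.single i 1) ∈ LinearMap.range B.mulVecLin := by
      rw [hrange]; exact ⟨_, rfl⟩
    obtain ⟨x, hx⟩ := this
    have h1 : D.Q.transpose.mulVec v i = D.Q.mulVec (Pi.single i 1) ⬝ᵥ v := by
      rw [Matrix.mulVec_single_one]; rfl
    rw [h1, ← hx, Matrix.mulVecLin_apply, ← Matrix.vecMul_transpose, ← Matrix.dotProduct_mulVec,
      hv, dotProduct_zero, Pi.zero_apply]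
  obtain ⟨c, hc0, hc⟩ := D.exists_dist_eq (B.mulVec (fun j => (s j : ℝ)) + w)
  have h1 := hc s
  have h2 : D.partialDist (B.mulVec (fun j => (s j : ℝ)) + v + w) 0 (fun j => s (D.perm j.1)) =
      D.partialDist (B.mulVec (fun j => (s j : ℝ)) + w) 0 (fun j => s (D.perm j.1)) := by
    unfold partialDist
    rw [Matrix.mulVec_add, Matrix.mulVec_add, Matrix.mulVec_add, hQv, add_zero]
  rw [h2]
  simp only [Pi.add_apply, add_sub_cancel_left] at h1
  linarith

/-- The total number of nodes visited, in terms of the noise level `ω`. -/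
theorem steps_mul_le (hL : 0 < L) {cX cZ : ℝ} (hcX : 0 ≤ cX) (hcZ : 0 ≤ cZ)
    (X : Matrix (Fin B.rank) ι ℝ) (Z : Matrix (Fin L) (Fin B.rank) ℝ)
    (hX : ∀ i x, |X i x| ≤ cX) (hZ : ∀ j i, |Z j i| ≤ cZ)
    {y : ι → ℝ} {S : Finset ℤ} {ρ₀ ω b : ℝ} (hρ₀ : 0 < ρ₀) (hω : 0 ≤ ω)
    (hb : ∀ i j, |D.R i j| ≤ b) (hb1 : 1 ≤ b) {s : Fin L → ℤ} (hs : ∀ i, s i ∈ S)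
    (hsω : D.partialDist y 0 (fun j => s (D.perm j.1)) ≤ ω ^ 2) :
    (D.steps y S ρ₀ : ℝ) * |(X * B * Z).det| ≤
      ((ρ₀ + 2) / ρ₀ * ((B.rank + 1) * ((B.rank.factorial * (Fintype.card ι * cX) ^ B.rank) *
        (L * cZ) ^ B.rank * (B.rank ^ B.rank * (2 * (ρ₀ + 2 + B.rank)) ^ B.rank)))) *
      ((1 + ω) ^ (B.rank + 1) * b ^ (2 * B.rank)) * (S.card : ℝ) ^ (L - B.rank) := by
  have hS : S.Nonempty := ⟨_, hs ⟨0, hL⟩⟩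
  have hstep := fun (ρ : ℝ) (hρ : 0 ≤ ρ) =>
    D.searchSteps_mul_le hL hcX hcZ X Z hX hZ (y := y) hS hρ hb hb1
  generalize |(X * B * Z).det| = δ at hstep ⊢
  clear hX hZ X Z
  set r := B.rank
  set T := D.lastSearch y S ρ₀ with hT
  -- If `T > 0`, the search with radius `ρ₀ * 2 ^ (T - 1)` missed the transmitted point, which lies
  -- at distance at most `ω`; so that radius is below `ω`.
  have hTρ : ρ₀ * 2 ^ T ≤ ρ₀ + 2 * ω := by
    rcases Nat.eq_zero_or_pos T with h0 | h0
    · rw [h0]; linarith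
    · have h1 : ¬ D.partialDist y 0 (fun j => s (D.perm j.1)) ≤ (ρ₀ * 2 ^ (T - 1)) ^ 2 := by
        intro h
        have := D.lastSearch_le hs h
        omega
      have h2 : ρ₀ * 2 ^ (T - 1) < ω := by
        have := (not_le.mp h1).trans_le hsω
        exact lt_of_pow_lt_pow_left₀ 2 hω this
      have h3 : (2 : ℝ) ^ T = 2 * 2 ^ (T - 1) := by
        rw [← pow_succ']; congr 1; omega
      rw [h3]; linarith
  set P : ℝ := (r.factorial * (Fintype.card ι * cX) ^ r) * (L * cZ) ^ r with hP
  have hP0 : 0 ≤ P := by positivity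
  have hb0 : 0 ≤ b := zero_le_one.trans hb1
  have hmax : ρ₀ + 2 * ω + r * b ≤ (ρ₀ + 2 + r) * ((1 + ω) * b) := by
    have h1 : (1 : ℝ) ≤ (1 + ω) * b := by nlinarith
    have h2 : ω ≤ (1 + ω) * b := by nlinarith
    have h3 : b ≤ (1 + ω) * b := by nlinarith
    have h4 : (0 : ℝ) ≤ r := by positivity
    nlinarith [mul_le_mul_of_nonneg_left h1 hρ₀.le, mul_le_mul_of_nonneg_left h3 h4]
  have hterm : ∀ t ∈ Finset.range (T + 1), (D.searchSteps y S (ρ₀ * 2 ^ t) : ℝ) *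
      δ ≤ (r + 1) * (P * (r ^ r * (2 * (ρ₀ + 2 + r)) ^ r)) *
        ((1 + ω) ^ r * b ^ (2 * r)) * (S.card : ℝ) ^ (L - r) := by
    intro t ht
    have htT : t ≤ T := by simpa [Nat.lt_succ_iff] using ht
    have hρt : ρ₀ * 2 ^ t ≤ ρ₀ + 2 * ω := by
      refine le_trans ?_ hTρ
      gcongr
      exact one_le_two
    refine (hstep (ρ₀ * 2 ^ t) (by positivity)).trans ?_
    calc _ ≤ (r + 1) * (P * ((r * b) ^ r * (2 * ((ρ₀ + 2 + r) * ((1 + ω) * b))) ^ r *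
        (S.card : ℝ) ^ (L - r))) := by
          gcongr
          linarith
      _ = _ := by rw [two_mul r, pow_add]; simp only [mul_pow]; ring
  -- The number of searches is at most `2 ^ T`, which is linear in `ω`; this accounts for the extra
  -- power in `(1 + ω) ^ (B.rank + 1)`.
  have hcount : ((T : ℝ) + 1) ≤ (ρ₀ + 2) / ρ₀ * (1 + ω) := by
    have h1 : (T : ℝ) + 1 ≤ 2 ^ T := by exact_mod_cast Nat.lt_two_pow_self
    have h2 : (2 : ℝ) ^ T ≤ (ρ₀ + 2 * ω) / ρ₀ := by
      rw [le_div_iff₀ hρ₀]; linarith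
    refine h1.trans (h2.trans ?_)
    rw [div_mul_eq_mul_div]
    gcongr
    nlinarith
  unfold steps
  rw [Nat.cast_sum, Finset.sum_mul]
  calc _ ≤ ∑ _t ∈ Finset.range (T + 1), (r + 1) * (P * (r ^ r * (2 * (ρ₀ + 2 + r)) ^ r)) *
        ((1 + ω) ^ r * b ^ (2 * r)) * (S.card : ℝ) ^ (L - r) := Finset.sum_le_sum hterm
    _ = ((T : ℝ) + 1) * ((r + 1) * (P * (r ^ r * (2 * (ρ₀ + 2 + r)) ^ r)) *
        ((1 + ω) ^ r * b ^ (2 * r)) * (S.card : ℝ) ^ (L - r)) := by simp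
    _ ≤ ((ρ₀ + 2) / ρ₀ * (1 + ω)) * ((r + 1) * (P * (r ^ r * (2 * (ρ₀ + 2 + r)) ^ r)) *
        ((1 + ω) ^ r * b ^ (2 * r)) * (S.card : ℝ) ^ (L - r)) := by gcongr
    _ = _ := by rw [pow_succ (1 + ω) r]; ring

end PivotedQR

/-! ### The equivalent channel and two-group decodability -/

section Codes

variable {κ κ₁ κ₂ τ ν μ : Type} [Fintype κ] [Fintype κ₁] [Fintype κ₂] [Fintype τ] [Fintype ν]
  [Fintype μ]

theorem frobSq_eq_sum_vecTilde (X : Matrix τ μ ℂ) : frobSq X = ∑ r, vecTilde X r ^ 2 := by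
  have h : ∀ z : ℂ, ‖z‖ ^ 2 = z.re ^ 2 + z.im ^ 2 := fun z => by
    rw [Complex.sq_norm, Complex.normSq_apply]; ring
  simp only [frobSq, vecTilde, Fintype.sum_sum_type, Fintype.sum_prod_type, Sum.elim_inl,
    Sum.elim_inr, Matrix.vec, Matrix.map_apply, h, Finset.sum_add_distrib]
  congr 1 <;> exact Finset.sum_comm

omit [Fintype τ] [Fintype μ] in
theorem vecTilde_add (X Y : Matrix τ μ ℂ) : vecTilde (X + Y) = vecTilde X + vecTilde Y := by
  ext r; rcases r with r | r <;> simp [vecTilde, Matrix.vec]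

omit [Fintype τ] [Fintype μ] in
theorem vecTilde_sub (X Y : Matrix τ μ ℂ) : vecTilde (X - Y) = vecTilde X - vecTilde Y := by
  ext r; rcases r with r | r <;> simp [vecTilde, Matrix.vec]

omit [Fintype τ] [Fintype μ] in
theorem vecTilde_zero : vecTilde (0 : Matrix τ μ ℂ) = 0 := by
  ext r; rcases r with r | r <;> simp [vecTilde]

omit [Fintype τ] [Fintype μ] in
theorem equivChannel_mulVec (A : κ → Matrix τ ν ℂ) (H : Matrix ν μ ℂ) (x : κ → ℝ) :
    (equivChannel A H).mulVec x = vecTilde (codeword A x * H) := by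
  have h : codeword A x * H = ∑ i, (x i : ℂ) • (A i * H) := by
    simp only [codeword, Matrix.sum_mul, Matrix.smul_mul]
  rw [h]
  ext r
  rcases r with r | r <;>
    simp [Matrix.mulVec, dotProduct, equivChannel, vecTilde, Matrix.vec, Matrix.sum_apply, mul_comm]

omit [Fintype τ] [Fintype ν] in
theorem codeword_sumElim (A : κ₁ ⊕ κ₂ → Matrix τ ν ℂ) (x₁ : κ₁ → ℝ) (x₂ : κ₂ → ℝ) :
    codeword A (Sum.elim x₁ x₂) = codeword (A ∘ Sum.inl) x₁ + codeword (A ∘ Sum.inr) x₂ := by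
  simp [codeword, Fintype.sum_sum_type]

omit [Fintype τ] [Fintype ν] in
theorem codeword_zero (A : κ → Matrix τ ν ℂ) : codeword A 0 = 0 := by simp [codeword]

/-- The mixed second difference of `φ₁ x₁ + φ₂ x₂` vanishes, while that of the squared norm is twice
the inner product. -/
theorem dotProduct_eq_zero_of_additive {ι : Type*} [Fintype ι] {V₁ V₂ : Type*} [Zero V₁] [Zero V₂]
    {a : V₁ → ι → ℝ} {b : V₂ → ι → ℝ} (ha : a 0 = 0) (hb : b 0 = 0) {φ₁ : V₁ → ℝ} {φ₂ : V₂ → ℝ}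
    (h : ∀ x₁ x₂, ∑ r, (a x₁ r + b x₂ r) ^ 2 = φ₁ x₁ + φ₂ x₂) (x₁ : V₁) (x₂ : V₂) :
    a x₁ ⬝ᵥ b x₂ = 0 := by
  have h1 := h x₁ x₂
  have h2 := h x₁ 0
  have h3 := h 0 x₂
  have h4 := h 0 0
  simp only [ha, hb, Pi.zero_apply, add_zero, zero_add] at h2 h3 h4
  have h5 : ∑ r, (a x₁ r + b x₂ r) ^ 2 =
      ∑ r, a x₁ r ^ 2 + ∑ r, b x₂ r ^ 2 + 2 * (a x₁ ⬝ᵥ b x₂) := by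
    rw [dotProduct, Finset.mul_sum, ← Finset.sum_add_distrib, ← Finset.sum_add_distrib]
    exact Finset.sum_congr rfl fun r _ => by ring
  norm_num at h4
  linarith

theorem IsTwoGroupMLDecodable.dotProduct_eq_zero {A : κ₁ ⊕ κ₂ → Matrix τ ν ℂ}
    (hA : IsTwoGroupMLDecodable A) {M : ℕ} (H : Matrix ν (Fin M) ℂ) (x₁ : κ₁ → ℝ) (x₂ : κ₂ → ℝ) :
    vecTilde (codeword (A ∘ Sum.inl) x₁ * H) ⬝ᵥ vecTilde (codeword (A ∘ Sum.inr) x₂ * H) = 0 := by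
  obtain ⟨φ₁, φ₂, h⟩ := hA M H 0
  refine dotProduct_eq_zero_of_additive (a := fun x₁ => vecTilde (codeword (A ∘ Sum.inl) x₁ * H))
    (b := fun x₂ => vecTilde (codeword (A ∘ Sum.inr) x₂ * H)) (φ₁ := φ₁) (φ₂ := φ₂)
    (by simp [codeword_zero, vecTilde_zero]) (by simp [codeword_zero, vecTilde_zero])
    (fun x₁ x₂ => ?_) x₁ x₂
  rw [← h, frobSq_eq_sum_vecTilde, codeword_sumElim, Matrix.add_mul, vecTilde_sub, vecTilde_add,
    vecTilde_zero]
  exact Finset.sum_congr rfl fun r _ => by simp [sub_eq_add_neg]; ring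

theorem dotProduct_vecTilde (X Y : Matrix τ μ ℂ) :
    vecTilde X ⬝ᵥ vecTilde Y = ∑ t, ∑ c, (star (X t c) * Y t c).re := by
  simp only [dotProduct, vecTilde, Fintype.sum_sum_type, Fintype.sum_prod_type, Sum.elim_inl,
    Sum.elim_inr, Matrix.vec, Matrix.map_apply]
  rw [Finset.sum_comm, Finset.sum_comm (γ := μ), ← Finset.sum_add_distrib]
  refine Finset.sum_congr rfl fun t _ => ?_
  rw [← Finset.sum_add_distrib]
  refine Finset.sum_congr rfl fun c _ => ?_
  simp

theorem dotProduct_vecTilde_mul (X Y : Matrix τ ν ℂ) (H : Matrix ν μ ℂ) :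
    vecTilde (X * H) ⬝ᵥ vecTilde (Y * H) = (H.conjTranspose * (X.conjTranspose * Y) * H).trace.re := by
  rw [dotProduct_vecTilde]
  have : H.conjTranspose * (X.conjTranspose * Y) * H = (X * H).conjTranspose * (Y * H) := by
    rw [Matrix.conjTranspose_mul]; simp only [Matrix.mul_assoc]
  rw [this, Matrix.trace, Complex.re_sum, Finset.sum_comm]
  refine Finset.sum_congr rfl fun c _ => ?_
  rw [Matrix.diag_apply, Matrix.mul_apply, Complex.re_sum]
  rfl

/-- The cross term of the metric is the real part of the trace of `Hᴴ (X₁ᴴ X₂) H`, which vanishes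
when `X₁ᴴ X₂` is skew-Hermitian. This direction serves the existence of the codes. -/
theorem isTwoGroupMLDecodable_of_skew {A : κ₁ ⊕ κ₂ → Matrix τ ν ℂ}
    (hA : ∀ i j, (A (Sum.inl i)).conjTranspose * A (Sum.inr j) +
      (A (Sum.inr j)).conjTranspose * A (Sum.inl i) = 0) : IsTwoGroupMLDecodable A := by
  intro M H Y
  refine ⟨fun x₁ => frobSq (Y - codeword (A ∘ Sum.inl) x₁ * H), fun x₂ =>
    frobSq (Y - codeword (A ∘ Sum.inr) x₂ * H) - frobSq Y, fun x₁ x₂ => ?_⟩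
  set X₁ := codeword (A ∘ Sum.inl) x₁ with hX₁
  set X₂ := codeword (A ∘ Sum.inr) x₂ with hX₂
  have hskew : X₁.conjTranspose * X₂ + X₂.conjTranspose * X₁ = 0 := by
    simp only [hX₁, hX₂, codeword, Matrix.conjTranspose_sum, Matrix.conjTranspose_smul,
      Matrix.sum_mul, Matrix.mul_sum, Function.comp]
    rw [Finset.sum_comm, ← Finset.sum_add_distrib]
    refine Finset.sum_eq_zero fun i _ => ?_
    rw [← Finset.sum_add_distrib]
    refine Finset.sum_eq_zero fun j _ => ?_
    have := congrArg (fun Z => (x₁ i * x₂ j) • Z) (hA i j)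
    simp only [smul_add, smul_zero] at this
    rw [← this]
    simp [smul_smul, mul_comm]
  have horth : vecTilde (X₁ * H) ⬝ᵥ vecTilde (X₂ * H) = 0 := by
    have h1 := dotProduct_vecTilde_mul X₁ X₂ H
    have h2 := dotProduct_vecTilde_mul X₂ X₁ H
    rw [dotProduct_comm] at h2
    have h3 : (H.conjTranspose * (X₁.conjTranspose * X₂) * H).trace.re +
        (H.conjTranspose * (X₂.conjTranspose * X₁) * H).trace.re = 0 := by
      rw [← Complex.add_re, ← Matrix.trace_add, ← Matrix.add_mul, ← Matrix.mul_add, hskew]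
      simp
    linarith
  rw [codeword_sumElim, Matrix.add_mul]
  simp only [frobSq_eq_sum_vecTilde, vecTilde_sub, vecTilde_add]
  rw [← hX₁, ← hX₂, ← sub_eq_zero, ← sub_eq_zero]
  have : (0 : ℝ) = 2 * (vecTilde (X₁ * H) ⬝ᵥ vecTilde (X₂ * H)) := by rw [horth, mul_zero]
  rw [sub_zero, this, dotProduct, Finset.mul_sum, ← sub_eq_zero, ← Finset.sum_sub_distrib,
    ← Finset.sum_add_distrib, ← Finset.sum_sub_distrib, ← Finset.sum_sub_distrib]
  refine Finset.sum_eq_zero fun r _ => ?_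
  simp only [Pi.sub_apply, Pi.add_apply]
  ring

/-- Both groups can be decoded from the same received vector: no part of the signal has to be
subtracted first, since the cross term is zero. -/
theorem IsTwoGroupMLDecodable.frobSq_eq {A : κ₁ ⊕ κ₂ → Matrix τ ν ℂ}
    (hA : IsTwoGroupMLDecodable A) {M : ℕ} (H : Matrix ν (Fin M) ℂ) (Y : Matrix τ (Fin M) ℂ)
    (x₁ : κ₁ → ℝ) (x₂ : κ₂ → ℝ) :
    frobSq (Y - codeword A (Sum.elim x₁ x₂) * H) =
      ∑ r, (vecTilde Y r - (equivChannel (A ∘ Sum.inl) H).mulVec x₁ r) ^ 2 +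
      ∑ r, (vecTilde Y r - (equivChannel (A ∘ Sum.inr) H).mulVec x₂ r) ^ 2 - frobSq Y := by
  have horth := hA.dotProduct_eq_zero H x₁ x₂
  rw [codeword_sumElim, Matrix.add_mul]
  simp only [frobSq_eq_sum_vecTilde, vecTilde_sub, vecTilde_add, equivChannel_mulVec]
  have : (0 : ℝ) = 2 * (vecTilde (codeword (A ∘ Sum.inl) x₁ * H) ⬝ᵥ
    vecTilde (codeword (A ∘ Sum.inr) x₂ * H)) := by rw [horth, mul_zero]
  rw [← sub_eq_zero, this, dotProduct, Finset.mul_sum, ← Finset.sum_add_distrib,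
    ← Finset.sum_sub_distrib, ← Finset.sum_sub_distrib, ← sub_eq_zero, ← Finset.sum_sub_distrib]
  refine Finset.sum_eq_zero fun r _ => ?_
  simp only [Pi.sub_apply, Pi.add_apply]
  ring

/-- The equivalent channel matrices of the two groups have orthogonal column spaces. -/
theorem IsTwoGroupMLDecodable.transpose_mulVec_eq_zero {A : κ₁ ⊕ κ₂ → Matrix τ ν ℂ}
    (hA : IsTwoGroupMLDecodable A) {M : ℕ} (H : Matrix ν (Fin M) ℂ) (x₁ : κ₁ → ℝ) (x₂ : κ₂ → ℝ) :
    (equivChannel (A ∘ Sum.inl) H).transpose.mulVec ((equivChannel (A ∘ Sum.inr) H).mulVec x₂) = 0 ∧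
    (equivChannel (A ∘ Sum.inr) H).transpose.mulVec ((equivChannel (A ∘ Sum.inl) H).mulVec x₁) = 0 := by
  constructor
  · rw [← dotProduct_eq_zero_iff]
    intro x
    rw [dotProduct_comm, Matrix.dotProduct_mulVec, Matrix.vecMul_transpose, equivChannel_mulVec,
      equivChannel_mulVec, hA.dotProduct_eq_zero]
  · rw [← dotProduct_eq_zero_iff]
    intro x
    rw [dotProduct_comm, Matrix.dotProduct_mulVec, Matrix.vecMul_transpose, dotProduct_comm, equivChannel_mulVec,
      equivChannel_mulVec, hA.dotProduct_eq_zero]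

/-- The column space is the sum of those of the two groups, and orthogonality makes their
intersection trivial. -/
theorem IsTwoGroupMLDecodable.rank_eq {A : κ₁ ⊕ κ₂ → Matrix τ ν ℂ}
    (hA : IsTwoGroupMLDecodable A) {M : ℕ} (H : Matrix ν (Fin M) ℂ) :
    (equivChannel A H).rank =
      (equivChannel (A ∘ Sum.inl) H).rank + (equivChannel (A ∘ Sum.inr) H).rank := by
  have hmul : ∀ x₁ x₂, (equivChannel A H).mulVec (Sum.elim x₁ x₂) =
      (equivChannel (A ∘ Sum.inl) H).mulVec x₁ + (equivChannel (A ∘ Sum.inr) H).mulVec x₂ := by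
    intro x₁ x₂
    rw [equivChannel_mulVec, equivChannel_mulVec, equivChannel_mulVec, codeword_sumElim,
      Matrix.add_mul, vecTilde_add]
  have hsup : LinearMap.range (equivChannel A H).mulVecLin =
      LinearMap.range (equivChannel (A ∘ Sum.inl) H).mulVecLin ⊔
      LinearMap.range (equivChannel (A ∘ Sum.inr) H).mulVecLin := by
    ext v
    simp only [Submodule.mem_sup, LinearMap.mem_range, Matrix.mulVecLin_apply]
    constructor
    · rintro ⟨x, rfl⟩
      refine ⟨_, ⟨x ∘ Sum.inl, rfl⟩, _, ⟨x ∘ Sum.inr, rfl⟩, ?_⟩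
      rw [← hmul, Sum.elim_comp_inl_inr]
    · rintro ⟨_, ⟨x₁, rfl⟩, _, ⟨x₂, rfl⟩, rfl⟩
      exact ⟨_, hmul x₁ x₂⟩
  have hinf : LinearMap.range (equivChannel (A ∘ Sum.inl) H).mulVecLin ⊓
      LinearMap.range (equivChannel (A ∘ Sum.inr) H).mulVecLin = ⊥ := by
    rw [eq_bot_iff]
    rintro v ⟨⟨x₁, h₁⟩, ⟨x₂, h₂⟩⟩
    have := hA.dotProduct_eq_zero H x₁ x₂
    rw [← equivChannel_mulVec, ← equivChannel_mulVec, ← Matrix.mulVecLin_apply,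
      ← Matrix.mulVecLin_apply, h₁, h₂] at this
    exact dotProduct_self_eq_zero.mp this
  have := Submodule.finrank_sup_add_finrank_inf_eq
    (LinearMap.range (equivChannel (A ∘ Sum.inl) H).mulVecLin)
    (LinearMap.range (equivChannel (A ∘ Sum.inr) H).mulVecLin)
  rw [hinf, finrank_bot, add_zero, ← hsup] at this
  exact this

end Codes

/-! ### Skew-Hermitian matrices adapted to an orthonormal basis -/

section Skew

variable {n : ℕ}

/-- Polarization of the real quadratic form: testing on basis vectors gives the real parts of the
entries, and a factor `I` on one of them gives the imaginary parts. -/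
theorem conjTranspose_eq_neg_of_re_eq_zero {ν : Type*} [Fintype ν] [DecidableEq ν]
    {C : Matrix ν ν ℂ} (h : ∀ v : ν → ℂ, (star v ⬝ᵥ C.mulVec v).re = 0) : C.conjTranspose = -C := by
  have hpol : ∀ v w : ν → ℂ, (star v ⬝ᵥ C.mulVec w).re + (star w ⬝ᵥ C.mulVec v).re = 0 := by
    intro v w
    have h1 := h (v + w)
    simp only [star_add, Matrix.mulVec_add, add_dotProduct, dotProduct_add, Complex.add_re] at h1
    linarith [h v, h w]
  ext i j
  have h1 := hpol (Pi.single j 1) (Pi.single i 1)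
  have h2 := hpol (Pi.single j 1) (Pi.single i Complex.I)
  simp only [← Pi.single_star, Matrix.mulVec_single, single_dotProduct, star_one, one_mul] at h1 h2
  simp at h1 h2
  apply Complex.ext
  · simp; linarith
  · simp; linarith

/-- The smaller index of a pair. -/
def lo (p : Fin n × Fin n) : Fin n := min p.1 p.2

/-- The larger index of a pair. -/
def hi (p : Fin n × Fin n) : Fin n := max p.1 p.2

/-- The real part for a pair below the diagonal, and the imaginary part otherwise. -/
def part (p : Fin n × Fin n) (z : ℂ) : ℝ := if p.2 < p.1 then z.re else z.im

/-- The skew-Hermitian matrices built from pairs of vectors of the family `q`. -/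
def skewBasis (q : Fin n → Fin n → ℂ) (p : Fin n × Fin n) : Matrix (Fin n) (Fin n) ℂ :=
  if p.1 = p.2 then Complex.I • Matrix.vecMulVec (q p.1) (star (q p.1))
  else if p.2 < p.1 then
    Matrix.vecMulVec (q p.1) (star (q p.2)) - Matrix.vecMulVec (q p.2) (star (q p.1))
  else Complex.I •
    (Matrix.vecMulVec (q p.1) (star (q p.2)) + Matrix.vecMulVec (q p.2) (star (q p.1)))

theorem skewBasis_mem (q : Fin n → Fin n → ℂ) (p : Fin n × Fin n) :
    skewBasis q p ∈ skewAdjoint (Matrix (Fin n) (Fin n) ℂ) := by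
  rw [skewAdjoint.mem_iff, Matrix.star_eq_conjTranspose]
  unfold skewBasis
  split_ifs <;>
    simp [Matrix.conjTranspose_smul, add_comm]

theorem norm_skewBasis_apply_le {q : Fin n → Fin n → ℂ} (hq : ∀ a i, ‖q a i‖ ≤ 1)
    (p : Fin n × Fin n) (i j : Fin n) : ‖skewBasis q p i j‖ ≤ 2 := by
  have h : ∀ a b i j, ‖Matrix.vecMulVec (q a) (star (q b)) i j‖ ≤ 1 := by
    intro a b i j
    simp only [Matrix.vecMulVec_apply, Pi.star_apply, norm_mul, norm_star]
    exact mul_le_one₀ (hq a i) (norm_nonneg _) (hq b j)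
  unfold skewBasis
  split_ifs
  · simp only [Matrix.smul_apply, norm_smul, Complex.norm_I, one_mul]
    exact (h _ _ _ _).trans one_le_two
  · rw [Matrix.sub_apply]
    exact (norm_sub_le _ _).trans (by linarith [h p.1 p.2 i j, h p.2 p.1 i j])
  · simp only [Matrix.smul_apply, norm_smul, Complex.norm_I, one_mul, Matrix.add_apply]
    exact (norm_add_le _ _).trans (by linarith [h p.1 p.2 i j, h p.2 p.1 i j])

theorem dotProduct_vecMulVec_mulVec (a u w v : Fin n → ℂ) :
    a ⬝ᵥ (Matrix.vecMulVec u (star w)).mulVec v = (a ⬝ᵥ u) * (star w ⬝ᵥ v) := by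
  have : (Matrix.vecMulVec u (star w)).mulVec v = (star w ⬝ᵥ v) • u := by
    ext i
    simp only [dotProduct, Matrix.mulVec, Matrix.vecMulVec_apply, Pi.smul_apply, smul_eq_mul,
      Finset.sum_mul]
    exact Finset.sum_congr rfl fun j _ => by ring
  rw [this, dotProduct_smul, smul_eq_mul, mul_comm]

theorem dotProduct_skewBasis_mulVec (q : Fin n → Fin n → ℂ) (p : Fin n × Fin n)
    (a v : Fin n → ℂ) : a ⬝ᵥ (skewBasis q p).mulVec v =
      if p.1 = p.2 then Complex.I * ((a ⬝ᵥ q p.1) * (star (q p.1) ⬝ᵥ v))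
      else if p.2 < p.1 then
        (a ⬝ᵥ q p.1) * (star (q p.2) ⬝ᵥ v) - (a ⬝ᵥ q p.2) * (star (q p.1) ⬝ᵥ v)
      else Complex.I *
        ((a ⬝ᵥ q p.1) * (star (q p.2) ⬝ᵥ v) + (a ⬝ᵥ q p.2) * (star (q p.1) ⬝ᵥ v)) := by
  unfold skewBasis
  split_ifs <;> simp [Matrix.smul_mulVec, Matrix.sub_mulVec, Matrix.add_mulVec,
    dotProduct_vecMulVec_mulVec, mul_add]

/-- `skewBasis q p` vanishes on vectors orthogonal to `q i` for `i ≥ lo p`. -/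
theorem skewBasis_mulVec_eq_zero {q : Fin n → Fin n → ℂ} {p : Fin n × Fin n} {v : Fin n → ℂ}
    (hv : ∀ l, lo p ≤ l → star (q l) ⬝ᵥ v = 0) : (skewBasis q p).mulVec v = 0 := by
  rw [← dotProduct_eq_zero_iff]
  intro a
  rw [dotProduct_comm, dotProduct_skewBasis_mulVec, hv p.1 (min_le_left _ _),
    hv p.2 (min_le_right _ _)]
  simp

/-- The matrix of the map `W ↦ W h` in suitable coordinates. -/
def skewEntry (q h : Fin n → Fin n → ℂ) (p' p : Fin n × Fin n) : ℝ :=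
  part p' (star (q (hi p')) ⬝ᵥ (skewBasis q p).mulVec (h (lo p')))

theorem skewEntry_eq_zero {q h : Fin n → Fin n → ℂ}
    (htri : ∀ c l, c < l → star (q l) ⬝ᵥ h c = 0) {p' p : Fin n × Fin n} (hp : lo p' < lo p) :
    skewEntry q h p' p = 0 := by
  rw [skewEntry, skewBasis_mulVec_eq_zero (fun l hl => htri _ _ (hp.trans_le hl)),
    dotProduct_zero]
  simp [part]

/-- For pairs with the same smaller index `c`, only the coefficient `ρ c` of `h c` along `q c`
survives, so `skewBasis q p` sends `h c` to `ρ c` times `q (hi p)`, with a factor `I` unless `p.2 <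
p.1`. Pairing with `q (hi p')` compares the larger indices, and `part` distinguishes a pair from its
transpose. -/
theorem skewEntry_eq {q h : Fin n → Fin n → ℂ} {ρ : Fin n → ℝ}
    (hq : ∀ a b, star (q a) ⬝ᵥ q b = if a = b then 1 else 0)
    (htri : ∀ c l, c < l → star (q l) ⬝ᵥ h c = 0) (hdiag : ∀ c, star (q c) ⬝ᵥ h c = (ρ c : ℂ))
    {p' p : Fin n × Fin n} (hp : lo p' = lo p) :
    skewEntry q h p' p = if p' = p then ρ (lo p) else 0 := by
  obtain ⟨a, b⟩ := p'
  obtain ⟨i, j⟩ := p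
  rw [skewEntry, dotProduct_skewBasis_mulVec, hp]
  simp only [hq]
  rcases lt_trichotomy i j with hij | rfl | hij
  · have h1 : lo (i, j) = i := min_eq_left hij.le
    rw [h1] at hp ⊢
    rw [if_neg hij.ne, if_neg (not_lt.mpr hij.le), hdiag, htri i j hij]
    rcases lt_trichotomy a b with hab | rfl | hab
    · have h2 : lo (a, b) = a := min_eq_left hab.le
      have h3 : hi (a, b) = b := max_eq_right hab.le
      rw [h2] at hp; subst hp
      by_cases hbj : b = j
      · subst hbj; simp [part, h3, not_lt.mpr hab.le]
      · simp [part, h3, hbj]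
    · have h2 : lo (a, a) = a := min_self a
      have h3 : hi (a, a) = a := max_self a
      rw [h2] at hp; subst hp
      simp [part, h3, hij.ne]
    · have h2 : lo (a, b) = b := min_eq_right hab.le
      have h3 : hi (a, b) = a := max_eq_left hab.le
      rw [h2] at hp; subst hp
      by_cases haj : a = j
      · subst haj; simp [part, h3, hab, hab.ne']
      · simp [part, h3, haj, hab, hab.ne']
  · have h1 : lo (i, i) = i := min_self i
    rw [h1] at hp ⊢
    rw [if_pos rfl, hdiag]
    rcases lt_trichotomy a b with hab | rfl | hab
    · have h2 : lo (a, b) = a := min_eq_left hab.le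
      have h3 : hi (a, b) = b := max_eq_right hab.le
      rw [h2] at hp; subst hp
      simp [part, h3, hab.ne']
    · have h2 : lo (a, a) = a := min_self a
      have h3 : hi (a, a) = a := max_self a
      rw [h2] at hp; subst hp
      simp [part, h3]
    · have h2 : lo (a, b) = b := min_eq_right hab.le
      have h3 : hi (a, b) = a := max_eq_left hab.le
      rw [h2] at hp; subst hp
      simp [part, h3, hab.ne']
  · have h1 : lo (i, j) = j := min_eq_right hij.le
    rw [h1] at hp ⊢
    rw [if_neg hij.ne', if_pos hij, hdiag, htri j i hij]
    rcases lt_trichotomy a b with hab | rfl | hab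
    · have h2 : lo (a, b) = a := min_eq_left hab.le
      have h3 : hi (a, b) = b := max_eq_right hab.le
      rw [h2] at hp; subst hp
      by_cases hbi : b = i
      · subst hbi; simp [part, h3, not_lt.mpr hab.le, hab.ne]
      · simp [part, h3, hbi, not_lt.mpr hab.le, hij.ne]
    · have h2 : lo (a, a) = a := min_self a
      have h3 : hi (a, a) = a := max_self a
      rw [h2] at hp; subst hp
      simp [part, h3, hij.ne]
    · have h2 : lo (a, b) = b := min_eq_right hab.le
      have h3 : hi (a, b) = a := max_eq_left hab.le
      rw [h2] at hp; subst hp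
      by_cases hai : a = i
      · subst hai; simp [part, h3, hab]
      · simp [part, h3, hai]

/-- Grouped by the smaller index the matrix is block triangular with scalar diagonal blocks. The
predicate `s` allows both the full set of pairs, for linear independence, and the pairs with `lo p <
M`, for the minor. -/
theorem det_skewEntry {q h : Fin n → Fin n → ℂ} {ρ : Fin n → ℝ} (s : Fin n × Fin n → Prop)
    [DecidablePred s]
    (hq : ∀ a b, star (q a) ⬝ᵥ q b = if a = b then 1 else 0)
    (htri : ∀ c l, c < l → star (q l) ⬝ᵥ h c = 0)
    (hdiag : ∀ c, star (q c) ⬝ᵥ h c = (ρ c : ℂ)) :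
    (Matrix.of fun p' p : {p // s p} => skewEntry q h p' p).det = ∏ p : {p // s p}, ρ (lo p.1) := by
  rw [← Matrix.det_transpose]
  have htriang : (Matrix.of fun p' p : {p // s p} => skewEntry q h p' p).transpose.BlockTriangular
      fun p => lo p.1 := fun p p' hp => skewEntry_eq_zero htri hp
  rw [htriang.det_fintype, ← Finset.prod_fiberwise (Finset.univ : Finset {p // s p})
    (fun p => lo p.1)]
  refine Finset.prod_congr rfl fun k _ => ?_
  have hblock : Matrix.toSquareBlock
      (Matrix.of fun p' p : {p // s p} => skewEntry q h p' p).transpose (fun p => lo p.1) k =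
      Matrix.diagonal fun _ => ρ k := by
    ext p p'
    have h1 : lo p.1.1 = k := p.2
    have h2 : lo p'.1.1 = k := p'.2
    have h3 := skewEntry_eq hq htri hdiag (p' := p'.1.1) (p := p.1.1) (h2.trans h1.symm)
    rw [Matrix.toSquareBlock_def, Matrix.of_apply, Matrix.transpose_apply, Matrix.of_apply, h3, h1,
      Matrix.diagonal_apply]
    refine if_congr ⟨fun h => ?_, fun h => ?_⟩ rfl rfl
    · exact Subtype.ext (Subtype.ext h.symm)
    · rw [h]
  rw [hblock, Matrix.det_diagonal, Finset.prod_const, Finset.card_univ, Fintype.card_subtype,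
    Finset.prod_congr rfl (g := fun _ => ρ k), Finset.prod_const]
  intro p hp
  rw [(Finset.mem_filter.mp hp).2]

/-- For `h = q` every `ρ c` is 1, so evaluation on the basis gives a matrix of determinant 1. -/
theorem linearIndependent_skewBasis {q : Fin n → Fin n → ℂ}
    (hq : ∀ a b, star (q a) ⬝ᵥ q b = if a = b then 1 else 0) :
    LinearIndependent ℝ (skewBasis q) := by
  have hdet := det_skewEntry (q := q) (h := q) (ρ := fun _ => 1) (fun _ => True) hq
    (fun c l hl => by rw [hq, if_neg hl.ne']) (fun c => by rw [hq, if_pos rfl]; simp)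
  rw [Finset.prod_const_one] at hdet
  rw [Fintype.linearIndependent_iff]
  intro x hx p
  have hz := Matrix.eq_zero_of_mulVec_eq_zero (by rw [hdet]; exact one_ne_zero)
    (v := fun p : {_p : Fin n × Fin n // True} => x p) ?_
  · exact congrFun hz ⟨p, trivial⟩
  ext p'
  have h1 : ∑ p, x p * skewEntry q q p' p = 0 := by
    have h2 : part p'.1 (star (q (hi p'.1)) ⬝ᵥ
        (∑ p, x p • skewBasis q p).mulVec (q (lo p'.1))) = 0 := by
      rw [hx, Matrix.zero_mulVec, dotProduct_zero]; simp [part]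
    rw [← h2, Matrix.sum_mulVec, dotProduct_sum]
    simp only [skewEntry, part, Matrix.smul_mulVec, dotProduct_smul]
    split_ifs <;> simp
  rw [Pi.zero_apply, ← h1]
  simp only [Matrix.mulVec, dotProduct, Matrix.of_apply]
  rw [← Equiv.sum_comp (Equiv.subtypeUnivEquiv (p := fun _ : Fin n × Fin n => True)
    fun _ => trivial)]
  exact Finset.sum_congr rfl fun p _ => mul_comm _ _

/-- The inclusion of the skew-Hermitian matrices, as a real-linear map. -/
def skewSubtype (n : ℕ) :
    skewAdjoint (Matrix (Fin n) (Fin n) ℂ) →ₗ[ℝ] Matrix (Fin n) (Fin n) ℂ where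
  toFun := Subtype.val
  map_add' _ _ := rfl
  map_smul' _ _ := rfl

instance finite_skewAdjoint :
    Module.Finite ℝ (skewAdjoint (Matrix (Fin n) (Fin n) ℂ)) :=
  Module.Finite.of_injective (skewSubtype n) Subtype.val_injective

/-- Multiplication by `I` exchanges Hermitian and skew-Hermitian matrices, so each has half the real
dimension `2 * n ^ 2`. -/
theorem finrank_skewAdjoint :
    Module.finrank ℝ (skewAdjoint (Matrix (Fin n) (Fin n) ℂ)) = n ^ 2 := by
  let e : selfAdjoint (Matrix (Fin n) (Fin n) ℂ) ≃ₗ[ℝ] skewAdjoint (Matrix (Fin n) (Fin n) ℂ) :=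
    { toFun := fun a => ⟨Complex.I • a.1, by
        rw [skewAdjoint.mem_iff, star_smul, a.2]; simp⟩
      invFun := skewAdjoint.negISMul
      map_add' := fun a b => Subtype.ext (by simp)
      map_smul' := fun r a => Subtype.ext (smul_comm _ _ _)
      left_inv := fun a => Subtype.ext (by simp [skewAdjoint.negISMul, smul_smul])
      right_inv := fun a => Subtype.ext (by simp [skewAdjoint.negISMul, smul_smul]) }
  have h1 := (StarModule.decomposeProdAdjoint ℝ (Matrix (Fin n) (Fin n) ℂ)).finrank_eq
  have h2 : Module.finrank ℝ (Matrix (Fin n) (Fin n) ℂ) = 2 * n ^ 2 := by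
    rw [Module.finrank_matrix, Complex.finrank_real_complex]; simp; ring
  have := Module.Finite.equiv e.symm
  rw [Module.finrank_prod, e.finrank_eq, h2] at h1
  omega

end Skew

/-! ### Existence of the codes -/

section Existence

variable {n : ℕ}

theorem I_smul_vecMulVec_mem (q : Fin n → ℂ) :
    Complex.I • Matrix.vecMulVec q (star q) ∈ skewAdjoint (Matrix (Fin n) (Fin n) ℂ) := by
  rw [skewAdjoint.mem_iff, Matrix.star_eq_conjTranspose]
  simp [Matrix.conjTranspose_smul]

/-- The pairs `(1, W)` with `W` skew-Hermitian and unitary. -/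
def unitarySkewPairs (n : ℕ) : Set (ℝ × skewAdjoint (Matrix (Fin n) (Fin n) ℂ)) :=
  {z | z.1 = 1 ∧ (z.2 : Matrix (Fin n) (Fin n) ℂ) ∈ Matrix.unitaryGroup (Fin n) ℂ}

/-- If `U` is unitary and skew-Hermitian, so is `-U`, and (0, U) is half the difference of (1, U)
and (1, -U). -/
theorem zero_pair_mem_span {U : skewAdjoint (Matrix (Fin n) (Fin n) ℂ)}
    (hU : (U : Matrix (Fin n) (Fin n) ℂ) ∈ Matrix.unitaryGroup (Fin n) ℂ) :
    ((0 : ℝ), U) ∈ Submodule.span ℝ (unitarySkewPairs n) := by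
  have h1 : ((1 : ℝ), U) ∈ Submodule.span ℝ (unitarySkewPairs n) :=
    Submodule.subset_span ⟨rfl, hU⟩
  have h2 : ((1 : ℝ), -U) ∈ Submodule.span ℝ (unitarySkewPairs n) := by
    refine Submodule.subset_span ⟨rfl, ?_⟩
    rw [Matrix.mem_unitaryGroup_iff] at hU ⊢
    simpa using hU
  have h3 := Submodule.smul_mem _ (1 / 2 : ℝ) (Submodule.sub_mem _ h1 h2)
  convert h3 using 1
  refine Prod.ext (by simp) ?_
  simp only [Prod.smul_snd, Prod.snd_sub, sub_neg_eq_add, ← two_smul ℝ U, smul_smul]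
  norm_num

theorem I_smul_one_mem_unitaryGroup :
    (Complex.I • (1 : Matrix (Fin n) (Fin n) ℂ)) ∈ Matrix.unitaryGroup (Fin n) ℂ := by
  rw [Matrix.mem_unitaryGroup_iff]
  simp [smul_smul]

theorem I_smul_one_mem_skewAdjoint :
    (Complex.I • (1 : Matrix (Fin n) (Fin n) ℂ)) ∈ skewAdjoint (Matrix (Fin n) (Fin n) ℂ) := by
  rw [skewAdjoint.mem_iff]
  simp

theorem I_smul_vecMulVec_pair_mem_span (q : Fin n → ℂ) :
    ((0 : ℝ), (⟨_, I_smul_vecMulVec_mem q⟩ : skewAdjoint (Matrix (Fin n) (Fin n) ℂ))) ∈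
      Submodule.span ℝ (unitarySkewPairs n) := by
  have hunit : ∀ q : Fin n → ℂ, star q ⬝ᵥ q = 1 →
      ((0 : ℝ), (⟨_, I_smul_vecMulVec_mem q⟩ : skewAdjoint (Matrix (Fin n) (Fin n) ℂ))) ∈
      Submodule.span ℝ (unitarySkewPairs n) := by
    intro q hq
    let J : skewAdjoint (Matrix (Fin n) (Fin n) ℂ) := ⟨_, I_smul_one_mem_skewAdjoint⟩
    let Q : skewAdjoint (Matrix (Fin n) (Fin n) ℂ) := ⟨_, I_smul_vecMulVec_mem q⟩
    have hQ2 : Matrix.vecMulVec q (star q) * Matrix.vecMulVec q (star q) =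
        Matrix.vecMulVec q (star q) := by
      rw [Matrix.vecMulVec_mul_vecMulVec, hq, one_smul]
    -- For a unit vector `q` this matrix is `I` times the reflection `1 - 2 q qᴴ`, hence unitary and
    -- skew-Hermitian; `Q` is then half the difference of two such matrices.
    have hU : ((J - (2 : ℝ) • Q : skewAdjoint (Matrix (Fin n) (Fin n) ℂ)) :
        Matrix (Fin n) (Fin n) ℂ) ∈ Matrix.unitaryGroup (Fin n) ℂ := by
      have h1 : ((J - (2 : ℝ) • Q : skewAdjoint (Matrix (Fin n) (Fin n) ℂ)) :
          Matrix (Fin n) (Fin n) ℂ) =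
          Complex.I • (1 - (2 : ℂ) • Matrix.vecMulVec q (star q)) := by
        ext i j
        simp [J, Q]
        ring
      rw [Matrix.mem_unitaryGroup_iff', skewAdjoint.mem_iff.mp (J - (2 : ℝ) • Q).2, h1]
      rw [← neg_smul, Matrix.smul_mul, Matrix.mul_smul, smul_smul]
      simp only [Matrix.sub_mul, Matrix.mul_sub, Matrix.smul_mul, Matrix.mul_smul, hQ2, one_mul,
        mul_one]
      simp only [neg_mul, Complex.I_mul_I, neg_neg, one_smul]
      module
    have h2 := zero_pair_mem_span hU
    have h3 := zero_pair_mem_span (U := J) I_smul_one_mem_unitaryGroup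
    have h4 := Submodule.smul_mem _ (1 / 2 : ℝ) (Submodule.sub_mem _ h3 h2)
    convert h4 using 1
    refine Prod.ext (by simp) ?_
    simp only [Prod.smul_snd, Prod.snd_sub, sub_sub_cancel, smul_smul]
    norm_num
    rfl
  by_cases hq : q = 0
  · convert Submodule.zero_mem _ using 1
    refine Prod.ext rfl (Subtype.ext ?_)
    simp [hq]
  · set t : ℝ := ‖(WithLp.toLp 2 q : EuclideanSpace ℂ (Fin n))‖ with ht
    have ht0 : t ≠ 0 := by
      rw [ht, norm_ne_zero_iff]
      simpa using hq
    have hqq : star q ⬝ᵥ q = ((t ^ 2 : ℝ) : ℂ) := by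
      have h := inner_self_eq_norm_sq_to_K (𝕜 := ℂ) (WithLp.toLp 2 q : EuclideanSpace ℂ (Fin n))
      rw [EuclideanSpace.inner_eq_star_dotProduct, dotProduct_comm] at h
      simpa [ht] using h
    have h := Submodule.smul_mem _ (t ^ 2) (hunit ((t⁻¹ : ℂ) • q) (by
      rw [star_smul, smul_dotProduct, dotProduct_smul, hqq]
      have : (t : ℂ) ≠ 0 := by exact_mod_cast ht0
      simp
      field_simp))
    convert h using 1
    refine Prod.ext (by simp) (Subtype.ext ?_)
    ext i j
    have : (t : ℂ) ≠ 0 := by exact_mod_cast ht0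
    simp [Matrix.vecMulVec_apply]
    field_simp

theorem skewBasis_pair_mem_span (q : Fin n → Fin n → ℂ) (p : Fin n × Fin n) :
    ((0 : ℝ), (⟨_, skewBasis_mem q p⟩ : skewAdjoint (Matrix (Fin n) (Fin n) ℂ))) ∈
      Submodule.span ℝ (unitarySkewPairs n) := by
  have hpol : ∀ (u v : Fin n → ℂ) (Z : skewAdjoint (Matrix (Fin n) (Fin n) ℂ)),
      (Z : Matrix (Fin n) (Fin n) ℂ) =
        Complex.I • (Matrix.vecMulVec u (star v) + Matrix.vecMulVec v (star u)) →
      ((0 : ℝ), Z) ∈ Submodule.span ℝ (unitarySkewPairs n) := by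
    intro u v Z hZ
    have h := Submodule.sub_mem _ (Submodule.sub_mem _ (I_smul_vecMulVec_pair_mem_span (u + v))
      (I_smul_vecMulVec_pair_mem_span u)) (I_smul_vecMulVec_pair_mem_span v)
    convert h using 1
    refine Prod.ext (by simp) (Subtype.ext ?_)
    rw [hZ]
    ext i j
    simp [Matrix.vecMulVec_apply]
    ring
  by_cases h1 : p.1 = p.2
  · convert I_smul_vecMulVec_pair_mem_span (q p.1) using 3
    rw [skewBasis, if_pos h1]
  by_cases h2 : p.2 < p.1
  -- Polarization with a second vector rotated by `I` turns the symmetric combination into the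
  -- antisymmetric one.
  · refine hpol (q p.1) (Complex.I • q p.2) _ ?_
    simp only [skewBasis, if_neg h1, if_pos h2]
    ext i j
    simp [Matrix.vecMulVec_apply]
    linear_combination
      (q p.1 i * (starRingEnd ℂ) (q p.2 j) - q p.2 i * (starRingEnd ℂ) (q p.1 j)) * Complex.I_sq
  · refine hpol (q p.1) (q p.2) _ ?_
    simp only [skewBasis, if_neg h1, if_neg h2]

theorem span_unitarySkewPairs : Submodule.span ℝ (unitarySkewPairs n) = ⊤ := by
  set q : Fin n → Fin n → ℂ := fun a => Pi.single a 1 with hqdef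
  have hq : ∀ a b, star (q a) ⬝ᵥ q b = if a = b then 1 else 0 := by
    intro a b
    simp [hqdef, Pi.single_apply, eq_comm]
  let w : Fin n × Fin n → skewAdjoint (Matrix (Fin n) (Fin n) ℂ) := fun p =>
    ⟨_, skewBasis_mem q p⟩
  have hw : LinearIndependent ℝ w := by
    have h1 : skewSubtype n ∘ w = skewBasis q := rfl
    refine LinearIndependent.of_comp (skewSubtype n) ?_
    rw [h1]
    exact linearIndependent_skewBasis hq
  have hspan := hw.span_eq_top_of_card_eq_finrank' (by rw [finrank_skewAdjoint]; simp [sq])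
  have hzero : ∀ W : skewAdjoint (Matrix (Fin n) (Fin n) ℂ),
      ((0 : ℝ), W) ∈ Submodule.span ℝ (unitarySkewPairs n) := by
    intro W
    have hle : Submodule.span ℝ (Set.range w) ≤
        (Submodule.span ℝ (unitarySkewPairs n)).comap (LinearMap.inr ℝ ℝ _) := by
      rw [Submodule.span_le]
      rintro _ ⟨p, rfl⟩
      exact skewBasis_pair_mem_span _ p
    exact hle (hspan ▸ Submodule.mem_top)
  have hone : ((1 : ℝ), (0 : skewAdjoint (Matrix (Fin n) (Fin n) ℂ))) ∈
      Submodule.span ℝ (unitarySkewPairs n) := by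
    let J : skewAdjoint (Matrix (Fin n) (Fin n) ℂ) := ⟨_, I_smul_one_mem_skewAdjoint⟩
    have h1 : ((1 : ℝ), J) ∈ Submodule.span ℝ (unitarySkewPairs n) :=
      Submodule.subset_span ⟨rfl, I_smul_one_mem_unitaryGroup⟩
    convert Submodule.sub_mem _ h1 (hzero J) using 1
    simp
  rw [eq_top_iff]
  rintro ⟨a, W⟩ -
  have := Submodule.add_mem _ (Submodule.smul_mem _ a hone) (hzero W)
  simpa using this

/-- A basis (1, Wⱼ) of ℝ × 𝔲(n) with Wⱼ unitary gives the groups diag(1, Wⱼ) and diag(Wⱼ, 1). In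
each block a real multiple of the identity and a skew-Hermitian matrix are added; the real part of
the trace separates them. -/
theorem exists_isTwoGroupBlockCode (hn : 0 < n) : ∃ A, IsTwoGroupBlockCode n A := by
  obtain ⟨v, hv, -, hli⟩ := Submodule.exists_fun_fin_finrank_span_eq ℝ (unitarySkewPairs n)
  have hfin : n ^ 2 + 1 = Module.finrank ℝ (Submodule.span ℝ (unitarySkewPairs n)) := by
    rw [span_unitarySkewPairs, finrank_top, Module.finrank_prod, finrank_skewAdjoint,
      Module.finrank_self, add_comm]
  let W : Fin (n ^ 2 + 1) → Matrix (Fin n) (Fin n) ℂ := fun j => (v (Fin.cast hfin j)).2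
  have hWU : ∀ j, W j ∈ Matrix.unitaryGroup (Fin n) ℂ := fun j => (hv _).2
  have hWS : ∀ j, (W j).conjTranspose = -W j := fun j =>
    skewAdjoint.mem_iff.mp (v (Fin.cast hfin j)).2.2
  have hindep : ∀ x : Fin (n ^ 2 + 1) → ℝ, ∑ j, x j = 0 → ∑ j, x j • W j = 0 → x = 0 := by
    intro x h1 h2
    have hli' := hli.comp _ (Fin.cast_injective hfin)
    rw [Fintype.linearIndependent_iff] at hli'
    refine funext (hli' x (Prod.ext ?_ (Subtype.ext ?_)))
    · rw [Prod.fst_sum]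
      simp only [Function.comp, Prod.smul_fst, (hv _).1, smul_eq_mul, mul_one, Prod.fst_zero]
      exact h1
    · rw [Prod.snd_sum, AddSubgroup.val_finsetSum]
      exact h2
  have htr : ∀ x : Fin (n ^ 2 + 1) → ℝ, (∑ j, x j • W j).trace.re = 0 := by
    intro x
    have h1 : (∑ j, x j • W j).conjTranspose = -∑ j, x j • W j := by
      simp [Matrix.conjTranspose_sum, Matrix.conjTranspose_smul, hWS]
    have h2 := congrArg (fun Z => (Matrix.trace Z).re) h1
    simp only [Matrix.trace_conjTranspose, Matrix.trace_neg, Complex.neg_re, Complex.star_def,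
      Complex.conj_re] at h2
    linarith
  have hscalar : ∀ (a : ℝ) (x : Fin (n ^ 2 + 1) → ℝ),
      a • (1 : Matrix (Fin n) (Fin n) ℂ) + ∑ j, x j • W j = 0 → a = 0 ∧ ∑ j, x j • W j = 0 := by
    intro a x h
    have h1 := congrArg (fun Z => (Matrix.trace Z).re) h
    simp only [Matrix.trace_add, Complex.add_re, htr, add_zero, Matrix.trace_smul,
      Matrix.trace_one, Matrix.trace_zero, Complex.zero_re, Fintype.card_fin] at h1
    have h2 : a = 0 := by
      have hn' : (n : ℝ) ≠ 0 := by exact_mod_cast hn.ne'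
      simpa [hn.ne'] using h1
    subst h2
    exact ⟨rfl, by simpa using h⟩
  refine ⟨Sum.elim (fun j => Matrix.fromBlocks 1 0 0 (W j)) (fun j => Matrix.fromBlocks (W j) 0 0 1),
    ?_, ⟨1, one_mem _, fun j => ⟨W j, hWU j, rfl⟩⟩, ⟨1, one_mem _, fun j => ⟨W j, hWU j, rfl⟩⟩, ?_⟩
  · rw [Fintype.linearIndependent_iff]
    intro x hx
    rw [Fintype.sum_sum_type] at hx
    simp only [Sum.elim_inl, Sum.elim_inr] at hx
    have hb1 := congrArg Matrix.toBlocks₁₁ hx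
    have hb2 := congrArg Matrix.toBlocks₂₂ hx
    have e1 : (∑ j, x (Sum.inl j)) • (1 : Matrix (Fin n) (Fin n) ℂ) +
        ∑ j, x (Sum.inr j) • W j = 0 := by
      ext a b
      have := congrFun (congrFun hb1 a) b
      simpa [Matrix.toBlocks₁₁, Matrix.sum_apply, Finset.sum_mul] using this
    have e2 : (∑ j, x (Sum.inr j)) • (1 : Matrix (Fin n) (Fin n) ℂ) +
        ∑ j, x (Sum.inl j) • W j = 0 := by
      ext a b
      have := congrFun (congrFun hb2 a) b
      rw [add_comm]
      simpa [Matrix.toBlocks₂₂, Matrix.sum_apply, Finset.sum_mul] using this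
    obtain ⟨h1, h2⟩ := hscalar _ _ e1
    obtain ⟨h3, h4⟩ := hscalar _ _ e2
    have h5 := hindep _ h1 h4
    have h6 := hindep _ h3 h2
    rintro (j | j)
    · exact congrFun h5 j
    · exact congrFun h6 j
  · refine isTwoGroupMLDecodable_of_skew fun i j => ?_
    simp [Matrix.fromBlocks_conjTranspose, Matrix.fromBlocks_multiply, Matrix.fromBlocks_add, hWS]

end Existence

/-! ### The equivalent channel matrix of one group -/

section HalfGroup

variable {n L M : ℕ}

/-- One group of the code, up to exchanging the two diagonal blocks by `e`: a constant block `F`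
and blocks `G * W j` with `W j` skew-Hermitian. -/
structure IsHalfGroup (e : Fin n ⊕ Fin n ≃ Fin n ⊕ Fin n) (F G : Matrix (Fin n) (Fin n) ℂ)
    (W : Fin L → skewAdjoint (Matrix (Fin n) (Fin n) ℂ))
    (A : Fin L → Matrix (Fin n ⊕ Fin n) (Fin n ⊕ Fin n) ℂ) : Prop where
  unitary_left : F ∈ Matrix.unitaryGroup (Fin n) ℂ
  unitary_right : G ∈ Matrix.unitaryGroup (Fin n) ℂ
  eq_submatrix : ∀ j, A j = (Matrix.fromBlocks F 0 0 (G * (W j).1)).submatrix e e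
  linearIndependent : LinearIndependent ℝ A

/-- One receive antenna with channel vector `v` suffices: orthogonality is then the vanishing of the
real part of the quadratic form at `v`. -/
theorem IsTwoGroupMLDecodable.conjTranspose_mul_skew {κ₁ κ₂ τ ν : Type} [Fintype κ₁] [Fintype κ₂]
    [Fintype τ] [Fintype ν] [DecidableEq ν] {A : κ₁ ⊕ κ₂ → Matrix τ ν ℂ}
    (hA : IsTwoGroupMLDecodable A) (i : κ₁) (j : κ₂) :
    ((A (Sum.inl i)).conjTranspose * A (Sum.inr j)).conjTranspose =
      -((A (Sum.inl i)).conjTranspose * A (Sum.inr j)) := by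
  classical
  refine conjTranspose_eq_neg_of_re_eq_zero fun v => ?_
  have h := hA.dotProduct_eq_zero (M := 1) (Matrix.of fun i _ => v i) (Pi.single i 1) (Pi.single j 1)
  have e₁ : codeword (A ∘ Sum.inl) (Pi.single i 1) = A (Sum.inl i) := by
    simp [codeword, Pi.single_apply, apply_ite Complex.ofReal]
  have e₂ : codeword (A ∘ Sum.inr) (Pi.single j 1) = A (Sum.inr j) := by
    simp [codeword, Pi.single_apply, apply_ite Complex.ofReal]
  rw [e₁, e₂, dotProduct_vecTilde_mul, Matrix.mul_assoc, Matrix.trace, Fin.sum_univ_one,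
    Matrix.diag_apply, Matrix.mul_apply] at h
  exact h

/-- The diagonal blocks of the skew-Hermitian cross products are `F₁ᴴ V₁` and `V₂ᴴ F₂`. So each
varying block is the constant block of the other group times a skew-Hermitian matrix; index 0 merely
supplies a member of the other group. -/
theorem IsTwoGroupBlockCode.isHalfGroup
    {A : Fin (n ^ 2 + 1) ⊕ Fin (n ^ 2 + 1) → Matrix (Fin n ⊕ Fin n) (Fin n ⊕ Fin n) ℂ}
    (hA : IsTwoGroupBlockCode n A) :
    (∃ F G W, IsHalfGroup (Equiv.refl _) F G W (A ∘ Sum.inl)) ∧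
    (∃ F G W, IsHalfGroup (Equiv.sumComm _ _) F G W (A ∘ Sum.inr)) := by
  obtain ⟨F₁, hF₁, h₁⟩ := hA.firstGroup
  obtain ⟨F₂, hF₂, h₂⟩ := hA.secondGroup
  choose V₂ hV₂ hA₁ using h₁
  choose V₁ hV₁ hA₂ using h₂
  have hskew : ∀ i j, (F₁.conjTranspose * V₁ j).conjTranspose = -(F₁.conjTranspose * V₁ j) ∧
      (F₂.conjTranspose * V₂ i).conjTranspose = -(F₂.conjTranspose * V₂ i) := by
    intro i j
    have h := hA.twoGroup.conjTranspose_mul_skew i j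
    rw [hA₁, hA₂, Matrix.fromBlocks_conjTranspose, Matrix.fromBlocks_multiply,
      Matrix.fromBlocks_conjTranspose, Matrix.fromBlocks_neg, Matrix.fromBlocks_inj] at h
    simp only [Matrix.conjTranspose_zero, Matrix.zero_mul, add_zero, zero_add,
      Matrix.conjTranspose_mul, Matrix.conjTranspose_conjTranspose] at h
    refine ⟨by simpa using h.1, ?_⟩
    rw [Matrix.conjTranspose_mul, Matrix.conjTranspose_conjTranspose, h.2.2.2, neg_neg]
  have hcancel : ∀ {G V : Matrix (Fin n) (Fin n) ℂ}, G ∈ Matrix.unitaryGroup (Fin n) ℂ →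
      G * (G.conjTranspose * V) = V := by
    intro G V hG
    rw [Matrix.mem_unitaryGroup_iff, Matrix.star_eq_conjTranspose] at hG
    rw [← Matrix.mul_assoc, hG, Matrix.one_mul]
  refine ⟨⟨F₁, F₂, fun j => ⟨F₂.conjTranspose * V₂ j, skewAdjoint.mem_iff.mpr (hskew j 0).2⟩,
    hF₁, hF₂, fun j => ?_, hA.linearIndependent.comp _ Sum.inl_injective⟩,
    ⟨F₂, F₁, fun j => ⟨F₁.conjTranspose * V₁ j, skewAdjoint.mem_iff.mpr (hskew 0 j).1⟩,
    hF₂, hF₁, fun j => ?_, hA.linearIndependent.comp _ Sum.inr_injective⟩⟩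
  · rw [Function.comp, hA₁, hcancel hF₂]
    rfl
  · rw [Function.comp, hA₂, hcancel hF₁]
    exact (Matrix.fromBlocks_submatrix_sum_swap_sum_swap _ _ _ _).symm

variable {e : Fin n ⊕ Fin n ≃ Fin n ⊕ Fin n} {F G : Matrix (Fin n) (Fin n) ℂ}
  {W : Fin L → skewAdjoint (Matrix (Fin n) (Fin n) ℂ)}
  {A : Fin L → Matrix (Fin n ⊕ Fin n) (Fin n ⊕ Fin n) ℂ}

namespace IsHalfGroup

theorem codeword_eq (hA : IsHalfGroup e F G W A) (x : Fin L → ℝ) :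
    codeword A x = (Matrix.fromBlocks ((∑ j, x j) • F) 0 0
      (G * (∑ j, x j • W j : skewAdjoint (Matrix (Fin n) (Fin n) ℂ)).1)).submatrix e e := by
  have h1 : (∑ j, x j • W j : skewAdjoint (Matrix (Fin n) (Fin n) ℂ)).1 =
      ∑ j, x j • (W j).1 := AddSubgroup.val_finsetSum _ _ _
  rw [h1]
  ext a b
  simp only [codeword, Matrix.sum_apply, hA.eq_submatrix, Matrix.smul_apply,
    Matrix.submatrix_apply, Matrix.mul_sum]
  rcases e a with a' | a' <;> rcases e b with b' | b' <;>
    simp [Matrix.sum_apply, Finset.sum_mul]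

theorem linearIndependent_pair (hA : IsHalfGroup e F G W A) :
    LinearIndependent ℝ fun j => ((1 : ℝ), W j) := by
  have hli := hA.linearIndependent
  rw [Fintype.linearIndependent_iff] at hli ⊢
  intro x hx
  refine hli x ?_
  have h1 : ∑ j, x j = 0 := by
    have := congrArg Prod.fst hx
    simpa [Prod.fst_sum] using this
  have h2 : ∑ j, x j • W j = 0 := by
    have := congrArg Prod.snd hx
    simpa [Prod.snd_sum] using this
  have h3 := hA.codeword_eq x
  rw [h1, h2] at h3
  have h4 : codeword A x = ∑ j, x j • A j := by
    ext a b; simp [codeword, Matrix.sum_apply]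
  rw [← h4, h3]
  ext a b
  simp only [Matrix.submatrix_apply]
  rcases e a with a' | a' <;> rcases e b with b' | b' <;> simp

/-- Coordinates of the elements of `ℝ × 𝔲(n)` in the span of the group. -/
theorem exists_coords (hA : IsHalfGroup e F G W A) (hL : L = n ^ 2 + 1) :
    ∃ c : (ℝ × skewAdjoint (Matrix (Fin n) (Fin n) ℂ)) ≃ₗ[ℝ] (Fin L → ℝ),
      ∀ a U, codeword A (c (a, U)) = (Matrix.fromBlocks (a • F) 0 0 (G * U.1)).submatrix e e := by
  have hcard : Fintype.card (Fin L) =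
      Module.finrank ℝ (ℝ × skewAdjoint (Matrix (Fin n) (Fin n) ℂ)) := by
    rw [Module.finrank_prod, finrank_skewAdjoint, Module.finrank_self, Fintype.card_fin, hL,
      add_comm]
  have : Nonempty (Fin L) := ⟨⟨0, by omega⟩⟩
  let b := basisOfLinearIndependentOfCardEqFinrank hA.linearIndependent_pair hcard
  refine ⟨b.equivFun, fun a U => ?_⟩
  have h := b.sum_equivFun (a, U)
  simp only [b, coe_basisOfLinearIndependentOfCardEqFinrank] at h
  rw [hA.codeword_eq]
  have h1 := congrArg Prod.fst h
  have h2 := congrArg Prod.snd h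
  simp only [Prod.fst_sum, Prod.snd_sum, Prod.smul_fst, Prod.smul_snd, smul_eq_mul, mul_one]
    at h1 h2
  rw [h1, h2]

end IsHalfGroup

end HalfGroup

/-! ### The rank and a large minor of the equivalent channel matrix of one group -/

section Minor

variable {n L M : ℕ}

/-- The columns of a channel matrix, extended by zero or truncated to a family of length `n`. -/
def columnFamily (H : Fin n → Fin M → ℂ) (j : Fin n) : EuclideanSpace ℂ (Fin n) :=
  if hj : (j : ℕ) < M then WithLp.toLp 2 fun i => H i ⟨j, hj⟩ else 0

/-- The unitary basis obtained from the columns of the channel matrix. -/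
def columnBasis (H : Fin n → Fin M → ℂ) : OrthonormalBasis (Fin n) ℂ (EuclideanSpace ℂ (Fin n)) :=
  InnerProductSpace.gramSchmidtOrthonormalBasis (by simp) (columnFamily H)

/-- The distance of the `j`-th column from the span of the preceding ones. -/
def columnDist (H : Fin n → Fin M → ℂ) (j : Fin n) : ℝ :=
  ‖InnerProductSpace.gramSchmidt ℂ (columnFamily H) j‖

theorem star_dotProduct_columnBasis (H : Fin n → Fin M → ℂ) (a b : Fin n) :
    star (columnBasis H a).ofLp ⬝ᵥ (columnBasis H b).ofLp = if a = b then 1 else 0 := by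
  have := orthonormal_iff_ite.mp (columnBasis H).orthonormal a b
  rwa [EuclideanSpace.inner_eq_star_dotProduct, dotProduct_comm] at this

theorem star_columnBasis_dotProduct_eq_zero (H : Fin n → Fin M → ℂ) {c l : Fin n} (h : c < l) :
    star (columnBasis H l).ofLp ⬝ᵥ (columnFamily H c).ofLp = 0 := by
  have := InnerProductSpace.gramSchmidtOrthonormalBasis_inv_triangular (𝕜 := ℂ)
    (E := EuclideanSpace ℂ (Fin n)) (by simp) (columnFamily H) h
  rwa [EuclideanSpace.inner_eq_star_dotProduct, dotProduct_comm] at this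

theorem star_columnBasis_dotProduct_self (H : Fin n → Fin M → ℂ) (c : Fin n) :
    star (columnBasis H c).ofLp ⬝ᵥ (columnFamily H c).ofLp = (columnDist H c : ℂ) := by
  have key : inner ℂ (columnBasis H c) (columnFamily H c) = (columnDist H c : ℂ) := by
    -- If the columns are dependent or padded by zero, the basis vector is an arbitrary completion;
    -- both sides are then zero.
    by_cases h0 : InnerProductSpace.gramSchmidt ℂ (columnFamily H) c = 0
    · rw [columnDist, h0, norm_zero, Complex.ofReal_zero]
      refine InnerProductSpace.inner_gramSchmidtOrthonormalBasis_eq_zero _ ?_ _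
      rw [InnerProductSpace.gramSchmidtNormed, h0, smul_zero]
    · have h1 : columnBasis H c = InnerProductSpace.gramSchmidtNormed ℂ (columnFamily H) c := by
        refine InnerProductSpace.gramSchmidtOrthonormalBasis_apply _ ?_
        rw [InnerProductSpace.gramSchmidtNormed]
        exact smul_ne_zero (by simpa using h0) h0
      have h2 : inner ℂ (InnerProductSpace.gramSchmidt ℂ (columnFamily H) c) (columnFamily H c) =
          ((columnDist H c : ℂ)) ^ 2 := by
        rw [InnerProductSpace.gramSchmidt_def'' ℂ (columnFamily H) c, inner_add_right, inner_sum,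
          Finset.sum_eq_zero, add_zero, inner_self_eq_norm_sq_to_K]
        · simp [columnDist]
        · intro i hi
          rw [inner_smul_right, InnerProductSpace.gramSchmidt_orthogonal ℂ _
            (Finset.mem_Iio.mp hi).ne', mul_zero]
      rw [h1, InnerProductSpace.gramSchmidtNormed, inner_smul_left, h2]
      have h3 : (columnDist H c : ℂ) ≠ 0 := by
        rw [columnDist]; exact_mod_cast norm_ne_zero_iff.mpr h0
      change (starRingEnd ℂ) ((columnDist H c : ℂ)⁻¹) * _ = _
      rw [map_inv₀, Complex.conj_ofReal]
      field_simp
  rw [← key, EuclideanSpace.inner_eq_star_dotProduct, dotProduct_comm]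

/-- The row vector of the functional `Y ↦ Re ∑ κ t * Y t c`. -/
def rowFunctional {τ μ : Type} [DecidableEq μ] (κ : τ → ℂ) (c : μ) : (μ × τ) ⊕ (μ × τ) → ℝ :=
  Sum.elim (fun r => if r.1 = c then (κ r.2).re else 0) (fun r => if r.1 = c then -(κ r.2).im else 0)

theorem rowFunctional_dotProduct {τ μ : Type} [Fintype τ] [Fintype μ] [DecidableEq μ] (κ : τ → ℂ)
    (c : μ) (Y : Matrix τ μ ℂ) : rowFunctional κ c ⬝ᵥ vecTilde Y = (∑ t, κ t * Y t c).re := by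
  simp only [rowFunctional, vecTilde, dotProduct, Fintype.sum_sum_type, Fintype.sum_prod_type,
    Sum.elim_inl, Sum.elim_inr, Matrix.vec, Matrix.map_apply, ite_mul, zero_mul]
  rw [Finset.sum_comm, Finset.sum_comm (γ := μ), ← Finset.sum_add_distrib]
  simp [sub_eq_add_neg]

theorem abs_rowFunctional_le {τ μ : Type} [DecidableEq μ] {κ : τ → ℂ} (hκ : ∀ t, ‖κ t‖ ≤ 1)
    (c : μ) (r : (μ × τ) ⊕ (μ × τ)) : |rowFunctional κ c r| ≤ 1 := by
  rcases r with r | r <;> simp only [rowFunctional, Sum.elim_inl, Sum.elim_inr]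
  · split_ifs
    · exact (Complex.abs_re_le_norm _).trans (hκ _)
    · simp
  · split_ifs
    · rw [abs_neg]; exact (Complex.abs_im_le_norm _).trans (hκ _)
    · simp

theorem norm_apply_le_one_of_star_dotProduct {q : Fin n → ℂ} (hq : star q ⬝ᵥ q = 1) (i : Fin n) :
    ‖q i‖ ≤ 1 := by
  have h1 : ∑ j, ‖q j‖ ^ 2 = 1 := by
    have := congrArg Complex.re hq
    simp only [dotProduct, Pi.star_apply, Complex.re_sum, Complex.one_re] at this
    rw [← this]
    refine Finset.sum_congr rfl fun j _ => ?_
    rw [Complex.star_def, ← Complex.normSq_eq_conj_mul_self, Complex.ofReal_re, Complex.sq_norm]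
  have h2 : ‖q i‖ ^ 2 ≤ 1 := by
    rw [← h1]
    exact Finset.single_le_sum (f := fun j => ‖q j‖ ^ 2) (fun j _ => by positivity)
      (Finset.mem_univ i)
  exact (sq_le_one_iff₀ (norm_nonneg _)).mp h2

variable {e : Fin n ⊕ Fin n ≃ Fin n ⊕ Fin n} {F G : Matrix (Fin n) (Fin n) ℂ}
  {W : Fin L → skewAdjoint (Matrix (Fin n) (Fin n) ℂ)}
  {A : Fin L → Matrix (Fin n ⊕ Fin n) (Fin n ⊕ Fin n) ℂ}

/-- Index set of the columns of the minor: the constant block and the pairs with `lo p < M`. -/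
abbrev MinorIndex (n M : ℕ) : Type := Unit ⊕ {p : Fin n × Fin n // (lo p : ℕ) < M}

theorem card_not_lo_lt :
    Fintype.card {p : Fin n × Fin n // ¬ (lo p : ℕ) < M} = (n - M) ^ 2 := by
  have h1 : Fintype.card {i : Fin n // ¬ (i : ℕ) < M} = n - M := by
    rw [Fintype.card_subtype_compl, Fintype.card_fin, Fintype.card_subtype, Fin.card_filter_val_lt]
    omega
  let φ : {p : Fin n × Fin n // ¬ (lo p : ℕ) < M} ≃
      {i : Fin n // ¬ (i : ℕ) < M} × {i : Fin n // ¬ (i : ℕ) < M} :=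
    { toFun := fun p => (⟨p.1.1, fun h => p.2 (lt_of_le_of_lt (Fin.le_def.mp (min_le_left _ _)) h)⟩,
        ⟨p.1.2, fun h => p.2 (lt_of_le_of_lt (Fin.le_def.mp (min_le_right _ _)) h)⟩)
      invFun := fun p => ⟨(p.1.1, p.2.1), by
        rcases min_choice p.1.1 p.2.1 with h | h
        · rw [lo, h]; exact p.1.2
        · rw [lo, h]; exact p.2.2⟩
      left_inv := fun p => rfl
      right_inv := fun p => rfl }
  rw [Fintype.card_congr φ, Fintype.card_prod, h1, sq]

theorem card_minorIndex : Fintype.card (MinorIndex n M) = n ^ 2 + 1 - (n - M) ^ 2 := by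
  have h3 := Fintype.card_subtype_compl (fun p : Fin n × Fin n => (lo p : ℕ) < M)
  have h4 := Fintype.card_subtype_le (fun p : Fin n × Fin n => (lo p : ℕ) < M)
  simp only [Fintype.card_prod, Fintype.card_fin, ← sq] at h3 h4
  rw [card_not_lo_lt] at h3
  rw [Fintype.card_sum, Fintype.card_unit]
  omega

namespace IsHalfGroup

theorem mul_apply (e : Fin n ⊕ Fin n ≃ Fin n ⊕ Fin n)
    (F : Matrix (Fin n) (Fin n) ℂ) (G U : Matrix (Fin n) (Fin n) ℂ) (a : ℝ)
    (H : Matrix (Fin n ⊕ Fin n) (Fin M) ℂ) (s : Fin n ⊕ Fin n) (c : Fin M) :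
    ((Matrix.fromBlocks (a • F) 0 0 (G * U)).submatrix e e * H) (e.symm s) c =
      Sum.elim ((a : ℂ) • F.mulVec fun i => H (e.symm (Sum.inl i)) c)
        (G.mulVec (U.mulVec fun i => H (e.symm (Sum.inr i)) c)) s := by
  rw [Matrix.mul_apply, ← Equiv.sum_comp e.symm, Fintype.sum_sum_type]
  rcases s with s | s
  · simp [Matrix.mulVec, dotProduct, Finset.mul_sum, mul_assoc]
  · rw [Matrix.mulVec_mulVec]
    simp [Matrix.mulVec, dotProduct]

/-- The elements of `skewBasis` with both indices at least `M` kill all columns of the lower half of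
the channel, giving `(n - M) ^ 2` independent kernel vectors for every `H`. -/
theorem rank_le (hA : IsHalfGroup e F G W A) (hL : L = n ^ 2 + 1)
    (H : Matrix (Fin n ⊕ Fin n) (Fin M) ℂ) :
    (equivChannel A H).rank ≤ Fintype.card (MinorIndex n M) := by
  obtain ⟨c, hc⟩ := hA.exists_coords hL
  set H₂ : Fin n → Fin M → ℂ := fun i => H (e.symm (Sum.inr i))
  set q : Fin n → Fin n → ℂ := fun a => (columnBasis H₂ a).ofLp
  let w : {p : Fin n × Fin n // ¬ (lo p : ℕ) < M} → (Fin L → ℝ) := fun p =>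
    c (0, ⟨_, skewBasis_mem q p⟩)
  have hw : LinearIndependent ℝ w := by
    have h1 : LinearIndependent ℝ fun p : Fin n × Fin n =>
        (⟨_, skewBasis_mem q p⟩ : skewAdjoint (Matrix (Fin n) (Fin n) ℂ)) := by
      refine LinearIndependent.of_comp (skewSubtype n) ?_
      exact linearIndependent_skewBasis (star_dotProduct_columnBasis H₂)
    have h2 := h1.map' (c.toLinearMap.comp (LinearMap.inr ℝ ℝ _)) (by
      rw [LinearMap.ker_eq_bot]
      exact c.injective.comp LinearMap.inr_injective)
    exact h2.comp (fun p : {p : Fin n × Fin n // ¬ (lo p : ℕ) < M} => p.1) Subtype.val_injective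
  have hker : ∀ p, w p ∈ LinearMap.ker (equivChannel A H).mulVecLin := by
    intro p
    have hM : M ≤ (lo p.1 : ℕ) := not_lt.mp p.2
    rw [LinearMap.mem_ker, Matrix.mulVecLin_apply, equivChannel_mulVec, hc]
    have hz : (Matrix.fromBlocks ((0 : ℝ) • F) 0 0 (G * skewBasis q p.1)).submatrix e e * H = 0 := by
      ext t c
      obtain ⟨s, rfl⟩ := e.symm.surjective t
      rw [mul_apply, skewBasis_mulVec_eq_zero]
      · rcases s with s | s <;> simp
      · intro l hl
        have hcn : (c : ℕ) < n := by have := (lo p.1).2; have := c.2; omega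
        have h := star_columnBasis_dotProduct_eq_zero H₂ (c := ⟨c, hcn⟩) (l := l)
          (by rw [Fin.lt_def]; have := Fin.le_def.mp hl; have := c.2; simp only; omega)
        rwa [columnFamily, dif_pos c.2] at h
    rw [hz, vecTilde_zero]
  have h1 : (n - M) ^ 2 ≤ Module.finrank ℝ (LinearMap.ker (equivChannel A H).mulVecLin) := by
    rw [← card_not_lo_lt, ← finrank_span_eq_card hw]
    refine Submodule.finrank_mono (Submodule.span_le.mpr ?_)
    rintro _ ⟨p, rfl⟩
    exact hker p
  have h2 := LinearMap.finrank_range_add_finrank_ker (equivChannel A H).mulVecLin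
  rw [Module.finrank_fin_fun] at h2
  rw [card_minorIndex, Matrix.rank]
  omega

/-- The skew-Hermitian basis varies with `H`, but its entries stay at most 2; this makes the bound
on its coordinates uniform in `H`. The left inverse `g` extends the coordinate map to all matrices,
where the sup norm is entrywise. -/
theorem exists_coords_bound (c : (ℝ × skewAdjoint (Matrix (Fin n) (Fin n) ℂ)) ≃ₗ[ℝ] (Fin L → ℝ)) :
    ∃ b : ℝ, 0 ≤ b ∧ (∀ l, |c (1, 0) l| ≤ b) ∧
      ∀ U : skewAdjoint (Matrix (Fin n) (Fin n) ℂ), (∀ i j, ‖U.1 i j‖ ≤ 2) →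
        ∀ l, |c (0, U) l| ≤ b := by
  obtain ⟨g, hg⟩ := LinearMap.exists_leftInverse_of_injective (skewSubtype n)
    (LinearMap.ker_eq_bot.mpr Subtype.val_injective)
  let T : (Fin n → Fin n → ℂ) →ₗ[ℝ] (Fin L → ℝ) :=
    (c.toLinearMap.comp (LinearMap.inr ℝ ℝ _)).comp (g.comp (Matrix.ofLinearEquiv ℝ).toLinearMap)
  let T' := LinearMap.toContinuousLinearMap T
  refine ⟨max ‖c (1, 0)‖ (‖T'‖ * 2), le_max_of_le_left (norm_nonneg _), fun l => ?_,
    fun U hU l => ?_⟩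
  · exact le_max_of_le_left (norm_le_pi_norm (c (1, 0)) l)
  · refine le_max_of_le_right ?_
    have h1 : T' U.1 = c (0, U) := by
      have h2 : g U.1 = U := LinearMap.congr_fun hg U
      change c (0, g U.1) = _
      rw [h2]
    let u : Fin n → Fin n → ℂ := U.1
    have h3 : ‖u‖ ≤ 2 :=
      (pi_norm_le_iff_of_nonneg zero_le_two).mpr fun i =>
        (pi_norm_le_iff_of_nonneg zero_le_two).mpr fun j => hU i j
    calc |c (0, U) l| ≤ ‖c (0, U)‖ := norm_le_pi_norm (c (0, U)) l
      _ = ‖T' u‖ := by rw [← h1]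
      _ ≤ ‖T'‖ * ‖u‖ := T'.le_opNorm _
      _ ≤ _ := by gcongr

/-- Bounded row and column operations bring the equivalent channel matrix into triangular form. -/
theorem exists_det_eq (hA : IsHalfGroup e F G W A) (hL : L = n ^ 2 + 1) (i₀ : Fin n)
    (c₀ : Fin M) : ∃ b : ℝ, 0 ≤ b ∧ ∀ H : Matrix (Fin n ⊕ Fin n) (Fin M) ℂ,
      ∃ (X : Matrix (MinorIndex n M) ((Fin M × (Fin n ⊕ Fin n)) ⊕ (Fin M × (Fin n ⊕ Fin n))) ℝ)
        (Z : Matrix (Fin L) (MinorIndex n M) ℝ), (∀ i x, |X i x| ≤ 1) ∧ (∀ j i, |Z j i| ≤ b) ∧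
        (X * equivChannel A H * Z).det = ‖H (e.symm (Sum.inl i₀)) c₀‖ *
          ∏ p : {p : Fin n × Fin n // (lo p : ℕ) < M},
            columnDist (fun i => H (e.symm (Sum.inr i))) (lo p.1) := by
  obtain ⟨c, hc⟩ := hA.exists_coords hL
  obtain ⟨b, hb0, hb1, hb2⟩ := exists_coords_bound c
  refine ⟨b, hb0, fun H => ?_⟩
  set H₂ : Fin n → Fin M → ℂ := fun i => H (e.symm (Sum.inr i)) with hH₂
  set q : Fin n → Fin n → ℂ := fun a => (columnBasis H₂ a).ofLp with hq
  set h : Fin n → Fin n → ℂ := fun a => (columnFamily H₂ a).ofLp with hh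
  have hqq : ∀ a b, star (q a) ⬝ᵥ q b = if a = b then 1 else 0 := star_dotProduct_columnBasis H₂
  obtain ⟨φ, hφ1, hφ⟩ : ∃ φ : ℂ, ‖φ‖ ≤ 1 ∧
      φ * H (e.symm (Sum.inl i₀)) c₀ = ‖H (e.symm (Sum.inl i₀)) c₀‖ := by
    by_cases hz : H (e.symm (Sum.inl i₀)) c₀ = 0
    · exact ⟨0, by simp, by simp [hz]⟩
    · have hz' : (‖H (e.symm (Sum.inl i₀)) c₀‖ : ℂ) ≠ 0 := by
        exact_mod_cast norm_ne_zero_iff.mpr hz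
      refine ⟨‖H (e.symm (Sum.inl i₀)) c₀‖ / H (e.symm (Sum.inl i₀)) c₀, ?_, ?_⟩
      · rw [norm_div, Complex.norm_real, norm_norm, div_self (norm_ne_zero_iff.mpr hz)]
      · field_simp
  have hGq : ∀ a, star (G.mulVec (q a)) ⬝ᵥ G.mulVec (q a) = 1 := by
    intro a
    have hG := hA.unitary_right
    rw [Matrix.mem_unitaryGroup_iff', Matrix.star_eq_conjTranspose] at hG
    rw [Matrix.star_mulVec, ← Matrix.dotProduct_mulVec, Matrix.mulVec_mulVec, hG,
      Matrix.one_mulVec, hqq, if_pos rfl]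
  -- The factor `-I` turns the real part into the imaginary part, so each row computes the
  -- functional `part`.
  let ω : Fin n × Fin n → ℂ := fun p => if p.2 < p.1 then 1 else -Complex.I
  have hω : ∀ p z, (ω p * z).re = part p z := by
    intro p z
    simp only [ω, part]
    split_ifs <;> simp
  -- The first row recovers, up to the phase `φ`, the entry `(i₀, c₀)` of the upper half via `Fᴴ F =
  -- 1`. The row of `p` pairs column `lo p` of the lower half of the output with `G q (hi p)`, and
  -- `Gᴴ G = 1` leaves an entry of `skewEntry`. The different supports make the off-diagonal blocks
  -- vanish.
  let κ : MinorIndex n M → (Fin n ⊕ Fin n) → ℂ := Sum.elim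
    (fun _ t => Sum.elim (fun i => φ * star (F i i₀)) 0 (e t))
    (fun p t => Sum.elim 0 (fun i => ω p.1 * star (G.mulVec (q (hi p.1)) i)) (e t))
  let col : MinorIndex n M → Fin M := Sum.elim (fun _ => c₀) fun p => ⟨lo p.1, p.2⟩
  let z : MinorIndex n M → ℝ × skewAdjoint (Matrix (Fin n) (Fin n) ℂ) :=
    Sum.elim (fun _ => (1, 0)) fun p => (0, ⟨_, skewBasis_mem q p.1⟩)
  have hκ : ∀ r t, ‖κ r t‖ ≤ 1 := by
    rintro (r | p) t
    · simp only [κ, Sum.elim_inl]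
      rcases e t with i | i
      · simp only [Sum.elim_inl, norm_mul, norm_star]
        exact mul_le_one₀ hφ1 (norm_nonneg _) (entry_norm_bound_of_unitary hA.unitary_left i i₀)
      · simp
    · simp only [κ, Sum.elim_inr]
      rcases e t with i | i
      · simp
      · have : ‖ω p.1‖ = 1 := by simp only [ω]; split_ifs <;> simp
        simp only [Sum.elim_inr, norm_mul, norm_star, this, one_mul]
        exact norm_apply_le_one_of_star_dotProduct (hGq _) i
  refine ⟨Matrix.of fun r => rowFunctional (κ r) (col r), Matrix.of fun l u => c (z u) l,
    fun r x => abs_rowFunctional_le (hκ r) _ x, ?_, ?_⟩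
  · rintro l (u | p)
    · exact hb1 l
    · refine hb2 _ (fun i j => norm_skewBasis_apply_le (fun a i => ?_) _ i j) l
      exact norm_apply_le_one_of_star_dotProduct (by rw [hqq, if_pos rfl]) i
  have hentry : ∀ r u, ((Matrix.of fun r => rowFunctional (κ r) (col r)) * equivChannel A H *
      Matrix.of fun l u => c (z u) l) r u = (∑ s, κ r (e.symm s) *
        (Sum.elim (((z u).1 : ℂ) • F.mulVec fun i => H (e.symm (Sum.inl i)) (col r))
        (G.mulVec ((z u).2.1.mulVec fun i => H (e.symm (Sum.inr i)) (col r))) s)).re := by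
    intro r u
    have h1 : ((Matrix.of fun r => rowFunctional (κ r) (col r)) * equivChannel A H *
        Matrix.of fun l u => c (z u) l) r u =
        rowFunctional (κ r) (col r) ⬝ᵥ (equivChannel A H).mulVec (c (z u)) := by
      rw [Matrix.mul_assoc]; rfl
    rw [h1, equivChannel_mulVec, rowFunctional_dotProduct, ← Equiv.sum_comp e.symm, hc]
    congr 1
    refine Finset.sum_congr rfl fun s _ => ?_
    rw [mul_apply]
  have hblocks : (Matrix.of fun r => rowFunctional (κ r) (col r)) * equivChannel A H *
      (Matrix.of fun l u => c (z u) l) = Matrix.fromBlocks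
        (Matrix.of fun _ _ => ‖H (e.symm (Sum.inl i₀)) c₀‖) 0 0
        (Matrix.of fun p' p : {p : Fin n × Fin n // (lo p : ℕ) < M} =>
          skewEntry q h p'.1 p.1) := by
    ext r u
    rw [hentry, Fintype.sum_sum_type]
    rcases r with r | p' <;> rcases u with u | p
    · have hF := hA.unitary_left
      rw [Matrix.mem_unitaryGroup_iff', Matrix.star_eq_conjTranspose] at hF
      have h1 : ∑ i, star (F i i₀) * F.mulVec (fun i => H (e.symm (Sum.inl i)) c₀) i =
          H (e.symm (Sum.inl i₀)) c₀ := by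
        have := congrFun (congrArg (fun Z => Matrix.mulVec Z
          (fun i => H (e.symm (Sum.inl i)) c₀)) hF) i₀
        simp only [Matrix.one_mulVec] at this
        rw [← Matrix.mulVec_mulVec] at this
        exact this
      simp only [κ, z, col, Sum.elim_inl, Sum.elim_inr, Equiv.apply_symm_apply,
        Complex.ofReal_one, one_smul, Pi.zero_apply, zero_mul, Finset.sum_const_zero, add_zero,
        mul_assoc, ← Finset.mul_sum, h1, hφ, Complex.ofReal_re, Matrix.fromBlocks_apply₁₁,
        Matrix.of_apply]
    · simp [κ, z, col]
    · simp [κ, z, col]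
    · have hG := hA.unitary_right
      rw [Matrix.mem_unitaryGroup_iff', Matrix.star_eq_conjTranspose] at hG
      have hcol : (fun i => H (e.symm (Sum.inr i)) (col (Sum.inr p'))) = h (lo p'.1) := by
        simp only [hh, columnFamily, dif_pos p'.2]
        rfl
      have h1 : ∀ v, ∑ i, star (G.mulVec (q (hi p'.1)) i) * G.mulVec v i =
          star (q (hi p'.1)) ⬝ᵥ v := by
        intro v
        have : star (G.mulVec (q (hi p'.1))) ⬝ᵥ G.mulVec v = star (q (hi p'.1)) ⬝ᵥ v := by
          rw [Matrix.star_mulVec, ← Matrix.dotProduct_mulVec, Matrix.mulVec_mulVec, hG,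
            Matrix.one_mulVec]
        exact this
      rw [hcol]
      simp only [κ, z, Sum.elim_inl, Sum.elim_inr, Equiv.apply_symm_apply,
        Pi.zero_apply, zero_mul, Finset.sum_const_zero, zero_add,
        mul_assoc, ← Finset.mul_sum, h1, hω, Matrix.fromBlocks_apply₂₂,
        Matrix.of_apply, skewEntry]
  rw [hblocks, Matrix.det_fromBlocks_zero₂₁, Matrix.det_unique, Matrix.of_apply,
    det_skewEntry (ρ := columnDist H₂) _ hqq
      (fun c l hl => star_columnBasis_dotProduct_eq_zero H₂ hl)
      (fun c => star_columnBasis_dotProduct_self H₂ c)]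

end IsHalfGroup

end Minor

/-! ### The circularly symmetric Gaussian law -/

section Gaussian

instance : IsProbabilityMeasure complexGaussian :=
  Measure.isProbabilityMeasure_map Complex.measurableEquivRealProd.symm.measurable.aemeasurable

theorem half_ne_zero : (1 / 2 : ℝ≥0) ≠ 0 := by norm_num

theorem lintegral_complexGaussian {φ : ℂ → ℝ≥0∞} (hφ : Measurable φ) :
    ∫⁻ z, φ z ∂complexGaussian =
      ∫⁻ z, ENNReal.ofReal (Real.pi⁻¹ * Real.exp (-‖z‖ ^ 2)) * φ z := by
  have h1 : (gaussianReal 0 (1 / 2)).prod (gaussianReal 0 (1 / 2)) =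
      (volume : Measure (ℝ × ℝ)).withDensity
        fun p => gaussianPDF 0 (1 / 2) p.1 * gaussianPDF 0 (1 / 2) p.2 := by
    rw [gaussianReal_of_var_ne_zero 0 half_ne_zero, prod_withDensity (by fun_prop) (by fun_prop)]
    rfl
  rw [complexGaussian, lintegral_map_equiv, h1, lintegral_withDensity_eq_lintegral_mul _
    (by fun_prop) (by fun_prop),
    ← (Complex.volume_preserving_equiv_real_prod.symm).lintegral_comp (by fun_prop)]
  refine lintegral_congr fun p => ?_
  simp only [Pi.mul_apply]
  congr 1
  rw [gaussianPDF, gaussianPDF, ← ENNReal.ofReal_mul (gaussianPDFReal_nonneg _ _ _),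
    gaussianPDFReal_def]
  congr 1
  have h2 : ‖Complex.measurableEquivRealProd.symm p‖ ^ 2 = p.1 ^ 2 + p.2 ^ 2 := by
    rw [Complex.sq_norm, Complex.normSq_apply, Complex.measurableEquivRealProd_symm_apply]
    ring
  rw [h2]
  have h3 : (√(2 * Real.pi * ((1 / 2 : ℝ≥0) : ℝ)))⁻¹ * (√(2 * Real.pi * ((1 / 2 : ℝ≥0) : ℝ)))⁻¹ =
      Real.pi⁻¹ := by
    rw [← mul_inv, Real.mul_self_sqrt (by positivity)]
    congr 1
    push_cast
    ring
  rw [← h3, neg_add, Real.exp_add]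
  simp only [sub_zero]
  have h4 : (2 * ((1 / 2 : ℝ≥0) : ℝ)) = 1 := by push_cast; norm_num
  rw [h4]
  ring_nf

/-- The weight `exp (|z|² / 2)`. -/
def gaussWeight (z : ℂ) : ℝ≥0∞ := ENNReal.ofReal (Real.exp (‖z‖ ^ 2 / 2))

theorem measurable_gaussWeight : Measurable gaussWeight := by
  unfold gaussWeight; fun_prop

/-- The density leaves a factor `exp (-‖z‖ ^ 2 / 2)` after the weight, and `‖z‖ ^ (-s)` is
integrable at the origin of the plane because `s < 2`. -/
theorem lintegral_gaussWeight_mul_rpow_lt_top {s : ℝ} (hs : s < 2) :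
    ∫⁻ z, gaussWeight z * (‖z‖ₑ ^ s)⁻¹ ∂complexGaussian < ⊤ := by
  rw [lintegral_complexGaussian (φ := fun z => gaussWeight z * (‖z‖ₑ ^ s)⁻¹)
    (measurable_gaussWeight.mul (by fun_prop))]
  have hint : Integrable fun x : ℂ => ‖x‖ ^ (-s) * Real.exp (-(1 / 2) * ‖x‖ ^ (2 : ℝ)) := by
    refine Integrable.of_integral_ne_zero ?_
    rw [Complex.integral_rpow_mul_exp_neg_mul_rpow one_le_two (by linarith) (by norm_num)]
    have := Real.Gamma_pos_of_pos (s := (-s + 2) / 2) (by linarith)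
    positivity
  have h1 : ∀ᵐ z : ℂ, ENNReal.ofReal (Real.pi⁻¹ * Real.exp (-‖z‖ ^ 2)) *
      (gaussWeight z * (‖z‖ₑ ^ s)⁻¹) = ENNReal.ofReal Real.pi⁻¹ *
        ENNReal.ofReal (‖z‖ ^ (-s) * Real.exp (-(1 / 2) * ‖z‖ ^ (2 : ℝ))) := by
    have hne : ∀ᵐ z : ℂ, z ≠ 0 := by
      rw [ae_iff]; simp
    filter_upwards [hne] with z hz
    have hz' : 0 < ‖z‖ := norm_pos_iff.mpr hz
    rw [gaussWeight, ← ofReal_norm, ENNReal.ofReal_rpow_of_pos hz',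
      ← ENNReal.ofReal_inv_of_pos (Real.rpow_pos_of_pos hz' _), ← Real.rpow_neg hz'.le,
      ← ENNReal.ofReal_mul (by positivity), ← ENNReal.ofReal_mul (by positivity),
      ← ENNReal.ofReal_mul (by positivity), Real.rpow_two]
    congr 1
    have : Real.exp (-(1 / 2) * ‖z‖ ^ 2) = Real.exp (-‖z‖ ^ 2) * Real.exp (‖z‖ ^ 2 / 2) := by
      rw [← Real.exp_add]; congr 1; ring
    rw [this]; ring
  rw [lintegral_congr_ae h1, lintegral_const_mul' _ _ ENNReal.ofReal_ne_top]
  exact ENNReal.mul_lt_top ENNReal.ofReal_lt_top hint.lintegral_lt_top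

theorem charFun_complexGaussian (t : ℂ) :
    charFun complexGaussian t = Complex.exp (-(‖t‖ : ℂ) ^ 2 / 4) := by
  have h1 : charFun complexGaussian t =
      charFun (gaussianReal 0 (1 / 2)) t.re * charFun (gaussianReal 0 (1 / 2)) t.im := by
    rw [charFun_apply, complexGaussian, integral_map_equiv, charFun_apply_real, charFun_apply_real,
      ← integral_prod_mul]
    refine integral_congr_ae (Filter.Eventually.of_forall fun p => ?_)
    simp only [Complex.measurableEquivRealProd_symm_apply, Complex.inner]
    rw [← Complex.exp_add]
    congr 1
    simp
    ring
  rw [h1, charFun_gaussianReal, charFun_gaussianReal, ← Complex.exp_add]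
  congr 1
  have : ((‖t‖ : ℝ) : ℂ) ^ 2 = (t.re : ℂ) ^ 2 + (t.im : ℂ) ^ 2 := by
    rw [← Complex.ofReal_pow, Complex.sq_norm, Complex.normSq_apply]; push_cast; ring
  rw [this]
  push_cast
  ring

theorem inner_real_eq_re {n : ℕ} (x y : EuclideanSpace ℂ (Fin n)) :
    inner ℝ x y = (inner ℂ x y).re := by
  rw [PiLp.inner_apply, PiLp.inner_apply, Complex.re_sum]
  rfl

/-- The law of a vector with i.i.d. Gaussian entries is invariant under rotations. -/
theorem map_toLp_pi_complexGaussian_repr {n : ℕ}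
    (b : OrthonormalBasis (Fin n) ℂ (EuclideanSpace ℂ (Fin n))) :
    ((Measure.pi fun _ : Fin n => complexGaussian).map (WithLp.toLp 2)).map b.repr =
      (Measure.pi fun _ : Fin n => complexGaussian).map (WithLp.toLp 2) := by
  have hcf : ∀ t : EuclideanSpace ℂ (Fin n),
      charFun ((Measure.pi fun _ : Fin n => complexGaussian).map (WithLp.toLp 2)) t =
        Complex.exp (-(‖t‖ : ℂ) ^ 2 / 4) := by
    intro t
    rw [charFun_pi]
    simp only [charFun_complexGaussian]
    rw [← Complex.exp_sum, ← Complex.ofReal_pow, EuclideanSpace.norm_sq_eq]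
    congr 1
    rw [← Finset.sum_div]
    push_cast
    rw [Finset.sum_neg_distrib]
  have : IsProbabilityMeasure ((Measure.pi fun _ : Fin n => complexGaussian).map
      (WithLp.toLp 2)) :=
    Measure.isProbabilityMeasure_map (MeasurableEquiv.toLp 2 (Fin n → ℂ)).measurable.aemeasurable
  refine Measure.ext_of_charFun (E := EuclideanSpace ℂ (Fin n)) (funext fun t => ?_)
  have h1 : charFun (((Measure.pi fun _ : Fin n => complexGaussian).map (WithLp.toLp 2)).map
      b.repr) t = charFun ((Measure.pi fun _ : Fin n => complexGaussian).map (WithLp.toLp 2))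
        (b.repr.symm t) := by
    rw [charFun_apply, charFun_apply, integral_map (by fun_prop) (by fun_prop)]
    refine integral_congr_ae (Filter.Eventually.of_forall fun x => ?_)
    simp only
    congr 3
    rw [inner_real_eq_re, inner_real_eq_re, ← b.repr.inner_map_map x,
      LinearIsometryEquiv.apply_symm_apply]
  rw [h1, hcf, hcf, LinearIsometryEquiv.norm_map]

end Gaussian

/-! ### Iterated integrals -/

section Iterated

variable {α : Type} [MeasurableSpace α]

/-- Needs no measurability of `φ`; the case `r = ⊤` is why `C` must not vanish. For this reason the
constants below are written `1 + ∫⁻ ...`. -/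
theorem lintegral_const_mul_le_of_ne_zero {ν : Measure α} {φ : α → ℝ≥0∞} {C : ℝ≥0∞} (hC : C ≠ 0)
    (h : ∫⁻ x, φ x ∂ν ≤ C) (r : ℝ≥0∞) : ∫⁻ x, r * φ x ∂ν ≤ r * C := by
  by_cases hr : r = ⊤
  · rw [hr, ENNReal.top_mul hC]; exact le_top
  · rw [lintegral_const_mul' _ _ hr]
    exact mul_le_mul_right h r

/-- A product of factors, each depending on one more coordinate than the preceding one, can be
integrated one coordinate after the other. -/
theorem lintegral_pi_prod_le {ν : Measure α} [SigmaFinite ν] {k : ℕ}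
    (F : ∀ j : Fin k, (Fin j → α) → α → ℝ≥0∞) (C : Fin k → ℝ≥0∞) (h0 : ∀ j, C j ≠ 0)
    (htop : ∀ j, C j ≠ ⊤) (hF : ∀ j g, ∫⁻ x, F j g x ∂ν ≤ C j) :
    ∫⁻ h : Fin k → α, ∏ j, F j (fun i => h (Fin.castLE j.2.le i)) (h j) ∂Measure.pi (fun _ => ν)
      ≤ ∏ j, C j := by
  induction k with
  | zero =>
    rw [Measure.pi_of_empty]
    simp
  | succ k ih =>
    have hmp := (measurePreserving_piFinSuccAbove (fun _ : Fin (k + 1) => ν) (Fin.last k)).symm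
    rw [← hmp.map_eq, lintegral_map_equiv, ← lintegral_prod_swap]
    -- The last coordinate is integrated innermost, with the others frozen; only its own factor
    -- depends on it.
    refine (lintegral_prod_le _).trans ?_
    have h1 : ∀ (g : Fin k → α) (x : α),
        ∏ j, F j (fun i => (MeasurableEquiv.piFinSuccAbove (fun _ => α) (Fin.last k)).symm
            (g, x).swap (Fin.castLE j.2.le i))
          ((MeasurableEquiv.piFinSuccAbove (fun _ => α) (Fin.last k)).symm
            (g, x).swap j) =
        (∏ j : Fin k, F j.castSucc (fun i => g (Fin.castLE j.2.le i)) (g j)) *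
          F (Fin.last k) g x := by
      intro g x
      have hc : ∀ i : Fin k, (MeasurableEquiv.piFinSuccAbove (fun _ => α) (Fin.last k)).symm
          (g, x).swap i.castSucc = g i := by
        intro i
        have := Fin.insertNth_apply_succAbove (α := fun _ => α) (Fin.last k) x g i
        rwa [Fin.succAbove_last] at this
      have hl : (MeasurableEquiv.piFinSuccAbove (fun _ => α) (Fin.last k)).symm
          (g, x).swap (Fin.last k) = x :=
        Fin.insertNth_apply_same (α := fun _ => α) (Fin.last k) x g
      rw [Fin.prod_univ_castSucc, hl]
      congr 1
      · refine Finset.prod_congr rfl fun j _ => ?_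
        rw [hc]
        congr 1
        funext i
        exact hc (Fin.castLE j.2.le i)
      · congr 1
        funext i
        exact hc i
    simp only [h1]
    calc _ ≤ ∫⁻ g : Fin k → α, (∏ j : Fin k, F j.castSucc (fun i => g (Fin.castLE j.2.le i)) (g j)) *
          C (Fin.last k) ∂Measure.pi (fun _ => ν) :=
        lintegral_mono fun g => lintegral_const_mul_le_of_ne_zero (h0 _) (hF _ _) _
      _ = (∫⁻ g : Fin k → α, (∏ j : Fin k, F j.castSucc (fun i => g (Fin.castLE j.2.le i)) (g j))
          ∂Measure.pi (fun _ => ν)) * C (Fin.last k) := lintegral_mul_const' _ _ (htop _)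
      _ ≤ _ := by
        rw [Fin.prod_univ_castSucc]
        refine mul_le_mul_left ?_ _
        exact ih (fun j => F j.castSucc) (fun j => C j.castSucc) (fun j => h0 _) (fun j => htop _)
          fun j g => hF j.castSucc g

/-- Both sides are curried forms of the product law on pairs. Gram–Schmidt works through columns,
while `gaussianMatrix` is built from rows. -/
theorem measurePreserving_transpose (ν : Measure α) [IsProbabilityMeasure ν] (σ τ : Type)
    [Fintype σ] [Fintype τ] :
    MeasurePreserving (fun (H : σ → τ → α) j i => H i j)
      (Measure.pi fun _ => Measure.pi fun _ => ν) (Measure.pi fun _ => Measure.pi fun _ => ν) := by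
  have h1 : ∀ σ τ : Type, ∀ [Fintype σ] [Fintype τ],
      (Measure.pi fun _ : σ × τ => ν).map (MeasurableEquiv.curry σ τ α) =
        Measure.pi fun _ => Measure.pi fun _ => ν := by
    intro σ τ _ _
    have := Measure.infinitePi_map_curry (fun (_ : σ) (_ : τ) => ν)
    simp only [Measure.infinitePi_eq_pi] at this
    exact this
  refine ⟨by fun_prop, ?_⟩
  have h2 : MeasurePreserving (MeasurableEquiv.piCongrLeft (fun _ => α) (Equiv.prodComm σ τ))
      (Measure.pi fun _ => ν) (Measure.pi fun _ => ν) :=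
    measurePreserving_piCongrLeft (fun _ => ν) (Equiv.prodComm σ τ)
  rw [← h1 σ τ, ← h1 τ σ, Measure.map_map (by fun_prop) (by fun_prop)]
  conv_rhs => rw [← h2.map_eq, Measure.map_map (by fun_prop) (by fun_prop)]
  rfl

end Iterated

/-! ### Integrability of inverse powers of the distance to a subspace -/

section Distance

variable {n : ℕ}

theorem prod_gaussWeight (x : Fin n → ℂ) :
    ∏ i, gaussWeight (x i) = ENNReal.ofReal (Real.exp (‖WithLp.toLp 2 x‖ ^ 2 / 2)) := by
  rw [EuclideanSpace.norm_sq_eq, Finset.sum_div, Real.exp_sum,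
    ENNReal.ofReal_prod_of_nonneg fun i _ => (Real.exp_pos _).le]
  rfl

theorem exists_orthonormalBasis_inner_eq_zero (V : Submodule ℂ (EuclideanSpace ℂ (Fin n))) {d : ℕ}
    (hd : Module.finrank ℂ V + d ≤ n) :
    ∃ (b : OrthonormalBasis (Fin n) ℂ (EuclideanSpace ℂ (Fin n))),
      ∀ i : Fin n, (i : ℕ) < d → ∀ v ∈ V, inner ℂ (b i) v = 0 := by
  have h1 : d ≤ Module.finrank ℂ Vᗮ := by
    have := V.finrank_add_finrank_orthogonal
    rw [finrank_euclideanSpace_fin] at this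
    omega
  let c := stdOrthonormalBasis ℂ Vᗮ
  let v : Fin n → EuclideanSpace ℂ (Fin n) := fun i =>
    if hi : (i : ℕ) < d then c ⟨i, hi.trans_le h1⟩ else 0
  obtain ⟨b, hb⟩ := Orthonormal.exists_orthonormalBasis_extension_of_card_eq (𝕜 := ℂ)
    (E := EuclideanSpace ℂ (Fin n)) (ι := Fin n) (by simp) (v := v) (s := {i | (i : ℕ) < d}) (by
      have h2 : ({i : Fin n | (i : ℕ) < d}.domRestrict v) = fun i => (c ⟨i.1, i.2.trans_le h1⟩ :
          EuclideanSpace ℂ (Fin n)) := by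
        funext i
        exact dif_pos i.2
      rw [h2]
      refine (c.orthonormal.comp_linearIsometry Vᗮ.subtypeₗᵢ).comp
        (fun i : {i : Fin n | (i : ℕ) < d} => (⟨i.1, i.2.trans_le h1⟩ : Fin _)) ?_
      intro i j hij
      exact Subtype.ext (Fin.ext (Fin.mk.inj_iff.mp hij)))
  refine ⟨b, fun i hi w hw => ?_⟩
  rw [hb i hi]
  simp only [v, dif_pos hi]
  exact (Submodule.mem_orthogonal' V _).mp (c _).2 w hw

/-- Each of the `d` coordinates orthogonal to `V` is at most the distance. Sharing the power `2 * d
- 1` equally among them gives each the exponent `(2 * d - 1) / d`, which is below the integrability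
threshold 2. For `d = 0` the truncated power is 0. -/
theorem prod_enorm_le_infEDist (V : Submodule ℂ (EuclideanSpace ℂ (Fin n))) {d : ℕ} (hdn : d ≤ n)
    (b : OrthonormalBasis (Fin n) ℂ (EuclideanSpace ℂ (Fin n)))
    (hb : ∀ i : Fin n, (i : ℕ) < d → ∀ v ∈ V, inner ℂ (b i) v = 0)
    (x : EuclideanSpace ℂ (Fin n)) :
    ∏ i : Fin n, ‖b.repr x i‖ₑ ^ (if (i : ℕ) < d then ((2 * d - 1 : ℕ) : ℝ) / d else 0) ≤
      Metric.infEDist x V ^ (2 * d - 1) := by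
  have h1 : ∀ i : Fin n, (i : ℕ) < d → ‖b.repr x i‖ₑ ≤ Metric.infEDist x V := by
    intro i hi
    rw [Metric.le_infEDist]
    intro y hy
    have h2 : b.repr x i = inner ℂ (b i) (x - y) := by
      rw [inner_sub_right, hb i hi y hy, sub_zero, b.repr_apply_apply]
    rw [h2, edist_eq_enorm_sub, ← ofReal_norm, ← ofReal_norm]
    refine ENNReal.ofReal_le_ofReal ((norm_inner_le_norm _ _).trans ?_)
    rw [b.norm_eq_one, one_mul]
  calc _ ≤ ∏ i : Fin n, (if (i : ℕ) < d then
        Metric.infEDist x V ^ (((2 * d - 1 : ℕ) : ℝ) / d) else 1) := by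
        refine Finset.prod_le_prod' fun i _ => ?_
        split_ifs with hi
        · exact ENNReal.rpow_le_rpow (h1 i hi) (by positivity)
        · rw [ENNReal.rpow_zero]
    _ = _ := by
        rw [Finset.prod_ite, Finset.prod_const, Finset.prod_const_one, mul_one,
          Fin.card_filter_val_lt, min_eq_right hdn, ← ENNReal.rpow_natCast, ← ENNReal.rpow_mul]
        rcases Nat.eq_zero_or_pos d with rfl | hd
        · simp
        · rw [div_mul_cancel₀ _ (by positivity), ENNReal.rpow_natCast]

/-- The integral of the inverse distance bounds, depending only on the dimensions. -/
def distConst (n d : ℕ) : ℝ≥0∞ :=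
  ∏ i : Fin n, (1 + ∫⁻ z, gaussWeight z *
    (‖z‖ₑ ^ (if (i : ℕ) < d then ((2 * d - 1 : ℕ) : ℝ) / d else 0))⁻¹ ∂complexGaussian)

theorem distConst_ne_zero (n d : ℕ) : distConst n d ≠ 0 :=
  Finset.prod_ne_zero_iff.mpr fun i _ => by simp

theorem one_add_lintegral_ne_top (d i : ℕ) : 1 + ∫⁻ z, gaussWeight z *
    (‖z‖ₑ ^ (if i < d then ((2 * d - 1 : ℕ) : ℝ) / d else 0))⁻¹ ∂complexGaussian ≠ ⊤ := by
  refine ENNReal.add_ne_top.mpr ⟨ENNReal.one_ne_top,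
    (lintegral_gaussWeight_mul_rpow_lt_top ?_).ne⟩
  split_ifs with hi
  · rw [div_lt_iff₀ (by exact_mod_cast (Nat.zero_le _).trans_lt hi)]
    exact_mod_cast (by omega : 2 * d - 1 < 2 * d)
  · norm_num

theorem distConst_ne_top (n d : ℕ) : distConst n d ≠ ⊤ :=
  ENNReal.prod_ne_top fun i _ => one_add_lintegral_ne_top d i

/-- A rotation preserves the Gaussian law and the weight, so the orthogonal coordinates of
`prod_enorm_le_infEDist` may be taken as independent entries. The bound depends on dimensions only,
not on `V`, so it can be used conditionally on earlier columns. -/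
theorem lintegral_infEDist_inv_le (V : Submodule ℂ (EuclideanSpace ℂ (Fin n))) {d : ℕ}
    (hd : Module.finrank ℂ V + d ≤ n) :
    ∫⁻ x : Fin n → ℂ, (∏ i, gaussWeight (x i)) *
      (Metric.infEDist (WithLp.toLp 2 x) V ^ (2 * d - 1))⁻¹ ∂Measure.pi (fun _ => complexGaussian)
      ≤ distConst n d := by
  obtain ⟨b, hb⟩ := exists_orthonormalBasis_inner_eq_zero V hd
  let s : Fin n → ℝ := fun i => if (i : ℕ) < d then ((2 * d - 1 : ℕ) : ℝ) / d else 0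
  let Ψ : EuclideanSpace ℂ (Fin n) → ℝ≥0∞ := fun y =>
    ∏ i, gaussWeight (y i) * (‖y i‖ₑ ^ s i)⁻¹
  have hm : ∀ i, Measurable fun z : ℂ => gaussWeight z * (‖z‖ₑ ^ s i)⁻¹ := fun i =>
    measurable_gaussWeight.mul (by fun_prop)
  have hΨ : Measurable Ψ := by
    refine Finset.measurable_prod _ fun i _ => ?_
    exact (hm i).comp (by fun_prop : Measurable fun y : EuclideanSpace ℂ (Fin n) => y i)
  calc _ ≤ ∫⁻ x : Fin n → ℂ, Ψ (b.repr (WithLp.toLp 2 x)) ∂Measure.pi (fun _ => complexGaussian) := by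
        refine lintegral_mono fun x => ?_
        simp only [Ψ]
        rw [Finset.prod_mul_distrib, prod_gaussWeight, prod_gaussWeight]
        have h1 : ‖WithLp.toLp 2 (b.repr (WithLp.toLp 2 x)).ofLp‖ = ‖WithLp.toLp 2 x‖ :=
          b.repr.norm_map _
        rw [h1]
        refine mul_le_mul_right ?_ _
        rw [← ENNReal.prod_inv_distrib]
        · exact ENNReal.inv_le_inv.mpr (prod_enorm_le_infEDist V (by omega) b hb _)
        · intro i _ j _ _
          refine Or.inr (ENNReal.rpow_ne_top_of_nonneg ?_ enorm_ne_top)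
          simp only [s]
          split_ifs <;> positivity
    _ = ∫⁻ x : Fin n → ℂ, Ψ (WithLp.toLp 2 x) ∂Measure.pi (fun _ => complexGaussian) := by
        have hl : Measurable (WithLp.toLp 2 : (Fin n → ℂ) → EuclideanSpace ℂ (Fin n)) := by fun_prop
        have hr : Measurable b.repr := by fun_prop
        have := congrArg (fun ν => ∫⁻ y, Ψ y ∂ν) (map_toLp_pi_complexGaussian_repr b)
        simp only at this
        rw [lintegral_map hΨ hr, lintegral_map (f := fun y => Ψ (b.repr y)) (hΨ.comp hr) hl,
          lintegral_map hΨ hl] at this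
        exact this
    _ ≤ _ := by
        exact lintegral_pi_prod_le (fun i _ z => gaussWeight z * (‖z‖ₑ ^ s i)⁻¹) _
          (fun i => by simp) (fun i => one_add_lintegral_ne_top d i) fun i _ => le_add_self

end Distance

/-! ### Integrability of the inverse of the minor -/

section MinorIntegral

theorem measurePreserving_comp_equiv {α ι κ : Type} [MeasurableSpace α] [Fintype ι] [Fintype κ]
    (ν : Measure α) [SigmaFinite ν] (e : ι ≃ κ) :
    MeasurePreserving (fun (g : κ → α) i => g (e i)) (Measure.pi fun _ => ν)
      (Measure.pi fun _ => ν) := by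
  have h := measurePreserving_piCongrLeft (fun _ => ν) e.symm
  have h1 : ⇑(MeasurableEquiv.piCongrLeft (fun _ : ι => α) e.symm) =
      fun (g : κ → α) i => g (e i) := by
    funext g i
    have := MeasurableEquiv.piCongrLeft_apply_apply (β := fun _ : ι => α) e.symm g (e i)
    rwa [e.symm_apply_apply] at this
  rwa [h1] at h

theorem lintegral_le_lintegral_comp {α β : Type} [MeasurableSpace α] [MeasurableSpace β]
    {ν : Measure α} {ν' : Measure β} {T : α → β} (hT : MeasurePreserving T ν ν')
    (φ : β → ℝ≥0∞) : ∫⁻ y, φ y ∂ν' ≤ ∫⁻ x, φ (T x) ∂ν := by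
  rw [← hT.map_eq]
  exact lintegral_map_le _ _

theorem lintegral_pi_fintype_prod_le {α ι : Type} [MeasurableSpace α] [Fintype ι] {ν : Measure α}
    [SigmaFinite ν] (φ : ι → α → ℝ≥0∞) (C : ι → ℝ≥0∞) (h0 : ∀ i, C i ≠ 0) (htop : ∀ i, C i ≠ ⊤)
    (hφ : ∀ i, ∫⁻ x, φ i x ∂ν ≤ C i) :
    ∫⁻ h : ι → α, ∏ i, φ i (h i) ∂Measure.pi (fun _ => ν) ≤ ∏ i, C i := by
  let e := Fintype.equivFin ι
  refine (lintegral_le_lintegral_comp (measurePreserving_comp_equiv ν e) _).trans ?_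
  rw [← e.symm.prod_comp C]
  refine le_trans (le_of_eq (lintegral_congr fun g => ?_))
    (lintegral_pi_prod_le (fun j _ x => φ (e.symm j) x) _ (fun j => h0 _) (fun j => htop _)
      fun j _ => hφ _)
  rw [← e.symm.prod_comp]
  simp

theorem lintegral_gaussWeight_entries_lt_top {σ τ : Type} [Fintype σ] [Fintype τ] (s : σ → τ → ℝ)
    (hs : ∀ i j, s i j < 2) :
    ∫⁻ H, ∏ i, ∏ j, gaussWeight (H i j) * (‖H i j‖ₑ ^ s i j)⁻¹ ∂gaussianMatrix σ τ < ⊤ := by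
  let C : σ → τ → ℝ≥0∞ := fun i j =>
    1 + ∫⁻ z, gaussWeight z * (‖z‖ₑ ^ s i j)⁻¹ ∂complexGaussian
  have h0 : ∀ i j, C i j ≠ 0 := fun i j => by simp [C]
  have htop : ∀ i j, C i j ≠ ⊤ := fun i j =>
    ENNReal.add_ne_top.mpr ⟨ENNReal.one_ne_top, (lintegral_gaussWeight_mul_rpow_lt_top (hs i j)).ne⟩
  refine lt_of_le_of_lt (lintegral_pi_fintype_prod_le
    (fun i (x : τ → ℂ) => ∏ j, gaussWeight (x j) * (‖x j‖ₑ ^ s i j)⁻¹) (fun i => ∏ j, C i j)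
    (fun i => Finset.prod_ne_zero_iff.mpr fun j _ => h0 i j)
    (fun i => ENNReal.prod_ne_top fun j _ => htop i j) fun i => ?_)
    (ENNReal.prod_ne_top fun i _ => ENNReal.prod_ne_top fun j _ => htop i j).lt_top
  exact lintegral_pi_fintype_prod_le (fun j z => gaussWeight z * (‖z‖ₑ ^ s i j)⁻¹) (C i)
    (h0 i) (htop i) fun j => le_add_self

variable {n M : ℕ}

/-- A difference of consecutive squares; truncated subtraction gives 0 for `j ≥ n`. -/
theorem card_lo_eq (j : ℕ) :
    (Finset.univ.filter fun p : Fin n × Fin n => (lo p : ℕ) = j).card = 2 * (n - j) - 1 := by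
  have h1 : ∀ k, (Finset.univ.filter fun p : Fin n × Fin n => ¬ (lo p : ℕ) < k).card =
      (n - k) ^ 2 := by
    intro k
    rw [← card_not_lo_lt, Fintype.card_subtype]
  have h2 : (Finset.univ.filter fun p : Fin n × Fin n => ¬ (lo p : ℕ) < j) =
      (Finset.univ.filter fun p : Fin n × Fin n => ¬ (lo p : ℕ) < j + 1) ∪
        (Finset.univ.filter fun p : Fin n × Fin n => (lo p : ℕ) = j) := by
    ext p
    simp only [Finset.mem_filter, Finset.mem_univ, true_and, Finset.mem_union]
    omega
  have h3 := congrArg Finset.card h2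
  rw [Finset.card_union_of_disjoint, h1, h1] at h3
  · rcases Nat.lt_or_ge j n with hj | hj
    · obtain ⟨d, rfl⟩ := Nat.exists_eq_add_of_lt hj
      have e1 : j + d + 1 - j = d + 1 := by omega
      have e2 : j + d + 1 - (j + 1) = d := by omega
      rw [e1, e2] at h3
      rw [e1]
      have : (d + 1) ^ 2 = d ^ 2 + (2 * d + 1) := by ring
      omega
    · have e1 : n - j = 0 := by omega
      rw [e1] at h3 ⊢
      omega
  · rw [Finset.disjoint_left]
    intro p
    simp only [Finset.mem_filter, Finset.mem_univ, true_and]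
    omega

/-- The span of the columns preceding the `j`-th column. -/
def precedingSpan {j : ℕ} (g : Fin j → Fin n → ℂ) : Submodule ℂ (EuclideanSpace ℂ (Fin n)) :=
  Submodule.span ℂ (Set.range fun i => WithLp.toLp 2 (g i))

theorem finrank_precedingSpan_le {j : ℕ} (g : Fin j → Fin n → ℂ) :
    Module.finrank ℂ (precedingSpan g) ≤ j := by
  have := finrank_range_le_card (R := ℂ)
    (b := fun i => (WithLp.toLp 2 (g i) : EuclideanSpace ℂ (Fin n)))
  rwa [Fintype.card_fin] at this

theorem columnDist_nonneg (H : Fin n → Fin M → ℂ) (j : Fin n) : 0 ≤ columnDist H j :=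
  norm_nonneg _

theorem infEDist_le_columnDist (h : Fin M → Fin n → ℂ) (a : Fin n) (ha : (a : ℕ) < M) :
    Metric.infEDist (WithLp.toLp 2 (h ⟨a, ha⟩) : EuclideanSpace ℂ (Fin n))
      (precedingSpan fun i : Fin a => h (Fin.castLE ha.le i)) ≤
      ENNReal.ofReal (columnDist (fun i j => h j i) a) := by
  set f := columnFamily fun i j => h j i
  have h1 : f a = WithLp.toLp 2 (h ⟨a, ha⟩) := dif_pos ha
  have h2 : f a - InnerProductSpace.gramSchmidt ℂ f a ∈
      precedingSpan fun i : Fin a => h (Fin.castLE ha.le i) := by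
    have h3 : f a - InnerProductSpace.gramSchmidt ℂ f a ∈ Submodule.span ℂ (f '' Set.Iio a) := by
      rw [← InnerProductSpace.span_gramSchmidt_Iio]
      nth_rewrite 1 [InnerProductSpace.gramSchmidt_def'' ℂ f a]
      rw [add_sub_cancel_left]
      exact Submodule.sum_mem _ fun i hi => Submodule.smul_mem _ _
        (Submodule.subset_span ⟨i, Finset.mem_Iio.mp hi, rfl⟩)
    refine Submodule.span_mono ?_ h3
    rintro _ ⟨i, hi, rfl⟩
    have hi' : (i : ℕ) < a := hi
    refine ⟨⟨i, hi'⟩, ?_⟩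
    simp only [f, columnFamily, dif_pos (hi'.trans ha)]
    rfl
  refine (Metric.infEDist_le_edist_of_mem h2).trans (le_of_eq ?_)
  rw [← h1, edist_eq_enorm_sub, sub_sub_cancel, ← ofReal_norm]
  rfl

/-- Grouped by `lo p`, the distance of column `j` occurs with power `2 * (n - j) - 1`, one below the
real dimension `2 * (n - j)` of the complement of `j` independent columns. Integrating from the last
column to the first, each factor is bounded uniformly in the preceding columns. -/
theorem lintegral_prod_columnDist_inv_ne_top :
    ∫⁻ H : Fin n → Fin M → ℂ, (∏ i, ∏ j, gaussWeight (H i j)) *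
      (ENNReal.ofReal (∏ p : {p : Fin n × Fin n // (lo p : ℕ) < M}, columnDist H (lo p.1)))⁻¹
      ∂gaussianMatrix (Fin n) (Fin M) ≠ ⊤ := by
  refine ne_top_of_le_ne_top (b := ∏ j : Fin M, distConst n (n - j))
    (ENNReal.prod_ne_top fun j _ => distConst_ne_top n _) ?_
  refine (lintegral_le_lintegral_comp (measurePreserving_transpose complexGaussian _ _) _).trans ?_
  refine le_trans (lintegral_mono fun h => ?_) (lintegral_pi_prod_le (fun j g x =>
    (∏ i, gaussWeight (x i)) * (Metric.infEDist (WithLp.toLp 2 x : EuclideanSpace ℂ (Fin n))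
      (precedingSpan g) ^ (2 * (n - j) - 1))⁻¹) _ (fun j => distConst_ne_zero n _)
      (fun j => distConst_ne_top n _) fun j g => ?_)
  · rw [Finset.prod_mul_distrib, Finset.prod_comm]
    refine mul_le_mul_right ?_ _
    rw [ENNReal.ofReal_prod_of_nonneg fun p _ => columnDist_nonneg _ (lo p.1),
      ENNReal.prod_inv_distrib fun _ _ _ _ _ => Or.inr ENNReal.ofReal_ne_top]
    let E : Fin M → ℝ≥0∞ := fun j =>
      Metric.infEDist (WithLp.toLp 2 (h j) : EuclideanSpace ℂ (Fin n))
        (precedingSpan fun i : Fin j => h (Fin.castLE j.2.le i))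
    let φ : {p : Fin n × Fin n // (lo p : ℕ) < M} → Fin M := fun p => ⟨lo p.1, p.2⟩
    calc _ ≤ ∏ p : {p : Fin n × Fin n // (lo p : ℕ) < M}, (E (φ p))⁻¹ :=
          Finset.prod_le_prod' fun p _ => ENNReal.inv_le_inv.mpr (infEDist_le_columnDist h _ p.2)
      _ = ∏ j, ∏ p : {p : Fin n × Fin n // (lo p : ℕ) < M} with φ p = j, (E j)⁻¹ :=
          (Finset.prod_fiberwise' Finset.univ φ fun j => (E j)⁻¹).symm
      _ = _ := by
          refine Finset.prod_congr rfl fun j _ => ?_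
          rw [Finset.prod_const, ENNReal.inv_pow, ← card_lo_eq (n := n) j]
          congr 1
          refine Finset.card_bij (fun p _ => p.1) (fun p hp => ?_) (fun p _ p' _ h => Subtype.ext h)
            fun p hp => ?_
          · simpa [φ, Fin.ext_iff] using hp
          · have hp' : (lo p : ℕ) = j := by simpa using hp
            exact ⟨⟨p, hp' ▸ j.2⟩, by simpa [φ, Fin.ext_iff] using hp', rfl⟩
  · refine lintegral_infEDist_inv_le _ ?_
    have h1 := finrank_precedingSpan_le g
    have h2 := (precedingSpan g).finrank_le
    rw [finrank_euclideanSpace_fin] at h2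
    omega

theorem measurable_gramSchmidt_columnFamily (j : Fin n) :
    Measurable fun H : Fin n → Fin M → ℂ =>
      InnerProductSpace.gramSchmidt ℂ (columnFamily H) j := by
  have hf : ∀ j : Fin n, Measurable fun H : Fin n → Fin M → ℂ => columnFamily H j := by
    intro j
    unfold columnFamily
    split_ifs with hj
    · fun_prop
    · exact measurable_const
  induction j using WellFoundedLT.induction with
  | ind j ih =>
    have h1 : (fun H : Fin n → Fin M → ℂ => InnerProductSpace.gramSchmidt ℂ (columnFamily H) j) =
        fun H => columnFamily H j - ∑ i ∈ Finset.Iio j,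
          (inner ℂ (InnerProductSpace.gramSchmidt ℂ (columnFamily H) i) (columnFamily H j) /
            ((‖InnerProductSpace.gramSchmidt ℂ (columnFamily H) i‖ : ℝ) : ℂ) ^ 2) •
          InnerProductSpace.gramSchmidt ℂ (columnFamily H) i := by
      funext H
      rw [eq_sub_iff_add_eq]
      exact (InnerProductSpace.gramSchmidt_def'' ℂ (columnFamily H) j).symm
    rw [h1]
    refine (hf j).sub (Finset.measurable_sum _ fun i hi => ?_)
    have h2 := ih i (Finset.mem_Iio.mp hi)
    have h3 := hf j
    have h4 : Measurable fun H : Fin n → Fin M → ℂ =>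
        inner ℂ (InnerProductSpace.gramSchmidt ℂ (columnFamily H) i) (columnFamily H j) /
          ((‖InnerProductSpace.gramSchmidt ℂ (columnFamily H) i‖ : ℝ) : ℂ) ^ 2 :=
      (h2.inner h3).div ((Complex.measurable_ofReal.comp h2.norm).pow_const 2)
    exact h4.smul h2

theorem measurable_columnDist (j : Fin n) :
    Measurable fun H : Fin n → Fin M → ℂ => columnDist H j :=
  (measurable_gramSchmidt_columnFamily j).norm

/-- The minor of the equivalent channel matrix of one group in `IsHalfGroup.exists_det_eq`. -/
def channelMinor (e : Fin n ⊕ Fin n ≃ Fin n ⊕ Fin n) (i₀ : Fin n) (c₀ : Fin M)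
    (H : Fin n ⊕ Fin n → Fin M → ℂ) : ℝ :=
  ‖H (e.symm (Sum.inl i₀)) c₀‖ * ∏ p : {p : Fin n × Fin n // (lo p : ℕ) < M},
    columnDist (fun i => H (e.symm (Sum.inr i))) (lo p.1)

theorem measurable_channelMinor (e : Fin n ⊕ Fin n ≃ Fin n ⊕ Fin n) (i₀ : Fin n) (c₀ : Fin M) :
    Measurable (channelMinor e i₀ c₀) := by
  refine Measurable.mul (by fun_prop) (Finset.measurable_prod _ fun p _ => ?_)
  exact (measurable_columnDist (lo p.1)).comp
    (by fun_prop : Measurable fun (H : Fin n ⊕ Fin n → Fin M → ℂ) i => H (e.symm (Sum.inr i)))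

theorem measurePreserving_sumElim_comp (e : Fin n ⊕ Fin n ≃ Fin n ⊕ Fin n) :
    MeasurePreserving
      (fun (h : (Fin n → Fin M → ℂ) × (Fin n → Fin M → ℂ)) s => Sum.elim h.1 h.2 (e s))
      ((gaussianMatrix (Fin n) (Fin M)).prod (gaussianMatrix (Fin n) (Fin M)))
      (gaussianMatrix (Fin n ⊕ Fin n) (Fin M)) := by
  have h1 := measurePreserving_sumPiEquivProdPi_symm (X := fun _ : Fin n ⊕ Fin n => Fin M → ℂ)
    fun _ => Measure.pi fun _ : Fin M => complexGaussian
  have h2 := (measurePreserving_comp_equiv (Measure.pi fun _ : Fin M => complexGaussian) e).comp h1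
  have h3 : (fun (h : (Fin n → Fin M → ℂ) × (Fin n → Fin M → ℂ)) s => Sum.elim h.1 h.2 (e s)) =
      (fun (g : Fin n ⊕ Fin n → Fin M → ℂ) i => g (e i)) ∘
        (MeasurableEquiv.sumPiEquivProdPi fun _ => Fin M → ℂ).symm := by
    funext h s
    simp only [Function.comp_apply]
    rcases e s with i | i <;> rfl
  rw [h3]
  exact h2

/-- The two halves of the channel are independent. The upper one enters through a single entry with
inverse power 1, below 2; the lower one through the column distances. -/
theorem lintegral_channelMinor_inv_lt_top (e : Fin n ⊕ Fin n ≃ Fin n ⊕ Fin n) (i₀ : Fin n)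
    (c₀ : Fin M) : ∫⁻ H, (∏ s, ∏ c, gaussWeight (H s c)) *
      (ENNReal.ofReal (channelMinor e i₀ c₀ H))⁻¹ ∂gaussianMatrix (Fin n ⊕ Fin n) (Fin M) < ⊤ := by
  classical
  let s : Fin n → Fin M → ℝ := fun i c => if i = i₀ ∧ c = c₀ then 1 else 0
  let I₂ : ℝ≥0∞ := 1 + ∫⁻ H : Fin n → Fin M → ℂ, (∏ i, ∏ j, gaussWeight (H i j)) *
      (ENNReal.ofReal (∏ p : {p : Fin n × Fin n // (lo p : ℕ) < M}, columnDist H (lo p.1)))⁻¹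
      ∂gaussianMatrix (Fin n) (Fin M)
  have hI₂ : I₂ ≠ ⊤ := ENNReal.add_ne_top.mpr
    ⟨ENNReal.one_ne_top, lintegral_prod_columnDist_inv_ne_top⟩
  have hI₁ := lintegral_gaussWeight_entries_lt_top s fun i c => by
    simp only [s]; split_ifs <;> norm_num
  refine lt_of_le_of_lt (lintegral_le_lintegral_comp (measurePreserving_sumElim_comp e) _) ?_
  refine lt_of_le_of_lt (lintegral_prod_le _) ?_
  refine lt_of_le_of_lt (lintegral_mono fun h₁ => le_trans (le_of_eq (lintegral_congr fun h₂ => ?_))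
    (lintegral_const_mul_le_of_ne_zero (φ := fun H => (∏ i, ∏ j, gaussWeight (H i j)) *
      (ENNReal.ofReal (∏ p : {p : Fin n × Fin n // (lo p : ℕ) < M}, columnDist H (lo p.1)))⁻¹)
      (C := I₂) (by simp [I₂]) le_add_self
      (∏ i, ∏ j, gaussWeight (h₁ i j) * (‖h₁ i j‖ₑ ^ s i j)⁻¹))) ?_
  · simp only [channelMinor, Equiv.apply_symm_apply, Sum.elim_inl, Sum.elim_inr]
    have h3 : ∏ i, ∏ j, (‖h₁ i j‖ₑ ^ s i j)⁻¹ = (ENNReal.ofReal ‖h₁ i₀ c₀‖)⁻¹ := by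
      rw [Finset.prod_eq_single i₀, Finset.prod_eq_single c₀]
      · simp [s]
      · intro c _ hc; simp [s, hc]
      · simp
      · intro i _ hi; simp [s, hi]
      · simp
    rw [e.prod_comp (fun t => ∏ c, gaussWeight (Sum.elim h₁ h₂ t c)), Fintype.prod_sum_type,
      ENNReal.ofReal_mul (norm_nonneg _), ENNReal.mul_inv (Or.inr ENNReal.ofReal_ne_top)
      (Or.inl ENNReal.ofReal_ne_top), ← h3]
    simp only [Sum.elim_inl, Sum.elim_inr, Finset.prod_mul_distrib]
    ring
  · rw [lintegral_mul_const' _ _ hI₂]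
    exact ENNReal.mul_lt_top hI₁ hI₂.lt_top

theorem gaussWeight_ne_zero (z : ℂ) : gaussWeight z ≠ 0 := by
  simp [gaussWeight, Real.exp_pos]

theorem measurable_gaussWeight_mul_inv (e : Fin n ⊕ Fin n ≃ Fin n ⊕ Fin n) (i₀ : Fin n)
    (c₀ : Fin M) : Measurable fun H : Fin n ⊕ Fin n → Fin M → ℂ =>
      (∏ s, ∏ c, gaussWeight (H s c)) * (ENNReal.ofReal (channelMinor e i₀ c₀ H))⁻¹ := by
  refine Measurable.mul (Finset.measurable_prod _ fun s _ => Finset.measurable_prod _ fun c _ => ?_)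
    (measurable_channelMinor e i₀ c₀).ennreal_ofReal.inv
  exact measurable_gaussWeight.comp (by fun_prop)

/-- A zero minor would make the weighted inverse infinite, since the weight never vanishes; a finite
integral excludes this almost surely. -/
theorem ae_channelMinor_pos (e : Fin n ⊕ Fin n ≃ Fin n ⊕ Fin n) (i₀ : Fin n) (c₀ : Fin M) :
    ∀ᵐ H ∂gaussianMatrix (Fin n ⊕ Fin n) (Fin M), 0 < channelMinor e i₀ c₀ H := by
  filter_upwards [ae_lt_top (measurable_gaussWeight_mul_inv e i₀ c₀)
    (lintegral_channelMinor_inv_lt_top e i₀ c₀).ne] with H hH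
  by_contra h0
  rw [ENNReal.ofReal_of_nonpos (not_lt.mp h0), ENNReal.inv_zero, ENNReal.mul_top] at hH
  · exact lt_irrefl _ hH
  · exact Finset.prod_ne_zero_iff.mpr fun s _ => Finset.prod_ne_zero_iff.mpr fun c _ =>
      gaussWeight_ne_zero _

end MinorIntegral

/-! ### The complexity of decoding one group -/

section Complexity

variable {τ ν μ κ : Type} [Fintype τ] [Fintype ν] [Fintype μ] [Fintype κ]

theorem frobSq_nonneg (X : Matrix τ μ ℂ) : 0 ≤ frobSq X :=
  Finset.sum_nonneg fun _ _ => Finset.sum_nonneg fun _ _ => sq_nonneg _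

theorem norm_apply_le_sqrt_frobSq (X : Matrix τ μ ℂ) (t : τ) (c : μ) : ‖X t c‖ ≤ √(frobSq X) := by
  refine Real.le_sqrt_of_sq_le ?_
  calc ‖X t c‖ ^ 2 ≤ ∑ c, ‖X t c‖ ^ 2 :=
        Finset.single_le_sum (f := fun c => ‖X t c‖ ^ 2) (fun _ _ => sq_nonneg _) (Finset.mem_univ c)
    _ ≤ _ := Finset.single_le_sum (f := fun t => ∑ c, ‖X t c‖ ^ 2)
        (fun _ _ => Finset.sum_nonneg fun _ _ => sq_nonneg _) (Finset.mem_univ t)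

theorem exists_abs_equivChannel_mul_le (A : κ → Matrix τ ν ℂ) (Θ : Matrix κ κ ℝ) :
    ∃ a : ℝ, 0 ≤ a ∧ ∀ (H : Matrix ν μ ℂ) r k, |(equivChannel A H * Θ) r k| ≤ a * √(frobSq H) := by
  refine ⟨∑ k, ∑ i, (∑ t, ∑ s, ‖A i t s‖) * |Θ i k|, by positivity, fun H r k => ?_⟩
  have h1 : ∀ i t c, ‖(A i * H) t c‖ ≤ (∑ t, ∑ s, ‖A i t s‖) * √(frobSq H) := by
    intro i t c
    rw [Matrix.mul_apply]
    calc _ ≤ ∑ s, ‖A i t s‖ * √(frobSq H) := by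
          refine (norm_sum_le _ _).trans (Finset.sum_le_sum fun s _ => ?_)
          rw [norm_mul]
          exact mul_le_mul_of_nonneg_left (norm_apply_le_sqrt_frobSq H s c) (norm_nonneg _)
      _ = (∑ s, ‖A i t s‖) * √(frobSq H) := (Finset.sum_mul _ _ _).symm
      _ ≤ _ := mul_le_mul_of_nonneg_right (Finset.single_le_sum
          (f := fun t => ∑ s, ‖A i t s‖) (fun _ _ => Finset.sum_nonneg fun _ _ => norm_nonneg _)
          (Finset.mem_univ t)) (Real.sqrt_nonneg _)
  have h2 : ∀ i, |equivChannel A H r i| ≤ (∑ t, ∑ s, ‖A i t s‖) * √(frobSq H) := by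
    intro i
    rcases r with r | r
    · exact (Complex.abs_re_le_norm _).trans (h1 i r.2 r.1)
    · exact (Complex.abs_im_le_norm _).trans (h1 i r.2 r.1)
  rw [Matrix.mul_apply]
  calc _ ≤ ∑ i, ((∑ t, ∑ s, ‖A i t s‖) * |Θ i k|) * √(frobSq H) := by
        refine (Finset.abs_sum_le_sum_abs _ _).trans (Finset.sum_le_sum fun i _ => ?_)
        rw [abs_mul, mul_right_comm]
        exact mul_le_mul_of_nonneg_right (h2 i) (abs_nonneg _)
    _ = (∑ i, (∑ t, ∑ s, ‖A i t s‖) * |Θ i k|) * √(frobSq H) := (Finset.sum_mul _ _ _).symm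
    _ ≤ _ := mul_le_mul_of_nonneg_right (Finset.single_le_sum
        (f := fun k => ∑ i, (∑ t, ∑ s, ‖A i t s‖) * |Θ i k|) (fun _ _ => by positivity)
        (Finset.mem_univ k)) (Real.sqrt_nonneg _)

/-- From `(1 + x) ^ D / D! ≤ exp (1 + x)` and `1 + x ≤ 3 / 2 + x ^ 2 / 2`, the latter being `(x - 1)
^ 2 ≥ 0`. -/
theorem one_add_pow_le_exp (D : ℕ) {x : ℝ} (hx : 0 ≤ x) :
    (1 + x) ^ D ≤ D.factorial * Real.exp (3 / 2) * Real.exp (x ^ 2 / 2) := by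
  have h1 := Real.pow_div_factorial_le_exp (1 + x) (by positivity) D
  rw [div_le_iff₀ (by positivity)] at h1
  have h2 : Real.exp (1 + x) ≤ Real.exp (3 / 2 + x ^ 2 / 2) :=
    Real.exp_le_exp.mpr (by nlinarith [sq_nonneg (x - 1)])
  rw [Real.exp_add (3 / 2)] at h2
  calc _ ≤ Real.exp (1 + x) * D.factorial := h1
    _ ≤ (Real.exp (3 / 2) * Real.exp (x ^ 2 / 2)) * D.factorial := by gcongr
    _ = _ := by ring

theorem prod_prod_gaussWeight (H : τ → μ → ℂ) :
    ∏ s, ∏ c, gaussWeight (H s c) = ENNReal.ofReal (Real.exp (frobSq (Matrix.of H) / 2)) := by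
  simp only [gaussWeight, frobSq, Finset.sum_div, Real.exp_sum, Matrix.of_apply]
  rw [ENNReal.ofReal_prod_of_nonneg fun _ _ => Finset.prod_nonneg fun _ _ => (Real.exp_pos _).le]
  exact Finset.prod_congr rfl fun s _ =>
    (ENNReal.ofReal_prod_of_nonneg fun _ _ => (Real.exp_pos _).le).symm

variable {n L M : ℕ} {e : Fin n ⊕ Fin n ≃ Fin n ⊕ Fin n} {F G : Matrix (Fin n) (Fin n) ℂ}
  {W : Fin L → skewAdjoint (Matrix (Fin n) (Fin n) ℂ)}
  {A : Fin L → Matrix (Fin n ⊕ Fin n) (Fin n ⊕ Fin n) ℂ}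

theorem IsHalfGroup.rank_eq (hA : IsHalfGroup e F G W A) (hL : L = n ^ 2 + 1) {i₀ : Fin n}
    {c₀ : Fin M} {H : Fin n ⊕ Fin n → Fin M → ℂ} (hpos : 0 < channelMinor e i₀ c₀ H) :
    (equivChannel A (Matrix.of H)).rank = Fintype.card (MinorIndex n M) := by
  refine le_antisymm (hA.rank_le hL _) ?_
  obtain ⟨b, -, hb⟩ := hA.exists_det_eq hL i₀ c₀
  obtain ⟨X, Z, -, -, hdet⟩ := hb (Matrix.of H)
  have h1 : IsUnit (X * equivChannel A (Matrix.of H) * Z) := by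
    rw [Matrix.isUnit_iff_isUnit_det, hdet, isUnit_iff_ne_zero]
    exact hpos.ne'
  rw [← Matrix.rank_of_isUnit _ h1]
  exact (Matrix.rank_mul_le_left _ _).trans (Matrix.rank_mul_le_right _ _)

/-- The column operations `Z` are replaced by `Θ⁻¹ * Z`, so the lattice generator changes only the
constant and the minor stays that of the channel. All constants are chosen before `H`. -/
theorem IsHalfGroup.exists_steps_mul_le (hA : IsHalfGroup e F G W A) (hL : L = n ^ 2 + 1)
    (i₀ : Fin n) (c₀ : Fin M) {Θ : Matrix (Fin L) (Fin L) ℝ} (hΘ : IsUnit Θ.det) {ρ₀ : ℝ}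
    (hρ₀ : 0 < ρ₀) : ∃ (K : ℝ) (k d : ℕ), 0 ≤ K ∧ ∀ H : Fin n ⊕ Fin n → Fin M → ℂ,
      0 < channelMinor e i₀ c₀ H → ∀ (D : PivotedQR (equivChannel A (Matrix.of H) * Θ))
        (S : Finset ℤ) (s : Fin L → ℤ), (∀ i, s i ∈ S) →
        ∀ v, (equivChannel A (Matrix.of H)).transpose.mulVec v = 0 →
        ∀ N : Matrix (Fin n ⊕ Fin n) (Fin M) ℂ,
        (D.steps ((equivChannel A (Matrix.of H) * Θ).mulVec (fun i => (s i : ℝ)) + v + vecTilde N)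
          S ρ₀ : ℝ) * channelMinor e i₀ c₀ H ≤ K * (1 + √(frobSq N)) ^ k *
            (1 + √(frobSq (Matrix.of H))) ^ d * (S.card : ℝ) ^ ((n - M) ^ 2) := by
  obtain ⟨b, hb0, hb⟩ := hA.exists_det_eq hL i₀ c₀
  obtain ⟨a, ha0, ha⟩ := exists_abs_equivChannel_mul_le (μ := Fin M) A Θ
  obtain ⟨cι, hι⟩ : ∃ cι, cι = Fintype.card
    ((Fin M × (Fin n ⊕ Fin n)) ⊕ (Fin M × (Fin n ⊕ Fin n))) := ⟨_, rfl⟩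
  set r := Fintype.card (MinorIndex n M) with hr
  let cZ : ℝ := (∑ j, ∑ l, |Θ⁻¹ j l|) * b
  have hcZ : 0 ≤ cZ := mul_nonneg (by positivity) hb0
  let β : ℝ := 1 + cι * a
  have hβ : 0 ≤ β := by positivity
  refine ⟨(ρ₀ + 2) / ρ₀ * ((r + 1) * ((r.factorial * (cι * 1) ^ r) *
    (L * cZ) ^ r * (r ^ r * (2 * (ρ₀ + 2 + r)) ^ r))) * β ^ (2 * r), r + 1, 2 * r, by positivity,
    fun H hpos D S s hs v hv N => ?_⟩
  obtain ⟨X, Z, hX, hZ, hdet⟩ := hb (Matrix.of H)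
  have hrank : (equivChannel A (Matrix.of H) * Θ).rank = r := by
    rw [Matrix.rank_mul_eq_left_of_isUnit_det _ _ hΘ, hA.rank_eq hL hpos]
  let ε : Fin (equivChannel A (Matrix.of H) * Θ).rank ≃ MinorIndex n M :=
    (finCongr hrank).trans (Fintype.equivFin _).symm
  have hZ' : ∀ j i, |(Θ⁻¹ * Z) j i| ≤ cZ := by
    intro j i
    rw [Matrix.mul_apply]
    calc _ ≤ ∑ l, |Θ⁻¹ j l| * b := by
          refine (Finset.abs_sum_le_sum_abs _ _).trans (Finset.sum_le_sum fun l _ => ?_)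
          rw [abs_mul]
          exact mul_le_mul_of_nonneg_left (hZ l i) (abs_nonneg _)
      _ = (∑ l, |Θ⁻¹ j l|) * b := (Finset.sum_mul _ _ _).symm
      _ ≤ _ := mul_le_mul_of_nonneg_right (Finset.single_le_sum (f := fun j => ∑ l, |Θ⁻¹ j l|)
          (fun _ _ => by positivity) (Finset.mem_univ j)) hb0
  have hR : ∀ i j, |D.R i j| ≤ β * (1 + √(frobSq (Matrix.of H))) := by
    intro i j
    refine (D.abs_R_le (ha (Matrix.of H)) i j).trans ?_
    rw [← hι]
    have h0 := Real.sqrt_nonneg (frobSq (Matrix.of H))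
    have h1 : (0 : ℝ) ≤ cι * a := by positivity
    simp only [β]
    nlinarith
  have hβ1 : 1 ≤ β * (1 + √(frobSq (Matrix.of H))) := by
    have h0 := Real.sqrt_nonneg (frobSq (Matrix.of H))
    have h1 : (0 : ℝ) ≤ cι * a := by positivity
    simp only [β]
    nlinarith [mul_nonneg h1 h0]
  have hv' : (equivChannel A (Matrix.of H) * Θ).transpose.mulVec v = 0 := by
    rw [Matrix.transpose_mul, ← Matrix.mulVec_mulVec, hv, Matrix.mulVec_zero]
  have hdist : D.partialDist ((equivChannel A (Matrix.of H) * Θ).mulVec (fun i => (s i : ℝ)) + v +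
      vecTilde N) 0 (fun j => s (D.perm j.1)) ≤ √(frobSq N) ^ 2 := by
    rw [Real.sq_sqrt (frobSq_nonneg N), frobSq_eq_sum_vecTilde]
    exact D.partialDist_zero_le hv'
  have key := D.steps_mul_le (by omega) zero_le_one hcZ (X.submatrix ε id)
    ((Θ⁻¹ * Z).submatrix id ε) (fun i x => hX _ _) (fun j i => hZ' _ _) hρ₀ (Real.sqrt_nonneg _)
    hR hβ1 hs hdist
  have hdet' : |(X.submatrix ε id * (equivChannel A (Matrix.of H) * Θ) *
      (Θ⁻¹ * Z).submatrix id ε).det| = channelMinor e i₀ c₀ H := by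
    have h1 : X.submatrix ε id * (equivChannel A (Matrix.of H) * Θ) * (Θ⁻¹ * Z).submatrix id ε =
        (X * equivChannel A (Matrix.of H) * Z).submatrix ε ε := by
      have h2 : X * equivChannel A (Matrix.of H) * Z =
          X * (equivChannel A (Matrix.of H) * Θ) * (Θ⁻¹ * Z) := by
        rw [Matrix.mul_assoc X, Matrix.mul_assoc X, Matrix.mul_assoc _ Θ,
          Matrix.mul_nonsing_inv_cancel_left _ _ hΘ]
      rw [h2]
      rfl
    rw [h1, Matrix.det_submatrix_equiv_self, hdet]
    exact abs_of_nonneg hpos.le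
  rw [hdet', hrank, ← hι] at key
  have hexp : L - r = (n - M) ^ 2 := by
    have h1 : (n - M) ^ 2 ≤ n ^ 2 := Nat.pow_le_pow_left (Nat.sub_le _ _) 2
    rw [hr, card_minorIndex]
    omega
  rw [hexp, mul_pow β] at key
  refine key.trans (le_of_eq ?_)
  ring

/-- With the powers absorbed in Gaussian weights, the bound is a product of a function of the
channel and a function of the noise, so the two integrals separate. -/
theorem IsHalfGroup.exists_steps_le (hA : IsHalfGroup e F G W A) (hL : L = n ^ 2 + 1)
    (i₀ : Fin n) (c₀ : Fin M) {Θ : Matrix (Fin L) (Fin L) ℝ} (hΘ : IsUnit Θ.det) {ρ₀ : ℝ}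
    (hρ₀ : 0 < ρ₀) : ∃ K : ℝ≥0, ∀ H : Fin n ⊕ Fin n → Fin M → ℂ,
      0 < channelMinor e i₀ c₀ H → ∀ (D : PivotedQR (equivChannel A (Matrix.of H) * Θ))
        (S : Finset ℤ) (s : Fin L → ℤ), (∀ i, s i ∈ S) →
        ∀ v, (equivChannel A (Matrix.of H)).transpose.mulVec v = 0 →
        ∀ N : Fin n ⊕ Fin n → Fin M → ℂ,
        (D.steps ((equivChannel A (Matrix.of H) * Θ).mulVec (fun i => (s i : ℝ)) + v +
          vecTilde (Matrix.of N)) S ρ₀ : ℝ≥0∞) ≤ K * (S.card : ℝ≥0∞) ^ ((n - M) ^ 2) *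
            ((∏ s, ∏ c, gaussWeight (H s c)) * (ENNReal.ofReal (channelMinor e i₀ c₀ H))⁻¹) *
            ∏ s, ∏ c, gaussWeight (N s c) := by
  obtain ⟨K, k, d, hK, h⟩ := hA.exists_steps_mul_le hL i₀ c₀ hΘ hρ₀
  refine ⟨(K * (k.factorial * Real.exp (3 / 2)) * (d.factorial * Real.exp (3 / 2))).toNNReal,
    fun H hpos D S s hs v hv N => ?_⟩
  have h1 := h H hpos D S s hs v hv (Matrix.of N)
  rw [← le_div_iff₀ hpos] at h1
  have h2 := one_add_pow_le_exp k (Real.sqrt_nonneg (frobSq (Matrix.of N)))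
  have h3 := one_add_pow_le_exp d (Real.sqrt_nonneg (frobSq (Matrix.of H)))
  rw [Real.sq_sqrt (frobSq_nonneg _)] at h2 h3
  have h4 : (D.steps ((equivChannel A (Matrix.of H) * Θ).mulVec (fun i => (s i : ℝ)) + v +
      vecTilde (Matrix.of N)) S ρ₀ : ℝ) ≤
      K * (k.factorial * Real.exp (3 / 2)) * (d.factorial * Real.exp (3 / 2)) *
        (S.card : ℝ) ^ ((n - M) ^ 2) *
        (Real.exp (frobSq (Matrix.of H) / 2) * (channelMinor e i₀ c₀ H)⁻¹) *
        Real.exp (frobSq (Matrix.of N) / 2) := by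
    refine h1.trans ?_
    rw [div_eq_mul_inv]
    calc _ ≤ K * (k.factorial * Real.exp (3 / 2) * Real.exp (frobSq (Matrix.of N) / 2)) *
          (d.factorial * Real.exp (3 / 2) * Real.exp (frobSq (Matrix.of H) / 2)) *
          (S.card : ℝ) ^ ((n - M) ^ 2) * (channelMinor e i₀ c₀ H)⁻¹ := by gcongr
      _ = _ := by ring
  have h5 := ENNReal.ofReal_le_ofReal h4
  rw [ENNReal.ofReal_natCast, ENNReal.ofReal_mul (by positivity), ENNReal.ofReal_mul (by positivity),
    ENNReal.ofReal_mul (by positivity), ENNReal.ofReal_mul (Real.exp_pos _).le,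
    ENNReal.ofReal_inv_of_pos hpos, ENNReal.ofReal_pow (by positivity), ENNReal.ofReal_natCast]
    at h5
  rw [prod_prod_gaussWeight, prod_prod_gaussWeight]
  exact h5

end Complexity

/-! ### Properties of the two-group block codes -/

namespace IsTwoGroupBlockCode

variable {n M : ℕ}
  {A : Fin (n ^ 2 + 1) ⊕ Fin (n ^ 2 + 1) → Matrix (Fin n ⊕ Fin n) (Fin n ⊕ Fin n) ℂ}

theorem rate_eq (A : Fin (n ^ 2 + 1) ⊕ Fin (n ^ 2 + 1) → Matrix (Fin n ⊕ Fin n) (Fin n ⊕ Fin n) ℂ) :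
    rate A = ((n : ℚ) ^ 2 + 1) / (2 * n) := by
  simp only [rate, Fintype.card_sum, Fintype.card_fin]
  push_cast
  rw [← two_mul, ← two_mul, mul_div_mul_left _ _ two_ne_zero]

theorem f_add_one : f n M + 1 = ((n ^ 2 + 1 - (n - M) ^ 2 : ℕ) : ℤ) := by
  have h1 : (n - M) ^ 2 ≤ n ^ 2 + 1 :=
    (Nat.pow_le_pow_left (Nat.sub_le _ _) 2).trans (Nat.le_succ _)
  have h2 : ((n - M : ℕ) : ℤ) = max ((n : ℤ) - M) 0 := by omega
  rw [f, ← h2]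
  push_cast [h1]
  ring

theorem ae_rank_eq (hA : IsTwoGroupBlockCode n A) (hn : 0 < n) (hM : 0 < M) :
    ∀ᵐ H ∂gaussianMatrix (Fin n ⊕ Fin n) (Fin M),
      (equivChannel (A ∘ Sum.inl) (Matrix.of H)).rank = n ^ 2 + 1 - (n - M) ^ 2 ∧
      (equivChannel (A ∘ Sum.inr) (Matrix.of H)).rank = n ^ 2 + 1 - (n - M) ^ 2 := by
  obtain ⟨⟨F₁, G₁, W₁, h₁⟩, ⟨F₂, G₂, W₂, h₂⟩⟩ := hA.isHalfGroup
  filter_upwards [ae_channelMinor_pos (Equiv.refl _) (⟨0, hn⟩ : Fin n) (⟨0, hM⟩ : Fin M),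
    ae_channelMinor_pos (Equiv.sumComm _ _) (⟨0, hn⟩ : Fin n) (⟨0, hM⟩ : Fin M)] with H H₁ H₂
  rw [← card_minorIndex]
  exact ⟨h₁.rank_eq rfl H₁, h₂.rank_eq rfl H₂⟩

theorem isSingular (hA : IsTwoGroupBlockCode n A) (hM : 0 < M) (hrate : ⌈rate A⌉ ≤ (M : ℤ))
    (hMn : M < n) : IsSingular A M := by
  refine ⟨by exact_mod_cast Int.ceil_le.mp hrate, ?_⟩
  filter_upwards [hA.ae_rank_eq (by omega) hM] with H hH
  rw [hA.twoGroup.rank_eq, hH.1, hH.2, Fintype.card_sum, Fintype.card_fin]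
  have : 0 < (n - M) ^ 2 := pow_pos (by omega) 2
  omega

theorem isMLEstimate (hA : IsTwoGroupBlockCode n A)
    {Θ₁ Θ₂ : Matrix (Fin (n ^ 2 + 1)) (Fin (n ^ 2 + 1)) ℝ} {ρ₀ : ℝ}
    {H : Matrix (Fin n ⊕ Fin n) (Fin M) ℂ} (D₁ : PivotedQR (equivChannel (A ∘ Sum.inl) H * Θ₁))
    (D₂ : PivotedQR (equivChannel (A ∘ Sum.inr) H * Θ₂)) (Y : Matrix (Fin n ⊕ Fin n) (Fin M) ℂ)
    (S : Finset ℤ) {s₁ s₂ : Fin (n ^ 2 + 1) → ℤ} (hs₁ : s₁ ∈ D₁.outputs (vecTilde Y) S ρ₀)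
    (hs₂ : s₂ ∈ D₂.outputs (vecTilde Y) S ρ₀) :
    (∀ i, s₁ i ∈ S) ∧ (∀ i, s₂ i ∈ S) ∧
      ∀ s₁' s₂' : Fin (n ^ 2 + 1) → ℤ, (∀ i, s₁' i ∈ S) → (∀ i, s₂' i ∈ S) →
        frobSq (Y - codeword A (latticeSymbols Θ₁ Θ₂ s₁ s₂) * H)
          ≤ frobSq (Y - codeword A (latticeSymbols Θ₁ Θ₂ s₁' s₂') * H) := by
  obtain ⟨h₁, h₁'⟩ := D₁.outputs_spec hs₁
  obtain ⟨h₂, h₂'⟩ := D₂.outputs_spec hs₂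
  refine ⟨h₁, h₂, fun s₁' s₂' hs₁' hs₂' => ?_⟩
  rw [latticeSymbols, latticeSymbols, hA.twoGroup.frobSq_eq, hA.twoGroup.frobSq_eq]
  simp only [Matrix.mulVec_mulVec]
  gcongr ?_ + ?_ - _
  · exact h₁' s₁' hs₁'
  · exact h₂' s₂' hs₂'

/-- The average number of visited nodes grows at most like `q ^ ((n - M)⁺)²`. -/
theorem exists_lintegral_steps_le (hA : IsTwoGroupBlockCode n A) (hn : 0 < n) (hM : 0 < M)
    {Θ₁ Θ₂ : Matrix (Fin (n ^ 2 + 1)) (Fin (n ^ 2 + 1)) ℝ} (hΘ₁ : IsUnit Θ₁.det)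
    (hΘ₂ : IsUnit Θ₂.det) {ρ₀ : ℝ} (hρ₀ : 0 < ρ₀) :
    ∃ C : ℝ≥0, ∀
      (D₁ : ∀ H : Fin n ⊕ Fin n → Fin M → ℂ,
        PivotedQR (equivChannel (A ∘ Sum.inl) (Matrix.of H) * Θ₁))
      (D₂ : ∀ H : Fin n ⊕ Fin n → Fin M → ℂ,
        PivotedQR (equivChannel (A ∘ Sum.inr) (Matrix.of H) * Θ₂))
      (S : Finset ℤ) (s₁ s₂ : Fin (n ^ 2 + 1) → ℤ), (∀ i, s₁ i ∈ S) → (∀ i, s₂ i ∈ S) →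
      ∫⁻ H, ∫⁻ N,
        (((D₁ H).steps (vecTilde (codeword A (latticeSymbols Θ₁ Θ₂ s₁ s₂) * Matrix.of H +
            Matrix.of N)) S ρ₀ +
          (D₂ H).steps (vecTilde (codeword A (latticeSymbols Θ₁ Θ₂ s₁ s₂) * Matrix.of H +
            Matrix.of N)) S ρ₀ : ℕ) : ℝ≥0∞)
        ∂gaussianMatrix (Fin n ⊕ Fin n) (Fin M) ∂gaussianMatrix (Fin n ⊕ Fin n) (Fin M)
      ≤ (C : ℝ≥0∞) * (S.card : ℝ≥0∞) ^ ((n - M) ^ 2) := by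
  obtain ⟨⟨F₁, G₁, W₁, h₁⟩, ⟨F₂, G₂, W₂, h₂⟩⟩ := hA.isHalfGroup
  let i₀ : Fin n := ⟨0, hn⟩
  let c₀ : Fin M := ⟨0, hM⟩
  obtain ⟨K₁, hK₁⟩ := h₁.exists_steps_le rfl i₀ c₀ hΘ₁ hρ₀
  obtain ⟨K₂, hK₂⟩ := h₂.exists_steps_le rfl i₀ c₀ hΘ₂ hρ₀
  let Ψ : (Fin n ⊕ Fin n → Fin M → ℂ) → ℝ≥0∞ := fun H => ∏ s, ∏ c, gaussWeight (H s c)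
  let Φ : (Fin n ⊕ Fin n ≃ Fin n ⊕ Fin n) → (Fin n ⊕ Fin n → Fin M → ℂ) → ℝ≥0∞ := fun e H =>
    Ψ H * (ENNReal.ofReal (channelMinor e i₀ c₀ H))⁻¹
  let I : ℝ≥0∞ := 1 + ∫⁻ N, Ψ N ∂gaussianMatrix (Fin n ⊕ Fin n) (Fin M)
  have hI : I ≠ ⊤ := by
    have h0 := lintegral_gaussWeight_entries_lt_top (σ := Fin n ⊕ Fin n) (τ := Fin M)
      (fun _ _ => 0) fun _ _ => by norm_num
    simp only [ENNReal.rpow_zero, inv_one, mul_one] at h0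
    exact ENNReal.add_ne_top.mpr ⟨ENNReal.one_ne_top, h0.ne⟩
  let E : (Fin n ⊕ Fin n ≃ Fin n ⊕ Fin n) → ℝ≥0∞ := fun e =>
    ∫⁻ H, Φ e H ∂gaussianMatrix (Fin n ⊕ Fin n) (Fin M)
  have hE : ∀ e, E e ≠ ⊤ := fun e => (lintegral_channelMinor_inv_lt_top e i₀ c₀).ne
  let J : ℝ≥0∞ := (K₁ * E (Equiv.refl _) + K₂ * E (Equiv.sumComm _ _)) * I
  have hJ : J ≠ ⊤ := ENNReal.mul_ne_top (ENNReal.add_ne_top.mpr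
    ⟨ENNReal.mul_ne_top ENNReal.coe_ne_top (hE _), ENNReal.mul_ne_top ENNReal.coe_ne_top (hE _)⟩) hI
  refine ⟨J.toNNReal, fun D₁ D₂ S s₁ s₂ hs₁ hs₂ => ?_⟩
  rw [ENNReal.coe_toNNReal hJ]
  set Q : ℝ≥0∞ := (S.card : ℝ≥0∞) ^ ((n - M) ^ 2) with hQ
  have hQt : Q ≠ ⊤ := ENNReal.pow_ne_top (ENNReal.natCast_ne_top _)
  have hpoint : ∀ᵐ H ∂gaussianMatrix (Fin n ⊕ Fin n) (Fin M), ∀ N : Fin n ⊕ Fin n → Fin M → ℂ,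
      (((D₁ H).steps (vecTilde (codeword A (latticeSymbols Θ₁ Θ₂ s₁ s₂) * Matrix.of H +
          Matrix.of N)) S ρ₀ +
        (D₂ H).steps (vecTilde (codeword A (latticeSymbols Θ₁ Θ₂ s₁ s₂) * Matrix.of H +
          Matrix.of N)) S ρ₀ : ℕ) : ℝ≥0∞) ≤
      (K₁ * Q * Φ (Equiv.refl _) H + K₂ * Q * Φ (Equiv.sumComm _ _) H) * Ψ N := by
    -- Where both minors are positive, each decoder sees the signal of the other group as a vector
    -- orthogonal to its own columns.
    filter_upwards [ae_channelMinor_pos (Equiv.refl _) i₀ c₀,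
      ae_channelMinor_pos (Equiv.sumComm _ _) i₀ c₀] with H H₁ H₂ N
    have hy : vecTilde (codeword A (latticeSymbols Θ₁ Θ₂ s₁ s₂) * Matrix.of H + Matrix.of N) =
        (equivChannel (A ∘ Sum.inl) (Matrix.of H) * Θ₁).mulVec (fun i => (s₁ i : ℝ)) +
        (equivChannel (A ∘ Sum.inr) (Matrix.of H) * Θ₂).mulVec (fun i => (s₂ i : ℝ)) +
        vecTilde (Matrix.of N) := by
      rw [latticeSymbols, codeword_sumElim, Matrix.add_mul, vecTilde_add, vecTilde_add,
        ← Matrix.mulVec_mulVec, ← Matrix.mulVec_mulVec, equivChannel_mulVec, equivChannel_mulVec]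
    have horth := hA.twoGroup.transpose_mulVec_eq_zero (Matrix.of H)
      (Θ₁.mulVec fun i => (s₁ i : ℝ)) (Θ₂.mulVec fun i => (s₂ i : ℝ))
    rw [Matrix.mulVec_mulVec _ _ Θ₁, Matrix.mulVec_mulVec _ _ Θ₂] at horth
    have e₁ := hK₁ H H₁ (D₁ H) S s₁ hs₁ _ horth.1 N
    have e₂ := hK₂ H H₂ (D₂ H) S s₂ hs₂ _ horth.2 N
    rw [add_comm (Matrix.mulVec _ _)] at e₂
    rw [hy, Nat.cast_add, add_mul]
    exact add_le_add e₁ e₂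
  -- The decompositions are arbitrary functions of `H`, so the step counts need not be measurable;
  -- monotonicity passes to a measurable bound before any integral is split.
  calc _ ≤ ∫⁻ H, (K₁ * Q * Φ (Equiv.refl _) H + K₂ * Q * Φ (Equiv.sumComm _ _) H) * I
        ∂gaussianMatrix (Fin n ⊕ Fin n) (Fin M) := by
        refine lintegral_mono_ae ?_
        filter_upwards [hpoint] with H hH
        exact (lintegral_mono hH).trans
          (lintegral_const_mul_le_of_ne_zero (by simp) le_add_self _)
    _ = J * Q := by
        have hm : ∀ K : ℝ≥0, ∀ e, Measurable fun H => (K : ℝ≥0∞) * Q * Φ e H := fun K e =>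
          (measurable_gaussWeight_mul_inv e i₀ c₀).const_mul _
        rw [lintegral_mul_const' _ _ hI, lintegral_add_left (hm _ _),
          lintegral_const_mul' _ _ (ENNReal.mul_ne_top ENNReal.coe_ne_top hQt),
          lintegral_const_mul' _ _ (ENNReal.mul_ne_top ENNReal.coe_ne_top hQt)]
        simp only [J, E]
        ring

end IsTwoGroupBlockCode

end STBC

end

/-! ### Assembly of the theorem -/

theorem mainTheorem6 (m M : ℕ) (hm : 2 ≤ m) (hM : 1 ≤ M) :
    (∃ A, STBC.IsTwoGroupBlockCode (2 ^ (m - 1)) A) ∧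
    ∀ A, STBC.IsTwoGroupBlockCode (2 ^ (m - 1)) A →
      -- the rate is `N / 4 + 1 / N` with `N = 2 ^ m`
      STBC.rate A = (2 : ℚ) ^ m / 4 + 1 / (2 : ℚ) ^ m ∧
      -- the ranks of the two group submatrices and of the whole equivalent channel matrix
      (∀ᵐ H ∂STBC.gaussianMatrix (Fin (2 ^ (m - 1)) ⊕ Fin (2 ^ (m - 1))) (Fin M),
        ((STBC.equivChannel (A ∘ Sum.inl) (Matrix.of H)).rank : ℤ)
            = STBC.f (2 ^ (m - 1)) M + 1 ∧
        ((STBC.equivChannel (A ∘ Sum.inr) (Matrix.of H)).rank : ℤ)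
            = STBC.f (2 ^ (m - 1)) M + 1 ∧
        ((STBC.equivChannel A (Matrix.of H)).rank : ℚ)
            = 2 * (((2 : ℚ) ^ m) ^ 2 / 4 - (max ((2 : ℚ) ^ m / 2 - M) 0) ^ 2 + 1)) ∧
      -- singularity for `⌈R⌉ ≤ M < N / 2`
      (⌈STBC.rate A⌉ ≤ (M : ℤ) → (M : ℚ) < (2 : ℚ) ^ m / 2 → STBC.IsSingular A M) ∧
      -- group-wise sphere decoding is ML decoding and has the asserted average complexity
      ∀ Θ₁ Θ₂ : Matrix (Fin ((2 ^ (m - 1)) ^ 2 + 1)) (Fin ((2 ^ (m - 1)) ^ 2 + 1)) ℝ,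
        IsUnit Θ₁.det → IsUnit Θ₂.det → ∀ ρ₀ : ℝ, 0 < ρ₀ →
        (∀ (H : Matrix (Fin (2 ^ (m - 1)) ⊕ Fin (2 ^ (m - 1))) (Fin M) ℂ)
            (D₁ : STBC.PivotedQR (STBC.equivChannel (A ∘ Sum.inl) H * Θ₁))
            (D₂ : STBC.PivotedQR (STBC.equivChannel (A ∘ Sum.inr) H * Θ₂))
            (Y : Matrix (Fin (2 ^ (m - 1)) ⊕ Fin (2 ^ (m - 1))) (Fin M) ℂ)
            (S : Finset ℤ), S.Nonempty →
          (D₁.outputs (STBC.vecTilde Y) S ρ₀).Nonempty ∧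
          (D₂.outputs (STBC.vecTilde Y) S ρ₀).Nonempty ∧
          ∀ s₁ ∈ D₁.outputs (STBC.vecTilde Y) S ρ₀, ∀ s₂ ∈ D₂.outputs (STBC.vecTilde Y) S ρ₀,
            (∀ i, s₁ i ∈ S) ∧ (∀ i, s₂ i ∈ S) ∧
            ∀ s₁' s₂' : Fin ((2 ^ (m - 1)) ^ 2 + 1) → ℤ, (∀ i, s₁' i ∈ S) → (∀ i, s₂' i ∈ S) →
              STBC.frobSq (Y - STBC.codeword A (STBC.latticeSymbols Θ₁ Θ₂ s₁ s₂) * H)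
              ≤ STBC.frobSq (Y - STBC.codeword A (STBC.latticeSymbols Θ₁ Θ₂ s₁' s₂') * H)) ∧
        ∃ C : ℝ≥0,
          ∀ (D₁ : ∀ H : Fin (2 ^ (m - 1)) ⊕ Fin (2 ^ (m - 1)) → Fin M → ℂ,
              STBC.PivotedQR (STBC.equivChannel (A ∘ Sum.inl) (Matrix.of H) * Θ₁))
            (D₂ : ∀ H : Fin (2 ^ (m - 1)) ⊕ Fin (2 ^ (m - 1)) → Fin M → ℂ,
              STBC.PivotedQR (STBC.equivChannel (A ∘ Sum.inr) (Matrix.of H) * Θ₂))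
            (S : Finset ℤ), S.Nonempty →
          ∀ s₁ s₂ : Fin ((2 ^ (m - 1)) ^ 2 + 1) → ℤ, (∀ i, s₁ i ∈ S) → (∀ i, s₂ i ∈ S) →
            ∫⁻ H, ∫⁻ W,
              (((D₁ H).steps (STBC.vecTilde (STBC.codeword A
                  (STBC.latticeSymbols Θ₁ Θ₂ s₁ s₂) * Matrix.of H + Matrix.of W)) S ρ₀
                + (D₂ H).steps (STBC.vecTilde (STBC.codeword A
                  (STBC.latticeSymbols Θ₁ Θ₂ s₁ s₂) * Matrix.of H + Matrix.of W)) S ρ₀ : ℕ) : ℝ≥0∞)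
              ∂STBC.gaussianMatrix (Fin (2 ^ (m - 1)) ⊕ Fin (2 ^ (m - 1))) (Fin M)
              ∂STBC.gaussianMatrix (Fin (2 ^ (m - 1)) ⊕ Fin (2 ^ (m - 1))) (Fin M)
            ≤ (C : ℝ≥0∞) * (S.card : ℝ≥0∞) ^ ((2 ^ m / 2 - M) ^ 2) := by
  obtain ⟨k, rfl⟩ : ∃ k, m = k + 1 := ⟨m - 1, by omega⟩
  have hn : 0 < 2 ^ (k + 1 - 1) := by positivity
  have hM' : 0 < M := hM
  have hpow : (2 : ℚ) ^ (k + 1) = 2 * ((2 ^ (k + 1 - 1) : ℕ) : ℚ) := by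
    rw [Nat.add_sub_cancel, pow_succ]; push_cast; ring
  have hdiv : 2 ^ (k + 1) / 2 = 2 ^ (k + 1 - 1) := by
    rw [Nat.add_sub_cancel, pow_succ, Nat.mul_div_cancel _ two_pos]
  rw [hpow, hdiv]
  -- Beyond `N = 2 * n` with `n` positive, the power of two plays no role.
  generalize 2 ^ (k + 1 - 1) = n at hn ⊢
  have hn' : (n : ℚ) ≠ 0 := by exact_mod_cast hn.ne'
  refine ⟨STBC.exists_isTwoGroupBlockCode hn, fun A hA => ⟨?_, ?_, ?_, ?_⟩⟩
  · rw [STBC.IsTwoGroupBlockCode.rate_eq]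
    field_simp
    ring
  · filter_upwards [hA.ae_rank_eq hn hM'] with H hH
    have hf := STBC.IsTwoGroupBlockCode.f_add_one (n := n) (M := M)
    refine ⟨by rw [hH.1, hf], by rw [hH.2, hf], ?_⟩
    rw [hA.twoGroup.rank_eq, hH.1, hH.2, Nat.cast_add, ← two_mul]
    have hq := congrArg (Int.cast : ℤ → ℚ) hf
    rw [Int.cast_natCast] at hq
    rw [← hq, STBC.f, mul_div_cancel_left₀ _ (two_ne_zero' ℚ)]
    push_cast
    ring
  · intro hrate hMn
    rw [mul_div_cancel_left₀ _ (two_ne_zero' ℚ)] at hMn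
    exact hA.isSingular hM' hrate (by exact_mod_cast hMn)
  · intro Θ₁ Θ₂ hΘ₁ hΘ₂ ρ₀ hρ₀
    refine ⟨fun H D₁ D₂ Y S hS => ⟨D₁.outputs_nonempty _ hS hρ₀, D₂.outputs_nonempty _ hS hρ₀,
      fun s₁ hs₁ s₂ hs₂ => hA.isMLEstimate D₁ D₂ Y S hs₁ hs₂⟩, ?_⟩
    obtain ⟨C, hC⟩ := hA.exists_lintegral_steps_le hn hM' hΘ₁ hΘ₂ hρ₀
    exact ⟨C, fun D₁ D₂ S _ s₁ s₂ => hC D₁ D₂ S s₁ s₂⟩
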